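/- **Lemma (PTSS Time to Clear Environment).** Let $\mathcal E\subset\mathbb R^2$ be the closed region bounded by a simple polygon with $n\ge 3$ edges and $r$ reflex vertices (interior angle $>\pi$). *PTSS partition and tree.* A *gap* of $\mathcal E$ is a segment $[q,q']$, $q\neq q'$, with $q,q'\in\partial\mathcal E$ and $]q,q'[\subset\operatorname{int}\mathcal E$. Let $\{\mathcal P^{[i]}\}_{i<N}$ be a partition of $\mathcal E$ into compact simply connected star-shaped regions (closures of their interiors) with disjoint interiors, such that any two distinct cells meeting inside $\operatorname{int}\mathcal E$ intersect exactly in a gap, and such that the dual graph (cells adjacent when they share a curve of nonzero length) is a tree. Root this tree at a cell $\mathcal P^{\rm root}$. Agents are at points $p^{[i]}$, where $p^{\rm root}\in\ker\mathcal P^{\rm root}\cap\partial\mathcal E$ and $p^{[k]}\in\mathcal P^{[j]}\cap\mathcal P^{[k]}\cap\ker\mathcal P^{[k]}\cap\partial\mathcal E$ whenever $\mathcal P^{[j]}$ is the parent of $\mathcal P^{[k]}$. Let $h$ be the height (number of edges of a longest branch from the root) of this tree. *PTSS.* Each agent's searchlight sweeps once, monotonically (clockwise or counterclockwise), through the directions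 that lead from $p^{[i]}$ into $\mathcal P^{[i]}$, slewing with constant angular speed $\omega>0$ whenever it is not pausing. The root starts at time $0$, aimed at its start angle. An agent that arrives at the first side of the gap towards a child pauses and calls the child. The child aims along the gap (its start angle) and is switched on, whereupon the parent continues. When the parent arrives at the second side of the gap, the child starts slewing too. A searchlight is switched off when it has reached its finish angle. Communication, processing, and aiming a switched-off searchlight at its start angle take no time. *Clearing.* A point $x$ is illuminated at time $t$ if, for some searchlight that is on, $[p^{[i]},x]\subset\mathcal E$ and $x$ lies on the semi-infinite ray along which it is aimed. Two points are separable at time $t$ if every curve connecting them in $\operatorname{int}\mathcal E$ contains an illuminated point. At time $0$ exactly the non-illuminated points of $\mathcal E$ are contaminated; a point $x$ is contaminated at time $t>0$ iff some $y$, contaminated at some $t'\in[0,t[$ and not illuminated during $[t',t]$, is not separable from $x$ at time $t$ (contamination being generated from time $0$ by finitely many such steps). $\mathcal E$ is clear at time $t$ if none of its points is contaminated. "Cleared within time $T$" means that $\mathcal E$ is clear at every time $t\ge T$. *Deployments.* The visibility set of $p$ is $\mathcal V(p)=\{q:[p,q]\subset\mathcal E\}$. The agents are in final positions of a *Reflex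 Vertex Straddling (RVS) deployment* if, with $R_{\rm root}=\mathcal E$ and, for each other agent $k$, $R_k$ the part of $\mathcal E$ lying across the gap from the cell of the parent of $k$, every cell is $\mathcal P^{[k]}=\overline{\operatorname{int}(\mathcal V(p^{[k]})\cap R_k)}$ and, for every child $k$ of an agent $j$, the gap between their cells is a visibility gap $[a,b]$ of $p^{[j]}$ in $R_j$ (that is, $]a,b[\subset\operatorname{int}R_j$, $[a,b]\subset\partial\mathcal V(p^{[j]})$, $a,b\in\partial R_j$) and $p^{[k]}$ is the end of it furthest from $p^{[j]}$. For an orthogonal polygon (any two consecutive edges perpendicular), the *Ganguli–Cortés–Bullo deployment* places the agents in a PTSS tree as above whose cells are convex quadrilaterals with corners at four distinct vertices of $\mathcal E$. Then, for every such execution of PTSS: 1. $\mathcal E$ is cleared within time $\frac{2\pi}{\omega}(h+1)$, so the time is linear in the height of the PTSS tree; 2. if the agents are in final positions of an RVS deployment, $\mathcal E$ is cleared within time $\frac{2\pi}{\omega}(r+1)$; moreover $\frac{2\pi}{\omega}(r+1)\le\frac{2\pi}{\omega}(n-2)$; 3. if the polygon is orthogonal and the agents are in final positions of an RVS deployment or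 of the Ganguli–Cortés–Bullo deployment, $\mathcal E$ is cleared within time $\frac{\pi}{\omega}(n-2)$. -/

import Mathlib

open Set Topology

namespace PTSS

noncomputable section

/-! ### Simple polygonal environments (the plane is identified with `ℂ`) -/

/-- A closed polygon is simple: its vertices are distinct, two consecutive edges meet only in their
common vertex, and any two other edges are disjoint. -/
structure IsSimple {n : ℕ} (Q : Polygon ℂ n) : Prop where
  injective : Function.Injective Q.vertices
  consecutive : ∀ i, Q.edgeSet ℝ i ∩ Q.edgeSet ℝ (finRotate n i) = {Q (finRotate n i)}
  disjoint : ∀ i j, j ≠ i → j ≠ finRotate n i → i ≠ finRotate n j →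
    Disjoint (Q.edgeSet ℝ i) (Q.edgeSet ℝ j)

/-- The environment bounded by a polygon: the boundary curve together with every point that it
encloses, i.e. that lies in a bounded component of the complement of the curve. -/
def environment {n : ℕ} (Q : Polygon ℂ n) : Set ℂ :=
  Q.boundary ℝ ∪
    {x | x ∉ Q.boundary ℝ ∧ Bornology.IsBounded (connectedComponentIn (Q.boundary ℝ)ᶜ x)}

/-- The unit vector with angle `θ` from the positive horizontal axis. -/
def unit (θ : ℝ) : ℂ := Complex.exp (θ * Complex.I)

/-- The interior angle of `E` at `x`: the measure of the set of directions that lead from `x`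
into `E`. -/
def interiorAngle (E : Set ℂ) (x : ℂ) : ℝ :=
  MeasureTheory.volume.real
    {θ : ℝ | θ ∈ Ioc (-Real.pi) Real.pi ∧ ∃ ε > 0, ∀ ρ ∈ Ioo (0 : ℝ) ε, x + ρ * unit θ ∈ E}

/-- The number of reflex vertices, i.e. vertices with interior angle greater than `π`. -/
def numReflex {n : ℕ} (Q : Polygon ℂ n) : ℕ :=
  {i : Fin n | Real.pi < interiorAngle (environment Q) (Q i)}.ncard

/-- A polygon is orthogonal if any two consecutive edges are perpendicular. -/
def IsOrthogonal {n : ℕ} (Q : Polygon ℂ n) : Prop :=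
  ∀ i, inner ℝ (Q (finRotate n i) - Q i)
    (Q (finRotate n (finRotate n i)) - Q (finRotate n i)) = 0

/-! ### Visibility, gaps, separability, contamination -/

/-- The visibility set of `p` in `E`. -/
def visibilitySet (E : Set ℂ) (p : ℂ) : Set ℂ := {q | q ∈ E ∧ segment ℝ p q ⊆ E}

/-- The kernel of a set. -/
def kernel (S : Set ℂ) : Set ℂ := {p | p ∈ S ∧ ∀ x ∈ S, segment ℝ p x ⊆ S}

/-- `[a, b]` is a gap of `E`. -/
def IsGap (E : Set ℂ) (a b : ℂ) : Prop :=
  a ≠ b ∧ a ∈ frontier E ∧ b ∈ frontier E ∧ openSegment ℝ a b ⊆ interior E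

/-- `[a, b]` is a visibility gap of `p` with respect to the region `R` of `E`. -/
def IsVisibilityGap (E R : Set ℂ) (p a b : ℂ) : Prop :=
  a ≠ b ∧ openSegment ℝ a b ⊆ interior R ∧ segment ℝ a b ⊆ frontier (visibilitySet E p) ∧
    a ∈ frontier R ∧ b ∈ frontier R

/-- `x` and `y` are separable when `L` is the set of illuminated points: every curve connecting
them in the interior of `E` contains an illuminated point. -/
def Separable (E L : Set ℂ) (x y : ℂ) : Prop :=
  ∀ γ : Path x y, (∀ u, γ u ∈ interior E) → ∃ u, γ u ∈ L

/-- `Contaminated E lit t x`: the point `x` is contaminated at time `t ≥ 0`, where `lit s` is the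
set of points illuminated at time `s`. At time zero exactly the points that are not illuminated are
contaminated; `x` is contaminated at `t > 0` iff there is a point `y`, contaminated at some earlier
time `t'`, not illuminated during `[t', t]`, and nonseparable from `x` at time `t`. -/
inductive Contaminated (E : Set ℂ) (lit : ℝ → Set ℂ) : ℝ → ℂ → Prop
  | initial (x : ℂ) (hx : x ∈ E) (hdark : x ∉ lit 0) : Contaminated E lit 0 x
  | spread (t' t : ℝ) (x y : ℂ) (htime : t' < t) (hx : x ∈ E) (hy : Contaminated E lit t' y)
      (hdark : ∀ s ∈ Icc t' t, y ∉ lit s) (hsep : ¬ Separable E (lit t) x y) :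
      Contaminated E lit t x

/-- `E` is clear at time `t`. -/
def IsClear (E : Set ℂ) (lit : ℝ → Set ℂ) (t : ℝ) : Prop := ∀ x ∈ E, ¬ Contaminated E lit t x

/-- The time required to clear `E` is at most `T`: the environment is clear at time `T` and at
every later time. -/
def ClearedBy (E : Set ℂ) (lit : ℝ → Set ℂ) (T : ℝ) : Prop := ∀ t, T ≤ t → IsClear E lit t

/-! ### PTSS partitions and PTSS trees -/

/-- The cells form a partition of `E`: compact simply connected regions (a region is the closure
of its interior) with union `E` and disjoint interiors. -/
structure IsPartition (E : Set ℂ) {N : ℕ} (cell : Fin N → Set ℂ) : Prop where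
  iUnion_eq : ⋃ i, cell i = E
  compact : ∀ i, IsCompact (cell i)
  simplyConnected : ∀ i, SimplyConnectedSpace (cell i)
  region : ∀ i, closure (interior (cell i)) = cell i
  disjoint : ∀ i j, i ≠ j → Disjoint (interior (cell i)) (interior (cell j))

/-- The dual graph: two cells are adjacent if they share a nondegenerate curve. -/
def dualGraph {N : ℕ} (cell : Fin N → Set ℂ) : SimpleGraph (Fin N) where
  Adj i j := i ≠ j ∧ ∃ x y, x ≠ y ∧ JoinedIn (cell i ∩ cell j) x y
  symm := ⟨fun i j h => ⟨h.1.symm, by simpa only [inter_comm] using h.2⟩⟩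
  loopless := ⟨fun _ h => h.1 rfl⟩

/-- `j` is the parent of `k` in the dual graph rooted at `root`. -/
def IsParent {N : ℕ} (cell : Fin N → Set ℂ) (root j k : Fin N) : Prop :=
  (dualGraph cell).Adj j k ∧ (dualGraph cell).dist root k = (dualGraph cell).dist root j + 1

/-- The height (number of edges of a longest branch) of the dual graph rooted at `root`. -/
def height {N : ℕ} (cell : Fin N → Set ℂ) (root : Fin N) : ℕ :=
  Finset.univ.sup fun k => (dualGraph cell).dist root k

/-- `root` may serve as the root of a PTSS partition. -/
def IsRoot (E : Set ℂ) {N : ℕ} (cell : Fin N → Set ℂ) (root : Fin N) : Prop :=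
  (kernel (cell root) ∩ frontier E).Nonempty ∧
    ∀ j k, IsParent cell root j k →
      ((cell j ∩ cell k) ∩ kernel (cell k) ∩ frontier E).Nonempty

/-- PTSS partitions of `E`. Distinct cells that meet inside `E` are separated by a gap. -/
structure IsPTSSPartition (E : Set ℂ) {N : ℕ} (cell : Fin N → Set ℂ) : Prop where
  partition : IsPartition E cell
  separated : ∀ i j, i ≠ j → (cell i ∩ cell j ∩ interior E).Nonempty →
    ∃ a b, IsGap E a b ∧ cell i ∩ cell j = segment ℝ a b
  starShaped : ∀ i, (kernel (cell i)).Nonempty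
  tree : (dualGraph cell).IsTree
  exists_root : ∃ root, IsRoot E cell root

/-- The agents, agent `i` at the point `pos i`, are positioned in a PTSS partition and rooted
PTSS tree. -/
structure IsPTSSTree (E : Set ℂ) {N : ℕ} (cell : Fin N → Set ℂ) (root : Fin N)
    (pos : Fin N → ℂ) : Prop where
  partition : IsPTSSPartition E cell
  isRoot : IsRoot E cell root
  pos_root : pos root ∈ kernel (cell root) ∩ frontier E
  pos_child : ∀ j k, IsParent cell root j k →
    pos k ∈ (cell j ∩ cell k) ∩ kernel (cell k) ∩ frontier E

/-! ### Executions of PTSS -/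

/-- The semi-infinite ray from `p` with angle `θ`. -/
def ray (p : ℂ) (θ : ℝ) : Set ℂ := {x | ∃ ρ : ℝ, 0 ≤ ρ ∧ x = p + ρ * unit θ}

/-- An execution of PTSS with angular speed `ω`, communication and processing taking no time.

Agent `i` slews from the angle `start i` through the total angle `total i` in the rotational
direction `sign i` (counterclockwise `1`, clockwise `-1`); `swept i t` is the angle through which
it has slewed at time `t`. It aims at its start angle and is switched on at time `engaged i`,
starts slewing at time `released i`, and is switched off at time `finished i`. When agent `j` is
the parent of agent `k`, then `first k` and `last k` are the angles (measured from the start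
angle of `j`) at which the beam of `j` meets the first and the second side of the gap towards `k`;
agent `j` pauses at the first side from the time `reach k` to the time `resume k`. -/
structure Execution (E : Set ℂ) {N : ℕ} (cell : Fin N → Set ℂ) (root : Fin N)
    (pos : Fin N → ℂ) (ω : ℝ) where
  start : Fin N → ℝ
  sign : Fin N → ℝ
  total : Fin N → ℝ
  first : Fin N → ℝ
  last : Fin N → ℝ
  engaged : Fin N → ℝ
  released : Fin N → ℝ
  finished : Fin N → ℝ
  reach : Fin N → ℝ
  resume : Fin N → ℝ
  swept : Fin N → ℝ → ℝ
  sign_eq : ∀ i, sign i = 1 ∨ sign i = -1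
  total_mem : ∀ i, total i ∈ Ico 0 (2 * Real.pi)
  /-- The directions from start to finish are exactly those that lead into the agent's cell. -/
  sweep_into : ∀ i, ∀ s ∈ Icc 0 (total i),
    ∃ ρ : ℝ, 0 < ρ ∧ pos i + ρ * unit (start i + sign i * s) ∈ cell i
  sweep_covers : ∀ i, ∀ x ∈ cell i, ∃ s ∈ Icc 0 (total i), x ∈ ray (pos i) (start i + sign i * s)
  /-- At its start angle a child is aimed across the gap that separates it from its parent. -/
  start_child : ∀ j k, IsParent cell root j k → cell j ∩ cell k ⊆ ray (pos k) (start k)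
  first_isLeast : ∀ j k, IsParent cell root j k →
    IsLeast {s | s ∈ Icc 0 (total j) ∧
      ∃ ρ : ℝ, 0 < ρ ∧ pos j + ρ * unit (start j + sign j * s) ∈ cell j ∩ cell k} (first k)
  last_isGreatest : ∀ j k, IsParent cell root j k →
    IsGreatest {s | s ∈ Icc 0 (total j) ∧
      ∃ ρ : ℝ, 0 < ρ ∧ pos j + ρ * unit (start j + sign j * s) ∈ cell j ∩ cell k} (last k)
  /-- The root begins at time zero. -/
  engaged_root : engaged root = 0
  released_root : released root = 0
  /-- The parent stops when it arrives at the first side of the gap and calls the child. -/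
  reach_isLeast : ∀ j k, IsParent cell root j k →
    IsLeast {t | released j ≤ t ∧ first k ≤ swept j t} (reach k)
  /-- The child, once called, aims across the gap and is switched on. -/
  engaged_child : ∀ j k, IsParent cell root j k → engaged k = reach k
  /-- The parent continues once the child has confirmed that it is aimed across the gap. -/
  resume_child : ∀ j k, IsParent cell root j k → resume k = engaged k
  /-- The child is told to begin slewing when the parent arrives at the second side of the gap. -/
  released_child : ∀ j k, IsParent cell root j k →
    IsLeast {t | released j ≤ t ∧ last k ≤ swept j t} (released k)
  /-- The searchlight is switched off when it arrives at its finish angle. -/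
  finished_isLeast : ∀ i, IsLeast {t | released i ≤ t ∧ total i ≤ swept i t} (finished i)
  /-- An agent stays aimed at its start angle until it begins slewing. -/
  hold : ∀ i, ∀ t ∈ Icc (engaged i) (released i), swept i t = 0
  /-- An agent slews with angular speed `ω` whenever it does not pause. -/
  slew : ∀ i t₁ t₂, released i ≤ t₁ → t₁ ≤ t₂ → t₂ ≤ finished i →
    (∀ k, IsParent cell root i k → Disjoint (Ico t₁ t₂) (Ico (reach k) (resume k))) →
    swept i t₂ - swept i t₁ = ω * (t₂ - t₁)
  /-- During a pause the searchlight does not move. -/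
  pause : ∀ i k, IsParent cell root i k → ∀ t ∈ Icc (reach k) (resume k),
    swept i t = swept i (reach k)

/-- The set of points illuminated at time `t`: those on the ray of a searchlight that is on. -/
def Execution.lit {E : Set ℂ} {N : ℕ} {cell : Fin N → Set ℂ} {root : Fin N} {pos : Fin N → ℂ}
    {ω : ℝ} (X : Execution E cell root pos ω) (t : ℝ) : Set ℂ :=
  {x | ∃ i, t ∈ Icc (X.engaged i) (X.finished i) ∧
    x ∈ visibilitySet E (pos i) ∩ ray (pos i) (X.start i + X.sign i * X.swept i t)}

/-! ### The two deployments -/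

/-- The part of `E` that lies across the gap `g` from the region `S`: the closure of the set of
points of the interior of `E` that the gap cuts off from `S`. -/
def regionAcross (E g S : Set ℂ) : Set ℂ :=
  closure {x | x ∈ interior E \ g ∧ ∀ y ∈ S, ¬ JoinedIn (interior E \ g) x y}

/-- The region served by agent `k` and its descendants in a Reflex Vertex Straddling deployment:
all of `E` for the root, and for other agents the part of `E` across the gap to the parent. -/
def rvsRegion (E : Set ℂ) {N : ℕ} (cell : Fin N → Set ℂ) (root k : Fin N) : Set ℂ :=
  {x | x ∈ E ∧ ∀ j, IsParent cell root j k → x ∈ regionAcross E (cell j ∩ cell k) (cell j)}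

/-- Final positions of a Reflex Vertex Straddling deployment: the cell of an agent is the part of
its visibility set in its region (lower-dimensional whiskers of visibility sets being ignored),
and its children sit at the furthest ends of its visibility gaps in that region. -/
structure IsRVS (E : Set ℂ) {N : ℕ} (cell : Fin N → Set ℂ) (root : Fin N)
    (pos : Fin N → ℂ) : Prop where
  cell_eq : ∀ k,
    cell k = closure (interior (visibilitySet E (pos k) ∩ rvsRegion E cell root k))
  child : ∀ j k, IsParent cell root j k → ∃ a,
    cell j ∩ cell k = segment ℝ a (pos k) ∧
    IsVisibilityGap E (rvsRegion E cell root j) (pos j) a (pos k) ∧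
    dist (pos j) a ≤ dist (pos j) (pos k)

/-- Every cell is a convex quadrilateral with its corners at vertices of the polygon. -/
def IsQuadrilateralPartition {n N : ℕ} (Q : Polygon ℂ n) (cell : Fin N → Set ℂ) : Prop :=
  ∀ i, ∃ f : Fin 4 → Fin n, Function.Injective f ∧
    cell i = convexHull ℝ (range fun m => Q (f m))

end

end PTSS

/-! Timing. Calling and aiming take no time, so every pause has length zero and an agent, once
released, turns at speed ω until it finishes. A child is released after its parent has turned
through less than 2π, so by induction on depth all agents finish before 2π(h+1)/ω.

Clearing. A point of a cell gets a sweep time from the agent of that cell. The invariant is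
`Execution.contaminated_lt`: a contaminated point has, in some cell containing it, a sweep time that
has not passed. For contamination to spread, an unlit curve in the interior must join the two
points. The conditions "sweep time still ahead" and "sweep time already past" are closed and cover
the curve. A curve point satisfying both lies on a gap: angles within one cell are unique, and the
parent sweeps a gap point at some time between the calling and the release of the child, which
itself sweeps it at its release. Throughout that interval the child's beam lies along the gap, so
such a point is lit (`Execution.mem_lit_of_lt_of_lt`). By connectedness the whole curve stays ahead
of the sweep. Thus the environment is clear once all agents have finished. The remaining bounds are
counts, through h < N.

RVS deployments. A visibility gap must be aligned with the observer, and its near end then has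
interior angle greater than π, hence is a reflex vertex (`IsRVS.exists_gap`, `pi_lt_interiorAngle`,
`IsSimple.interiorAngle_le_pi`). Different children get different vertices, so N ≤ r + 1
(`IsRVS.le_numReflex`). At least three vertices, being extreme in some direction, are not reflex, so
r + 3 ≤ n.

Orthogonal polygons. Hopf's secant argument gives turning number ±1 (`sum_turn_eq`), so right and
left turns differ by four in number. The environment lies on one fixed side of the boundary
(`IsSimple.offset_mem_iff`), which decides which turns are the inward ones (set `R`), whence 2|R| +
4 = n and 2r + 4 ≤ n. With N ≤ r + 1 this settles RVS.

Quadrilaterals. Angle sums are replaced by a count of directions: fix a generic direction and its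
quarter turns. At least four pairs (corner, direction) enter each quadrilateral, while at most one
direction enters the environment at a vertex outside `R` and at most three at a vertex in `R`. Hence
4N ≤ n + 2|R| = 2n - 4, that is 2(h+1) ≤ 2N ≤ n - 2. -/

namespace PTSS

/-! ### Parents, depth and height in the dual tree -/

section Tree

variable {N : ℕ} {cell : Fin N → Set ℂ} {root : Fin N}

theorem exists_parent (hT : (dualGraph cell).IsTree) {k : Fin N} (hk : k ≠ root) :
    ∃ j, IsParent cell root j k := by
  obtain ⟨p, hp⟩ := (hT.connected k root).exists_walk_length_eq_dist
  cases p with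
  | nil => exact absurd rfl hk
  | @cons _ v _ h q =>
    refine ⟨v, h.symm, ?_⟩
    have h1 : (dualGraph cell).dist v root ≤ q.length := SimpleGraph.dist_le q
    rw [SimpleGraph.Walk.length_cons] at hp
    rw [SimpleGraph.dist_comm (u := root), SimpleGraph.dist_comm (u := root)]
    rcases hT.dist_eq_dist_add_one_of_adj root h with h2 | h2
    · rw [SimpleGraph.dist_comm (u := root), SimpleGraph.dist_comm (u := root)] at h2
      exact h2
    · rw [SimpleGraph.dist_comm (u := root), SimpleGraph.dist_comm (u := root)] at h2
      omega

theorem isParent_or_isParent (hT : (dualGraph cell).IsTree) {j k : Fin N}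
    (h : (dualGraph cell).Adj j k) : IsParent cell root j k ∨ IsParent cell root k j := by
  rcases hT.dist_eq_dist_add_one_of_adj root h with h2 | h2
  · exact Or.inr ⟨h.symm, h2⟩
  · exact Or.inl ⟨h, h2⟩

/-- In a tree the distances from a fixed vertex to two adjacent vertices differ by exactly one,
whereas both distances from `i` would be 1. This is what excludes a third cell at an inner point of
a gap, and two children sharing part of a gap. -/
theorem not_triangle (hT : (dualGraph cell).IsTree) {i j k : Fin N}
    (h₁ : (dualGraph cell).Adj i j) (h₂ : (dualGraph cell).Adj j k)
    (h₃ : (dualGraph cell).Adj i k) : False := by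
  have a := hT.dist_eq_dist_add_one_of_adj i h₂
  rw [SimpleGraph.dist_eq_one_iff_adj.2 h₁, SimpleGraph.dist_eq_one_iff_adj.2 h₃] at a
  omega

theorem dist_le_height (k : Fin N) : (dualGraph cell).dist root k ≤ height cell root :=
  Finset.le_sup (f := fun k => (dualGraph cell).dist root k) (Finset.mem_univ k)

theorem height_lt (hT : (dualGraph cell).IsTree) : height cell root < N := by
  have hN : 0 < N := root.pos
  refine (Finset.sup_lt_iff (by simpa using hN)).2 fun k _ => ?_
  obtain ⟨p, hp, hl⟩ := (hT.connected root k).exists_path_of_dist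
  have := hp.length_lt
  rw [Fintype.card_fin] at this
  omega

end Tree

/-! ### The schedule of the sweeps -/

section Timing

variable {E : Set ℂ} {N : ℕ} {cell : Fin N → Set ℂ} {root : Fin N} {pos : Fin N → ℂ} {ω : ℝ}

theorem Execution.engaged_le_released (X : Execution E cell root pos ω)
    (hT : (dualGraph cell).IsTree) (i : Fin N) : X.engaged i ≤ X.released i := by
  by_cases hi : i = root
  · rw [hi, X.engaged_root, X.released_root]
  · obtain ⟨j, hj⟩ := exists_parent hT hi
    rw [X.engaged_child j i hj]
    refine (X.reach_isLeast j i hj).2 ⟨(X.released_child j i hj).1.1, le_trans ?_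
      (X.released_child j i hj).1.2⟩
    exact (X.first_isLeast j i hj).2 (X.last_isGreatest j i hj).1

theorem Execution.swept_released (X : Execution E cell root pos ω)
    (hT : (dualGraph cell).IsTree) (i : Fin N) : X.swept i (X.released i) = 0 :=
  X.hold i _ ⟨X.engaged_le_released hT i, le_rfl⟩

/-- Since `resume k = engaged k = reach k`, each pause is an empty half-open interval, and the
slewing law applies from the release onwards without interruption. -/
theorem Execution.swept_eq (X : Execution E cell root pos ω) (hT : (dualGraph cell).IsTree)
    {i : Fin N} {t : ℝ} (h₁ : X.released i ≤ t) (h₂ : t ≤ X.finished i) :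
    X.swept i t = ω * (t - X.released i) := by
  have := X.slew i (X.released i) t le_rfl h₁ h₂ fun k hk => by
    rw [X.resume_child i k hk, X.engaged_child i k hk]; simp
  rw [X.swept_released hT i, sub_zero] at this
  exact this

theorem Execution.finished_eq (X : Execution E cell root pos ω) (hT : (dualGraph cell).IsTree)
    (hω : 0 < ω) (i : Fin N) : X.finished i = X.released i + X.total i / ω := by
  have h0 : 0 ≤ X.total i / ω := div_nonneg (X.total_mem i).1 hω.le
  have hf := (X.finished_isLeast i).1
  have h1 := X.swept_eq hT hf.1 le_rfl
  -- The speed law is known only up to `finished i`. This inequality must come first, so that the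
  -- law may be evaluated at the candidate time.
  have h2 : X.released i + X.total i / ω ≤ X.finished i := by
    have := hf.2
    rw [h1] at this
    have := (div_le_iff₀' hω).2 this
    linarith
  refine le_antisymm ((X.finished_isLeast i).2 ⟨by simpa using h0, ?_⟩) h2
  rw [X.swept_eq hT (by simpa using h0) h2]
  apply le_of_eq
  field_simp
  ring

/-- The first time at which an agent has slewed through the angle `s`. -/
theorem Execution.isLeast_eq (X : Execution E cell root pos ω) (hT : (dualGraph cell).IsTree)
    (hω : 0 < ω) {i : Fin N} {s t : ℝ} (hs : s ∈ Icc 0 (X.total i))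
    (h : IsLeast {t | X.released i ≤ t ∧ s ≤ X.swept i t} t) : t = X.released i + s / ω := by
  have h0 : 0 ≤ s / ω := div_nonneg hs.1 hω.le
  have hle : X.released i + s / ω ≤ X.finished i := by
    rw [X.finished_eq hT hω]
    have := div_le_div_of_nonneg_right hs.2 hω.le
    linarith
  have hmem : X.released i + s / ω ∈ {t | X.released i ≤ t ∧ s ≤ X.swept i t} := by
    refine ⟨by simpa using h0, ?_⟩
    rw [X.swept_eq hT (by simpa using h0) hle]
    apply le_of_eq
    field_simp
    ring
  refine le_antisymm (h.2 hmem) ?_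
  have h1 := h.1.2
  rw [X.swept_eq hT h.1.1 ((h.2 hmem).trans hle)] at h1
  have := (div_le_iff₀' hω).2 h1
  linarith

theorem Execution.engaged_child_eq (X : Execution E cell root pos ω)
    (hT : (dualGraph cell).IsTree) (hω : 0 < ω) {j k : Fin N} (h : IsParent cell root j k) :
    X.engaged k = X.released j + X.first k / ω := by
  rw [X.engaged_child j k h]
  exact X.isLeast_eq hT hω (X.first_isLeast j k h).1.1 (X.reach_isLeast j k h)

theorem Execution.released_child_eq (X : Execution E cell root pos ω)
    (hT : (dualGraph cell).IsTree) (hω : 0 < ω) {j k : Fin N} (h : IsParent cell root j k) :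
    X.released k = X.released j + X.last k / ω :=
  X.isLeast_eq hT hω (X.last_isGreatest j k h).1.1 (X.released_child j k h)

/-- Each step down the tree delays the release by `last k / ω`, which is at most one full turn. -/
theorem Execution.released_mem (X : Execution E cell root pos ω)
    (hT : (dualGraph cell).IsTree) (hω : 0 < ω) (i : Fin N) :
    X.released i ∈ Icc 0 (2 * Real.pi / ω * ((dualGraph cell).dist root i : ℝ)) := by
  induction hd : (dualGraph cell).dist root i generalizing i with
  | zero =>
    have : i = root := ((hT.connected.dist_eq_zero_iff).1 hd).symm
    rw [this, X.released_root]
    simp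
  | succ d ih =>
    have hi : i ≠ root := by rintro rfl; simp at hd
    obtain ⟨j, hj⟩ := exists_parent hT hi
    have hj' := ih j (by have := hj.2; omega)
    have hl := (X.last_isGreatest j i hj).1.1
    rw [X.released_child_eq hT hω hj]
    have h0 : 0 ≤ X.last i / ω := div_nonneg hl.1 hω.le
    have h1 : X.last i / ω ≤ 2 * Real.pi / ω :=
      div_le_div_of_nonneg_right (hl.2.trans (X.total_mem j).2.le) hω.le
    constructor
    · linarith [hj'.1]
    · push_cast
      linarith [hj'.2]

theorem Execution.finished_lt (X : Execution E cell root pos ω)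
    (hT : (dualGraph cell).IsTree) (hω : 0 < ω) (i : Fin N) :
    X.finished i < 2 * Real.pi / ω * ((height cell root : ℝ) + 1) := by
  have h1 := (X.released_mem hT hω i).2
  have h2 : X.total i / ω < 2 * Real.pi / ω :=
    div_lt_div_of_pos_right (X.total_mem i).2 hω
  have h3 : ((dualGraph cell).dist root i : ℝ) ≤ height cell root := by
    exact_mod_cast dist_le_height i
  have h4 : 0 < 2 * Real.pi / ω := by positivity
  have h5 := mul_le_mul_of_nonneg_left h3 h4.le
  rw [X.finished_eq hT hω]
  linarith

end Timing

/-! ### Contamination stays ahead of the sweep -/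

section Clearing

theorem norm_unit (θ : ℝ) : ‖unit θ‖ = 1 := by
  simp [unit, Complex.norm_exp_ofReal_mul_I]

theorem continuous_unit : Continuous unit := by
  unfold unit; fun_prop

theorem mem_ray_iff {p x : ℂ} {θ : ℝ} : x ∈ ray p θ ↔ x - p = ‖x - p‖ * unit θ := by
  constructor
  · rintro ⟨ρ, hρ, rfl⟩
    simp [norm_unit, abs_of_nonneg hρ]
  · intro h
    exact ⟨‖x - p‖, norm_nonneg _, by rw [← h]; ring⟩

theorem unit_eq_unit_iff {a b : ℝ} : unit a = unit b ↔ ∃ m : ℤ, a = b + m * (2 * Real.pi) := by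
  unfold unit
  rw [Complex.exp_eq_exp_iff_exists_int]
  refine exists_congr fun m => ?_
  rw [← Complex.ofReal_inj]
  push_cast
  constructor
  · intro h
    apply mul_right_cancel₀ Complex.I_ne_zero
    rw [h]; ring
  · intro h
    rw [h]; ring

/-- Equal rays have angles congruent modulo 2π, and a sweep covers less than a full turn. So an
agent passes over a given point at only one angle. -/
theorem eq_of_mem_ray {p x : ℂ} {θ σ s s' T : ℝ} (hx : x ≠ p) (hσ : σ = 1 ∨ σ = -1)
    (hT : T < 2 * Real.pi) (hs : s ∈ Icc 0 T) (hs' : s' ∈ Icc 0 T)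
    (h : x ∈ ray p (θ + σ * s)) (h' : x ∈ ray p (θ + σ * s')) : s = s' := by
  rw [mem_ray_iff] at h h'
  have hn : (‖x - p‖ : ℂ) ≠ 0 := by
    simpa using sub_ne_zero.2 hx
  have hu : unit (θ + σ * s) = unit (θ + σ * s') :=
    mul_left_cancel₀ hn (h.symm.trans h')
  obtain ⟨m, hm⟩ := unit_eq_unit_iff.1 hu
  have hpi := Real.pi_pos
  have hm2 : |s - s'| = |(m : ℝ)| * (2 * Real.pi) := by
    have : σ * (s - s') = m * (2 * Real.pi) := by linarith
    have h2 := congrArg abs this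
    rw [abs_mul, abs_mul, abs_of_pos (by positivity : 0 < 2 * Real.pi)] at h2
    rcases hσ with rfl | rfl <;> simpa using h2
  have hlt : |s - s'| < 2 * Real.pi := by
    rw [abs_lt]; constructor <;> linarith [hs.1, hs.2, hs'.1, hs'.2]
  have hm0 : m = 0 := by
    by_contra hne
    have : (1 : ℝ) ≤ |(m : ℝ)| := by exact_mod_cast Int.one_le_abs hne
    nlinarith
  rw [hm0] at hm2
  simp only [Int.cast_zero, abs_zero, zero_mul, abs_eq_zero] at hm2
  linarith

/-- The sector is the projection of a closed subset of `ℂ × S` along the compact factor `S`. -/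
theorem isClosed_sweep (p : ℂ) (θ σ : ℝ) {S : Set ℝ} (hS : IsCompact S) :
    IsClosed {x : ℂ | ∃ s ∈ S, x ∈ ray p (θ + σ * s)} := by
  have : {x : ℂ | ∃ s ∈ S, x ∈ ray p (θ + σ * s)} =
      Prod.fst '' ((univ ×ˢ S) ∩ {q : ℂ × ℝ | q.1 - p = ‖q.1 - p‖ * unit (θ + σ * q.2)}) := by
    ext x
    simp only [mem_ofPred_eq, mem_ray_iff, mem_image, Prod.exists, mem_inter_iff, mem_prod, mem_univ,
      true_and]
    constructor
    · rintro ⟨s, hs, h⟩; exact ⟨x, s, ⟨hs, h⟩, rfl⟩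
    · rintro ⟨x, s, ⟨hs, h⟩, rfl⟩; exact ⟨s, hs, h⟩
  rw [this]
  have hcl : IsClosed {q : ℂ × ℝ | q.1 - p = ‖q.1 - p‖ * unit (θ + σ * q.2)} := by
    have := continuous_unit
    exact isClosed_eq (by fun_prop) (by fun_prop)
  have h2 : Prod.fst '' ((univ ×ˢ S) ∩ {q : ℂ × ℝ | q.1 - p = ‖q.1 - p‖ * unit (θ + σ * q.2)}) =
      Prod.fst '' ((fun q : ℂ × S => ((q.1, (q.2 : ℝ)) : ℂ × ℝ)) ⁻¹'
        {q : ℂ × ℝ | q.1 - p = ‖q.1 - p‖ * unit (θ + σ * q.2)}) := by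
    ext x
    simp
  rw [h2]
  have hcs : CompactSpace S := isCompact_iff_compactSpace.1 hS
  exact isClosedMap_fst_of_compactSpace _ (hcl.preimage (by fun_prop))

variable {E : Set ℂ} {N : ℕ} {cell : Fin N → Set ℂ} {root : Fin N} {pos : Fin N → ℂ} {ω : ℝ}

theorem IsPTSSPartition.cell_subset (h : IsPTSSPartition E cell) (i : Fin N) : cell i ⊆ E := by
  rw [← h.partition.iUnion_eq]; exact subset_iUnion _ i

theorem IsPTSSPartition.adj_of_mem (h : IsPTSSPartition E cell) {i j : Fin N} (hij : i ≠ j) {z : ℂ}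
    (hz : z ∈ interior E) (hi : z ∈ cell i) (hj : z ∈ cell j) : (dualGraph cell).Adj i j := by
  obtain ⟨a, b, hg, hab⟩ := h.separated i j hij ⟨z, ⟨hi, hj⟩, hz⟩
  refine ⟨hij, a, b, hg.1, ?_⟩
  rw [hab]
  exact JoinedIn.of_segment_subset subset_rfl

theorem IsPTSSTree.pos_mem (h : IsPTSSTree E cell root pos) (i : Fin N) :
    pos i ∈ kernel (cell i) ∩ frontier E := by
  by_cases hi : i = root
  · rw [hi]; exact h.pos_root
  · obtain ⟨j, hj⟩ := exists_parent h.partition.tree hi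
    exact ⟨(h.pos_child j i hj).1.2, (h.pos_child j i hj).2⟩

theorem IsPTSSTree.pos_notMem_interior (h : IsPTSSTree E cell root pos) (i : Fin N) :
    pos i ∉ interior E := fun hi => (h.pos_mem i).2.2 hi

/-- The time `released i + s / ω` is the sweep time of `x` in the cell `i`; the point is visible
because the agent stands in the kernel of its cell. -/
theorem Execution.mem_lit (X : Execution E cell root pos ω) (hE : IsPTSSTree E cell root pos)
    (hω : 0 < ω) {i : Fin N} {x : ℂ} {s : ℝ} (hx : x ∈ cell i) (hs : s ∈ Icc 0 (X.total i))
    (hr : x ∈ ray (pos i) (X.start i + X.sign i * s)) :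
    x ∈ X.lit (X.released i + s / ω) := by
  have h0 : 0 ≤ s / ω := div_nonneg hs.1 hω.le
  have hle : X.released i + s / ω ≤ X.finished i := by
    rw [X.finished_eq hE.partition.tree hω]
    have := div_le_div_of_nonneg_right hs.2 hω.le
    linarith
  have he := X.engaged_le_released hE.partition.tree i
  refine ⟨i, ⟨by linarith, hle⟩, ⟨hE.partition.cell_subset i hx,
    ((hE.pos_mem i).1.2 x hx).trans (hE.partition.cell_subset i)⟩, ?_⟩
  rw [X.swept_eq hE.partition.tree (by linarith) hle]
  convert hr using 3
  field_simp
  ring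

theorem Execution.mem_lit_of_gap (X : Execution E cell root pos ω)
    (hE : IsPTSSTree E cell root pos) {j k : Fin N} (h : IsParent cell root j k)
    {x : ℂ} (hxj : x ∈ cell j) (hxk : x ∈ cell k) {t : ℝ}
    (ht : t ∈ Icc (X.engaged k) (X.released k)) : x ∈ X.lit t := by
  refine ⟨k, ⟨ht.1, ht.2.trans ?_⟩, ⟨hE.partition.cell_subset k hxk,
    ((hE.pos_mem k).1.2 x hxk).trans (hE.partition.cell_subset k)⟩, ?_⟩
  · exact (X.finished_isLeast k).1.1
  · rw [X.hold k t ht, mul_zero, add_zero]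
    exact X.start_child j k h ⟨hxj, hxk⟩

/-- A point of the interior that lies in two cells and is swept by one of the two searchlights
before time `t` and by the other after time `t` is illuminated at time `t`. -/
theorem Execution.mem_lit_of_lt_of_lt (X : Execution E cell root pos ω)
    (hE : IsPTSSTree E cell root pos) (hω : 0 < ω) {i i' : Fin N} {x : ℂ} {s s' t : ℝ}
    (hxE : x ∈ interior E) (hx : x ∈ cell i) (hx' : x ∈ cell i')
    (hs : s ∈ Icc 0 (X.total i)) (hs' : s' ∈ Icc 0 (X.total i'))
    (hr : x ∈ ray (pos i) (X.start i + X.sign i * s))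
    (hr' : x ∈ ray (pos i') (X.start i' + X.sign i' * s'))
    (ht : t < X.released i + s / ω) (ht' : X.released i' + s' / ω < t) : x ∈ X.lit t := by
  have hne : ∀ i, x ≠ pos i := fun i h => hE.pos_notMem_interior i (h ▸ hxE)
  by_cases hii : i = i'
  · subst hii
    have := eq_of_mem_ray (hne i) (X.sign_eq i) (X.total_mem i).2 hs hs' hr hr'
    subst this
    linarith
  -- On a gap the parent's sweep time lies between the calling and the release of the child, and the
  -- child's own sweep time is exactly its release, since it starts aimed along the gap.
  have key : ∀ j k, IsParent cell root j k → x ∈ cell j → x ∈ cell k → ∀ s ∈ Icc 0 (X.total j),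
      ∀ s' ∈ Icc 0 (X.total k), x ∈ ray (pos j) (X.start j + X.sign j * s) →
      x ∈ ray (pos k) (X.start k + X.sign k * s') →
      X.engaged k ≤ X.released j + s / ω ∧ X.released j + s / ω ≤ X.released k ∧ s' = 0 := by
    intro j k hjk hj hk s hs s' hs' hr hr'
    have hpos : ∃ ρ : ℝ, 0 < ρ ∧ pos j + ρ * unit (X.start j + X.sign j * s) ∈ cell j ∩ cell k := by
      obtain ⟨ρ, hρ, hxρ⟩ := hr
      refine ⟨ρ, lt_of_le_of_ne hρ ?_, by rw [← hxρ]; exact ⟨hj, hk⟩⟩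
      rintro rfl
      exact hne j (by simpa using hxρ)
    have h1 := (X.first_isLeast j k hjk).2 ⟨hs, hpos⟩
    have h2 := (X.last_isGreatest j k hjk).2 ⟨hs, hpos⟩
    rw [X.engaged_child_eq hE.partition.tree hω hjk, X.released_child_eq hE.partition.tree hω hjk]
    have h3 := div_le_div_of_nonneg_right h1 hω.le
    have h4 := div_le_div_of_nonneg_right h2 hω.le
    refine ⟨by linarith, by linarith, ?_⟩
    refine eq_of_mem_ray (hne k) (X.sign_eq k) (X.total_mem k).2 hs' ⟨le_rfl, (X.total_mem k).1⟩ hr' ?_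
    simpa using X.start_child j k hjk ⟨hj, hk⟩
  rcases isParent_or_isParent (root := root) hE.partition.tree
    (hE.partition.adj_of_mem hii hxE hx hx') with h | h
  · obtain ⟨h1, h2, rfl⟩ := key i i' h hx hx' s hs s' hs' hr hr'
    simp only [zero_div, add_zero] at ht'
    linarith
  · obtain ⟨h1, h2, rfl⟩ := key i' i h hx' hx s' hs' s hs hr' hr
    simp only [zero_div, add_zero] at ht
    exact X.mem_lit_of_gap hE h hx' hx ⟨by linarith, ht.le⟩

/-- The invariant of the clearing argument, by induction on the generation of contamination: some
sweep time of a contaminated point is not yet past. Only some cell containing the point is asserted,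
because a point on a gap has two sweep times. -/
theorem Execution.contaminated_lt (X : Execution E cell root pos ω)
    (hE : IsPTSSTree E cell root pos) (hω : 0 < ω) {t : ℝ} {x : ℂ}
    (h : Contaminated E X.lit t x) :
    ∃ i, ∃ s ∈ Icc 0 (X.total i), x ∈ cell i ∧ x ∈ ray (pos i) (X.start i + X.sign i * s) ∧
      t ≤ X.released i + s / ω := by
  have hcov : ∀ x ∈ E, ∃ i, ∃ s ∈ Icc 0 (X.total i), x ∈ cell i ∧
      x ∈ ray (pos i) (X.start i + X.sign i * s) := by
    intro x hx
    rw [← hE.partition.partition.iUnion_eq] at hx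
    obtain ⟨i, hi⟩ := mem_iUnion.1 hx
    obtain ⟨s, hs, hr⟩ := X.sweep_covers i x hi
    exact ⟨i, s, hs, hi, hr⟩
  induction h with
  | initial x hx hdark =>
    obtain ⟨i, s, hs, hi, hr⟩ := hcov x hx
    refine ⟨i, s, hs, hi, hr, ?_⟩
    have := (X.released_mem hE.partition.tree hω i).1
    have := div_nonneg hs.1 hω.le
    linarith
  | spread t' t x y htime hx hy hdark hsep ih =>
    obtain ⟨i, s, hs, hi, hr, hle⟩ := ih
    -- The point `y` is dark throughout `[t', t]`, so its sweep time cannot fall in that interval.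
    have hlt : t < X.released i + s / ω := by
      by_contra hcon
      exact hdark _ ⟨hle, not_lt.1 hcon⟩ (X.mem_lit hE hω hi hs hr)
    unfold Separable at hsep
    push Not at hsep
    obtain ⟨γ, hγ, hγd⟩ := hsep
    -- `A i` and `B i` are the sectors that agent `i` sweeps from time `t` on and up to time `t`.
    -- Both are taken closed; on the curve the common borderline does not occur, since points swept
    -- at time `t` are lit.
    set A : Fin N → Set ℂ := fun i => {z | ∃ s ∈ Icc 0 (X.total i) ∩ Ici (ω * (t - X.released i)),
      z ∈ ray (pos i) (X.start i + X.sign i * s)} with hA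
    set B : Fin N → Set ℂ := fun i => {z | ∃ s ∈ Icc 0 (X.total i) ∩ Iic (ω * (t - X.released i)),
      z ∈ ray (pos i) (X.start i + X.sign i * s)} with hB
    have hAc : ∀ i, IsClosed (A i) := fun i =>
      isClosed_sweep _ _ _ (isCompact_Icc.inter_right isClosed_Ici)
    have hBc : ∀ i, IsClosed (B i) := fun i =>
      isClosed_sweep _ _ _ (isCompact_Icc.inter_right isClosed_Iic)
    have hcell : ∀ i, IsClosed (cell i) := fun i => (hE.partition.partition.compact i).isClosed
    have hlt_iff : ∀ i s, X.released i + s / ω < t ↔ s < ω * (t - X.released i) := by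
      intro i s
      rw [← div_lt_iff₀' hω]
      constructor <;> intro h <;> linarith
    have hgt_iff : ∀ i s, t < X.released i + s / ω ↔ ω * (t - X.released i) < s := by
      intro i s
      rw [← lt_div_iff₀' hω]
      constructor <;> intro h <;> linarith
    have hne : ∀ u i s, s ∈ Icc 0 (X.total i) → γ u ∈ cell i →
        γ u ∈ ray (pos i) (X.start i + X.sign i * s) → s ≠ ω * (t - X.released i) := by
      intro u i s hs hi hr heq
      apply hγd u
      have := X.mem_lit hE hω hi hs hr
      rw [heq, mul_div_cancel_left₀ _ hω.ne'] at this
      simpa using this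
    set U : Set unitInterval := ⋃ i, γ ⁻¹' (cell i ∩ A i) with hU
    set V : Set unitInterval := ⋃ i, γ ⁻¹' (cell i ∩ B i) with hV
    have hUc : IsClosed U := isClosed_iUnion_of_finite fun i =>
      ((hcell i).inter (hAc i)).preimage γ.continuous
    have hVc : IsClosed V := isClosed_iUnion_of_finite fun i =>
      ((hcell i).inter (hBc i)).preimage γ.continuous
    have hcover : (univ : Set unitInterval) ⊆ U ∪ V := by
      intro u _
      obtain ⟨i, s, hs, hi, hr⟩ := hcov (γ u) (interior_subset (hγ u))
      rcases le_total (ω * (t - X.released i)) s with h | h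
      · exact Or.inl (mem_iUnion.2 ⟨i, hi, s, ⟨hs, h⟩, hr⟩)
      · exact Or.inr (mem_iUnion.2 ⟨i, hi, s, ⟨hs, h⟩, hr⟩)
    have hdisj : ¬ (univ ∩ (U ∩ V)).Nonempty := by
      rintro ⟨u, -, hu, hv⟩
      obtain ⟨i, hi, s, ⟨hs, hs2⟩, hr⟩ := mem_iUnion.1 hu
      obtain ⟨i', hi', s', ⟨hs', hs2'⟩, hr'⟩ := mem_iUnion.1 hv
      have h1 := lt_of_le_of_ne hs2 (hne u i s hs hi hr).symm
      have h2 := lt_of_le_of_ne hs2' (hne u i' s' hs' hi' hr')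
      exact hγd u (X.mem_lit_of_lt_of_lt hE hω (hγ u) hi hi' hs hs' hr hr'
        ((hgt_iff _ _).2 h1) ((hlt_iff _ _).2 h2))
    have h1U : (1 : unitInterval) ∈ U := by
      refine mem_iUnion.2 ⟨i, ?_⟩
      rw [mem_preimage, γ.target]
      exact ⟨hi, s, ⟨hs, ((hgt_iff _ _).1 hlt).le⟩, hr⟩
    -- The end `y` of the curve is still ahead of the sweep. If `x` were not, connectedness of the
    -- unit interval would give a parameter in both closed sets.
    have h0U : (0 : unitInterval) ∈ U := by
      rcases hcover (mem_univ 0) with h | h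
      · exact h
      · exact absurd (isPreconnected_closed_iff.1 isPreconnected_univ U V hUc hVc hcover
          ⟨1, mem_univ _, h1U⟩ ⟨0, mem_univ _, h⟩) hdisj
    obtain ⟨i', hi', s', ⟨hs', hs2'⟩, hr'⟩ := mem_iUnion.1 h0U
    have h1 := lt_of_le_of_ne hs2' (hne 0 i' s' hs' hi' hr').symm
    rw [γ.source] at hi' hr'
    exact ⟨i', s', hs', hi', hr', ((hgt_iff _ _).2 h1).le⟩

theorem Execution.clearedBy (X : Execution E cell root pos ω) (hE : IsPTSSTree E cell root pos)
    (hω : 0 < ω) {T : ℝ} (hT : 2 * Real.pi / ω * ((height cell root : ℝ) + 1) ≤ T) :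
    ClearedBy E X.lit T := by
  intro t ht x _ hc
  obtain ⟨i, s, hs, -, -, hle⟩ := X.contaminated_lt hE hω hc
  have h1 := X.finished_lt hE.partition.tree hω i
  rw [X.finished_eq hE.partition.tree hω] at h1
  have h2 := div_le_div_of_nonneg_right hs.2 hω.le
  linarith

end Clearing

end PTSS

namespace PTSS

/-! ### Topology of the environment of a polygon -/

section Environment

variable {n : ℕ} (Q : Polygon ℂ n)

theorem edgeSet_eq_segment (i : Fin n) :
    Q.edgeSet ℝ i = segment ℝ (Q i) (Q (finRotate n i)) := affineSegment_eq_segment ℝ _ _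

theorem isCompact_segment (a b : ℂ) : IsCompact (segment ℝ a b) := by
  rw [segment_eq_image_lineMap]
  exact isCompact_Icc.image AffineMap.lineMap_continuous

theorem isClosed_edgeSet (i : Fin n) : IsClosed (Q.edgeSet ℝ i) := by
  rw [edgeSet_eq_segment]
  exact (isCompact_segment _ _).isClosed

theorem isClosed_boundary : IsClosed (Q.boundary ℝ) :=
  isClosed_iUnion_of_finite fun i => isClosed_edgeSet Q i

theorem vertex_mem_edgeSet (i : Fin n) : Q i ∈ Q.edgeSet ℝ i := by
  rw [edgeSet_eq_segment]; exact left_mem_segment ..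

theorem edgeSet_subset_boundary (i : Fin n) : Q.edgeSet ℝ i ⊆ Q.boundary ℝ :=
  subset_iUnion (Q.edgeSet ℝ) i

theorem boundary_subset_environment : Q.boundary ℝ ⊆ environment Q := subset_union_left

variable {Q}

/-- A preconnected set that misses the boundary lies in one component of its complement, which is
bounded or not as a whole. Every later decision between inside and outside goes through this. -/
theorem mem_environment_iff_of_isPreconnected {S : Set ℂ} (hS : IsPreconnected S)
    (hd : Disjoint S (Q.boundary ℝ)) {x y : ℂ} (hx : x ∈ S) (hy : y ∈ S) :
    x ∈ environment Q ↔ y ∈ environment Q := by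
  have hsub : S ⊆ (Q.boundary ℝ)ᶜ := hd.subset_compl_right
  have hy' := hS.subset_connectedComponentIn hx hsub hy
  have := connectedComponentIn_eq hy'
  simp only [environment, mem_union, mem_ofPred_eq, this]
  have hxb : x ∉ Q.boundary ℝ := hsub hx
  have hyb : y ∉ Q.boundary ℝ := hsub hy
  tauto

theorem mem_environment_iff_of_segment {x y : ℂ}
    (hd : Disjoint (segment ℝ x y) (Q.boundary ℝ)) :
    x ∈ environment Q ↔ y ∈ environment Q :=
  mem_environment_iff_of_isPreconnected (convex_segment x y).isPreconnected hd
    (left_mem_segment ..) (right_mem_segment ..)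

theorem exists_ball_of_notMem_boundary {x : ℂ} (hx : x ∉ Q.boundary ℝ) :
    ∃ ε > 0, ∀ y ∈ Metric.ball x ε, x ∈ environment Q ↔ y ∈ environment Q := by
  obtain ⟨ε, hε, hb⟩ := Metric.isOpen_iff.1 (isClosed_boundary Q).isOpen_compl x hx
  exact ⟨ε, hε, fun y hy => mem_environment_iff_of_isPreconnected
    (convex_ball x ε).isPreconnected (disjoint_left.2 hb) (Metric.mem_ball_self hε) hy⟩

theorem isClosed_environment : IsClosed (environment Q) := by
  rw [← isOpen_compl_iff, Metric.isOpen_iff]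
  intro x hx
  obtain ⟨ε, hε, hb⟩ :=
    exists_ball_of_notMem_boundary fun h => hx (boundary_subset_environment Q h)
  exact ⟨ε, hε, fun y hy h => hx ((hb y hy).2 h)⟩

theorem frontier_environment_subset : frontier (environment Q) ⊆ Q.boundary ℝ := by
  intro x hx
  by_contra hxb
  obtain ⟨ε, hε, hb⟩ := exists_ball_of_notMem_boundary hxb
  exact hx.2 (mem_interior.2 ⟨Metric.ball x ε,
    fun y hy => (hb y hy).1 (isClosed_environment.frontier_subset hx), Metric.isOpen_ball,
    Metric.mem_ball_self hε⟩)

theorem convex_halfSpace_mul_re_ge (w : ℂ) (c : ℝ) : Convex ℝ {z : ℂ | c ≤ (w * z).re} :=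
  convex_halfSpace_ge (f := fun z : ℂ => (w * z).re)
    ⟨fun x y => by simp [mul_add], fun r x => by simp; ring⟩ c

theorem convex_halfSpace_mul_re_le (w : ℂ) (c : ℝ) : Convex ℝ {z : ℂ | (w * z).re ≤ c} :=
  convex_halfSpace_le (f := fun z : ℂ => (w * z).re)
    ⟨fun x y => by simp [mul_add], fun r x => by simp; ring⟩ c

theorem le_of_mem_boundary {w : ℂ} {c : ℝ} (h : ∀ i, c ≤ (w * Q i).re) {x : ℂ}
    (hx : x ∈ Q.boundary ℝ) : c ≤ (w * x).re := by
  obtain ⟨i, hi⟩ := mem_iUnion.1 hx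
  rw [edgeSet_eq_segment] at hi
  exact (convex_halfSpace_mul_re_ge w c).segment_subset (h _) (h _) hi

/-- The environment lies in every half-plane that contains the vertices. -/
theorem le_of_mem_environment {w : ℂ} (hw : w ≠ 0) {c : ℝ} (h : ∀ i, c ≤ (w * Q i).re) {x : ℂ}
    (hx : x ∈ environment Q) : c ≤ (w * x).re := by
  rcases hx with hx | ⟨hx, hbd⟩
  · exact le_of_mem_boundary h hx
  by_contra! hlt
  -- The half-plane behind `x` misses the boundary, so it lies in the component of `x`. It is
  -- unbounded, while that component is bounded.
  have hsub : {z : ℂ | (w * z).re ≤ (w * x).re} ⊆ connectedComponentIn (Q.boundary ℝ)ᶜ x := by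
    refine (convex_halfSpace_mul_re_le w _).isPreconnected.subset_connectedComponentIn
      (show (w * x).re ≤ (w * x).re from le_rfl) ?_
    intro z hz hzb
    have := le_of_mem_boundary h hzb
    have hz' : (w * z).re ≤ (w * x).re := hz
    linarith
  obtain ⟨R, hR⟩ := (hbd.subset hsub).subset_ball 0
  have hR0 : 0 ≤ |R| + ‖x‖ := by positivity
  set t : ℝ := |R| + ‖x‖ with ht
  have hmem : x - t * (w⁻¹) * ‖w‖ ∈ {z : ℂ | (w * z).re ≤ (w * x).re} := by
    have : w * (x - t * (w⁻¹) * ‖w‖) = w * x - ((t * ‖w‖ : ℝ) : ℂ) := by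
      push_cast; field_simp
    rw [mem_ofPred_eq, this, Complex.sub_re, Complex.ofReal_re]
    have : 0 ≤ t * ‖w‖ := by positivity
    linarith
  have h1 := hR hmem
  rw [mem_ball_zero_iff] at h1
  have h2 : ‖(t * (w⁻¹) * ‖w‖ : ℂ)‖ = t := by
    have : ‖w‖ ≠ 0 := norm_ne_zero_iff.2 hw
    simp [abs_of_nonneg hR0]
    field_simp
  have h3 : ‖(t * (w⁻¹) * ‖w‖ : ℂ)‖ - ‖x‖ ≤ ‖x - t * (w⁻¹) * ‖w‖‖ := by
    rw [norm_sub_rev]; exact norm_sub_norm_le _ _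
  have := le_abs_self R
  linarith

theorem exists_ball_inter_boundary (p : ℂ) :
    ∃ ε > 0, ∀ x ∈ Metric.ball p ε, x ∈ Q.boundary ℝ →
      ∃ i, x ∈ Q.edgeSet ℝ i ∧ p ∈ Q.edgeSet ℝ i := by
  have : IsClosed (⋃ i ∈ {i | p ∉ Q.edgeSet ℝ i}, Q.edgeSet ℝ i) :=
    (toFinite _).isClosed_biUnion fun i _ => isClosed_edgeSet Q i
  obtain ⟨ε, hε, hb⟩ := Metric.isOpen_iff.1 this.isOpen_compl p (by simp)
  refine ⟨ε, hε, fun x hx hxb => ?_⟩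
  obtain ⟨i, hi⟩ := mem_iUnion.1 hxb
  refine ⟨i, hi, ?_⟩
  by_contra hp
  exact hb hx (mem_biUnion (show i ∈ {i | p ∉ Q.edgeSet ℝ i} from hp) hi)

/-- Near one of its points a segment is a cone with that apex: a line through an inner point, a
half-line at an end. -/
theorem exists_segment_conic {a b p : ℂ} (hp : p ∈ segment ℝ a b) :
    ∃ ε > 0, ∀ x ∈ Metric.ball p ε, ∀ r : ℝ, 0 < r → r ≤ 1 →
      p + r * (x - p) ∈ segment ℝ a b → x ∈ segment ℝ a b := by
  rw [segment_eq_image'] at hp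
  obtain ⟨s, hs, rfl⟩ := hp
  simp only
  by_cases hab : b = a
  · refine ⟨1, one_pos, fun x _ r hr _ h => ?_⟩
    subst hab
    simpa [hr.ne', sub_eq_zero] using h
  have hl : 0 < ‖b - a‖ := norm_pos_iff.2 (sub_ne_zero.2 hab)
  -- `e` bounds the parameter distance from `p` to those ends of the segment that differ from `p`;
  -- an end at `p` itself imposes no restriction.
  obtain ⟨e, he, he1, he2⟩ : ∃ e > 0, (s = 0 ∨ e ≤ s) ∧ (s = 1 ∨ e ≤ 1 - s) := by
    rcases hs.1.eq_or_lt with h | h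
    · exact ⟨1, one_pos, Or.inl h.symm, Or.inr (by linarith)⟩
    · rcases hs.2.eq_or_lt with h' | h'
      · exact ⟨1, one_pos, Or.inr (by linarith), Or.inl h'⟩
      · exact ⟨min s (1 - s), lt_min h (by linarith), Or.inr (min_le_left _ _),
          Or.inr (min_le_right _ _)⟩
  refine ⟨e * ‖b - a‖, by positivity, fun x hx r hr hr1 h => ?_⟩
  rw [segment_eq_image'] at h ⊢
  obtain ⟨s', hs', h⟩ := h
  have hr0 : (r : ℂ) ≠ 0 := by exact_mod_cast hr.ne'
  have hx' : x = a + ((s + (s' - s) / r : ℝ) : ℂ) * (b - a) := by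
    simp only [Complex.real_smul] at h
    push_cast
    field_simp
    linear_combination -h
  have hd : |(s' - s) / r| < e := by
    rw [mem_ball_iff_norm, hx'] at hx
    simp only [Complex.real_smul] at hx
    rw [show a + ((s + (s' - s) / r : ℝ) : ℂ) * (b - a) - (a + (s : ℂ) * (b - a)) =
      (((s' - s) / r : ℝ) : ℂ) * (b - a) by push_cast; ring, norm_mul, Complex.norm_real,
      Real.norm_eq_abs] at hx
    exact lt_of_mul_lt_mul_right hx hl.le
  rw [abs_lt] at hd
  refine ⟨s + (s' - s) / r, ⟨?_, ?_⟩, by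
    simp only; rw [Complex.real_smul, ← hx']⟩
  · rcases he1 with h0 | h0
    · rw [h0]; have := div_nonneg hs'.1 hr.le; simpa using this
    · linarith
  · rcases he2 with h0 | h0
    · rw [h0]
      have := div_nonpos_of_nonpos_of_nonneg (sub_nonpos.2 hs'.2) hr.le
      linarith
    · linarith

/-- Near a boundary point the environment is star-shaped with respect to that point. -/
theorem exists_ball_segment_subset {p : ℂ} (hp : p ∈ Q.boundary ℝ) :
    ∃ ε > 0, ∀ x ∈ Metric.ball p ε, x ∈ environment Q → segment ℝ p x ⊆ environment Q := by
  obtain ⟨ε₁, hε₁, h₁⟩ := exists_ball_inter_boundary (Q := Q) p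
  have h₂ : ∀ i, ∃ ε > 0, p ∈ Q.edgeSet ℝ i → ∀ x ∈ Metric.ball p ε, ∀ r : ℝ, 0 < r → r ≤ 1 →
      p + r * (x - p) ∈ Q.edgeSet ℝ i → x ∈ Q.edgeSet ℝ i := by
    intro i
    by_cases hi : p ∈ Q.edgeSet ℝ i
    · rw [edgeSet_eq_segment] at hi ⊢
      obtain ⟨ε, hε, h⟩ := exists_segment_conic hi
      exact ⟨ε, hε, fun _ => h⟩
    · exact ⟨1, one_pos, fun h => absurd h hi⟩
  choose e he h₂ using h₂
  obtain ⟨i₀, hi₀⟩ := mem_iUnion.1 hp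
  have hne : (Finset.univ : Finset (Fin n)).Nonempty := ⟨i₀, Finset.mem_univ _⟩
  set ε₂ := Finset.univ.inf' hne e
  have hε₂ : 0 < ε₂ := (Finset.lt_inf'_iff hne).2 fun i _ => he i
  have hle : ∀ i, ε₂ ≤ e i := fun i => Finset.inf'_le _ (Finset.mem_univ i)
  refine ⟨min ε₁ ε₂, lt_min hε₁ hε₂, fun x hx hxE => ?_⟩
  have hx₁ := Metric.ball_subset_ball (min_le_left ε₁ ε₂) hx
  have hx₂ := Metric.ball_subset_ball (min_le_right ε₁ ε₂) hx
  by_cases hxb : x ∈ Q.boundary ℝ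
  · obtain ⟨i, hxi, hpi⟩ := h₁ x hx₁ hxb
    rw [edgeSet_eq_segment] at hxi hpi
    refine ((convex_segment _ _).segment_subset hpi hxi).trans ?_
    rw [← edgeSet_eq_segment]
    exact (edgeSet_subset_boundary Q i).trans (boundary_subset_environment Q)
  · intro y hy
    rcases eq_or_ne y p with rfl | hyp
    · exact boundary_subset_environment Q hp
    rw [segment_eq_image'] at hy
    obtain ⟨r, hr, rfl⟩ := hy
    have hr0 : 0 < r := lt_of_le_of_ne hr.1 (by rintro rfl; simp at hyp)
    refine (mem_environment_iff_of_segment (disjoint_left.2 ?_)).1 hxE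
    intro z hz hzb
    -- A boundary point on the way from `x` to `y` would be a contraction of `x` towards `p`. By the
    -- conic property `x` itself would then be a boundary point.
    have hz' : ∃ r' : ℝ, 0 < r' ∧ r' ≤ 1 ∧ z = p + r' * (x - p) := by
      rw [segment_eq_image'] at hz
      obtain ⟨c, hc, rfl⟩ := hz
      refine ⟨1 - c + c * r, ?_, ?_, ?_⟩
      · rcases hc.2.eq_or_lt with h | h
        · rw [h]; linarith
        · nlinarith [mul_nonneg hc.1 hr0.le]
      · nlinarith [hc.1, hr.2, mul_nonneg hc.1 (sub_nonneg.2 hr.2)]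
      · simp only [Complex.real_smul]; push_cast; ring
    obtain ⟨r', hr'0, hr'1, rfl⟩ := hz'
    have hzball : p + r' * (x - p) ∈ Metric.ball p ε₁ := by
      rw [mem_ball_iff_norm] at hx₁ ⊢
      rw [add_sub_cancel_left, norm_mul, Complex.norm_real, Real.norm_eq_abs, abs_of_pos hr'0]
      nlinarith [norm_nonneg (x - p)]
    obtain ⟨i, hzi, hpi⟩ := h₁ _ hzball hzb
    exact hxb (edgeSet_subset_boundary Q i (h₂ i hpi x
      (Metric.ball_subset_ball (hle i) hx₂) r' hr'0 hr'1 hzi))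

end Environment

/-! ### Edges of simple polygons -/

section Simple

variable {n : ℕ} {Q : Polygon ℂ n}

theorem IsSimple.eq_of_mem_of_mem (hQ : IsSimple Q) {p : ℂ} {i j : Fin n} (hij : i ≠ j)
    (hi : p ∈ Q.edgeSet ℝ i) (hj : p ∈ Q.edgeSet ℝ j) :
    (j = finRotate n i ∧ p = Q j) ∨ (i = finRotate n j ∧ p = Q i) := by
  by_cases h1 : j = finRotate n i
  · refine Or.inl ⟨h1, ?_⟩
    subst h1
    have : p ∈ Q.edgeSet ℝ i ∩ Q.edgeSet ℝ (finRotate n i) := ⟨hi, hj⟩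
    rw [hQ.consecutive] at this
    exact this
  by_cases h2 : i = finRotate n j
  · refine Or.inr ⟨h2, ?_⟩
    subst h2
    have : p ∈ Q.edgeSet ℝ j ∩ Q.edgeSet ℝ (finRotate n j) := ⟨hj, hi⟩
    rw [hQ.consecutive] at this
    exact this
  exact absurd hj (disjoint_left.1 (hQ.disjoint i j (Ne.symm hij) h1 h2) hi)

theorem finRotate_ne_self (hn : 2 ≤ n) (i : Fin n) : finRotate n i ≠ i := by
  obtain ⟨m, rfl⟩ := Nat.exists_eq_add_of_le' hn
  rw [finRotate_apply]
  simp

theorem IsSimple.ne_next (hQ : IsSimple Q) (hn : 2 ≤ n) (i : Fin n) :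
    Q (finRotate n i) ≠ Q i := fun h => finRotate_ne_self hn i (hQ.injective h)

/-- The vertices of a simple polygon are not collinear. -/
theorem IsSimple.exists_ne (hQ : IsSimple Q) (hn : 3 ≤ n) {w : ℂ} (hw : w ≠ 0) (c : ℝ) :
    ∃ i, (w * Q i).re ≠ c := by
  by_contra! hcon
  have : Nonempty (Fin n) := ⟨⟨0, by omega⟩⟩
  obtain ⟨i, hi⟩ := Finite.exists_max fun i => (w * Q i).im
  -- `i` is extreme on the supposed common line, so both neighbours lie on the same side of it and
  -- the two edges at `i` overlap in more than the vertex.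
  set prev := (finRotate n).symm i with hprev
  have hi' : finRotate n prev = i := Equiv.apply_symm_apply _ _
  have h1 : Q prev ≠ Q i := by
    have := hQ.ne_next (by omega) prev
    rw [hi'] at this
    exact this.symm
  have h2 : Q (finRotate n i) ≠ Q i := hQ.ne_next (by omega) i
  have key : ∀ j, ∃ t : ℝ, 0 ≤ t ∧ Q j = Q i - t * (Complex.I / w) := by
    intro j
    refine ⟨(w * Q i).im - (w * Q j).im, by linarith [hi j], ?_⟩
    have : w * Q j = w * Q i - (((w * Q i).im - (w * Q j).im : ℝ) : ℂ) * Complex.I := by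
      apply Complex.ext
      · simpa using (hcon j).trans (hcon i).symm
      · simp
    generalize (w * Q i).im - (w * Q j).im = s at this
    field_simp
    linear_combination this
  obtain ⟨s, hs, hs'⟩ := key prev
  obtain ⟨t, ht, ht'⟩ := key (finRotate n i)
  have hs0 : 0 < s := lt_of_le_of_ne hs (by
    rintro rfl; exact h1 (by rw [hs', Complex.ofReal_zero, zero_mul, sub_zero]))
  have ht0 : 0 < t := lt_of_le_of_ne ht (by
    rintro rfl; exact h2 (by rw [ht', Complex.ofReal_zero, zero_mul, sub_zero]))
  set m := min s t with hm
  have hm0 : 0 < m := lt_min hs0 ht0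
  have hx : Q i - m * (Complex.I / w) ∈ Q.edgeSet ℝ prev ∩ Q.edgeSet ℝ (finRotate n prev) := by
    rw [hi', edgeSet_eq_segment, edgeSet_eq_segment, hi', hs', ht', segment_symm,
      segment_eq_image', segment_eq_image']
    have hs0' : (s : ℂ) ≠ 0 := by exact_mod_cast hs0.ne'
    have ht0' : (t : ℂ) ≠ 0 := by exact_mod_cast ht0.ne'
    refine ⟨⟨m / s, ⟨by positivity, (div_le_one hs0).2 (min_le_left _ _)⟩, ?_⟩,
      ⟨m / t, ⟨by positivity, (div_le_one ht0).2 (min_le_right _ _)⟩, ?_⟩⟩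
    · simp only [Complex.real_smul]; push_cast; field_simp; ring
    · simp only [Complex.real_smul]; push_cast; field_simp; ring
  rw [hQ.consecutive, hi'] at hx
  have hx' : Q i - m * (Complex.I / w) = Q i := hx
  rw [sub_eq_self] at hx'
  have : (m : ℂ) ≠ 0 := by exact_mod_cast hm0.ne'
  simp [this, hw] at hx'

end Simple

/-! ### Estimates of interior angles and nonreflex vertices -/

section Angle

/-- The angles of the directions that lead from `x` into `E`. -/
def directions (E : Set ℂ) (x : ℂ) : Set ℝ :=
  {θ | ∃ ε > 0, ∀ ρ ∈ Ioo (0 : ℝ) ε, x + ρ * unit θ ∈ E}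

theorem interiorAngle_eq (E : Set ℂ) (x : ℂ) :
    interiorAngle E x =
      MeasureTheory.volume.real (directions E x ∩ Ioc (-Real.pi) Real.pi) := by
  rw [inter_comm]; rfl

/-- All half-open intervals of length 2π are fundamental domains of the same group. This lets an
angle be measured over any convenient window instead of `]-π, π]`. -/
theorem volume_inter_Ioc_eq {A : Set ℝ} (hA : MeasurableSet A)
    (hper : ∀ (m : ℤ) θ, θ + m * (2 * Real.pi) ∈ A ↔ θ ∈ A) (a b : ℝ) :
    MeasureTheory.volume (A ∩ Ioc a (a + 2 * Real.pi)) =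
      MeasureTheory.volume (A ∩ Ioc b (b + 2 * Real.pi)) := by
  have h2pi : 0 < 2 * Real.pi := by positivity
  refine (isAddFundamentalDomain_Ioc h2pi a).measure_set_eq (isAddFundamentalDomain_Ioc h2pi b)
    hA ?_
  rintro ⟨g, hg⟩
  obtain ⟨m, rfl⟩ := AddSubgroup.mem_zmultiples_iff.1 hg
  ext θ
  rw [← hper m θ]
  simp [AddSubgroup.vadd_def, add_comm]

theorem interiorAngle_le_of_subset {E : Set ℂ} {x : ℂ} {A : Set ℝ} (hA : MeasurableSet A)
    (hper : ∀ (m : ℤ) θ, θ + m * (2 * Real.pi) ∈ A ↔ θ ∈ A) (h : directions E x ⊆ A)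
    {b c d : ℝ} (hcd : c ≤ d) (hb : A ∩ Ioc b (b + 2 * Real.pi) ⊆ Icc c d) :
    interiorAngle E x ≤ d - c := by
  rw [interiorAngle_eq, MeasureTheory.measureReal_def]
  refine ENNReal.toReal_le_of_le_ofReal (sub_nonneg.2 hcd) ?_
  rw [← Real.volume_Icc]
  refine le_trans (MeasureTheory.measure_mono (inter_subset_inter_left _ h)) ?_
  have := volume_inter_Ioc_eq hA hper (-Real.pi) b
  rw [show -Real.pi + 2 * Real.pi = Real.pi by ring] at this
  rw [this]
  exact MeasureTheory.measure_mono hb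

theorem le_interiorAngle {E : Set ℂ} {x : ℂ} {c d : ℝ} (hcd : d ≤ c + 2 * Real.pi)
    (h : ∀ θ ∈ Ioo c d, θ ∈ directions E x) : d - c ≤ interiorAngle E x := by
  -- The set of directions is not known to be measurable; the periodic open set `A` inside it is,
  -- and the window can be moved for `A`.
  set A : Set ℝ := ⋃ m : ℤ, (fun θ => θ + m * (2 * Real.pi)) ⁻¹' Ioo c d with hA
  have hAm : MeasurableSet A :=
    (isOpen_iUnion fun m => isOpen_Ioo.preimage (by fun_prop)).measurableSet
  have hper : ∀ (m : ℤ) θ, θ + m * (2 * Real.pi) ∈ A ↔ θ ∈ A := by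
    intro m θ
    simp only [hA, mem_iUnion, mem_preimage]
    constructor
    · rintro ⟨k, hk⟩
      refine ⟨m + k, ?_⟩
      push_cast
      rwa [add_mul, ← add_assoc]
    · rintro ⟨k, hk⟩
      refine ⟨k - m, ?_⟩
      push_cast
      rwa [sub_mul, add_assoc, add_sub_cancel]
  have hsub : A ⊆ directions E x := by
    intro θ hθ
    obtain ⟨m, hm⟩ := mem_iUnion.1 hθ
    obtain ⟨ε, hε, hx⟩ := h _ hm
    refine ⟨ε, hε, fun ρ hρ => ?_⟩
    have := hx ρ hρ
    rwa [unit_eq_unit_iff.2 ⟨m, rfl⟩] at this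
  rw [interiorAngle_eq, MeasureTheory.measureReal_def]
  refine le_trans ?_ (ENNReal.toReal_mono (ne_top_of_le_ne_top (b := MeasureTheory.volume
    (Ioc (-Real.pi) Real.pi)) (by simp) (MeasureTheory.measure_mono inter_subset_right))
    (MeasureTheory.measure_mono (inter_subset_inter_left _ hsub)))
  have := volume_inter_Ioc_eq hAm hper (-Real.pi) c
  rw [show -Real.pi + 2 * Real.pi = Real.pi by ring] at this
  rw [this]
  have h0 : Ioo c d ⊆ A ∩ Ioc c (c + 2 * Real.pi) := fun θ hθ =>
    ⟨mem_iUnion.2 ⟨0, by simpa using hθ⟩, hθ.1, hθ.2.le.trans hcd⟩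
  rcases le_total d c with hle | hle
  · exact (sub_nonpos.2 hle).trans ENNReal.toReal_nonneg
  · have h1 := MeasureTheory.measure_mono (μ := MeasureTheory.volume) h0
    rw [Real.volume_Ioo] at h1
    rw [← ENNReal.toReal_ofReal (sub_nonneg.2 hle)]
    refine ENNReal.toReal_mono (ne_top_of_le_ne_top (b := MeasureTheory.volume
      (Ioc c (c + 2 * Real.pi))) (by rw [Real.volume_Ioc]; exact ENNReal.ofReal_ne_top) (MeasureTheory.measure_mono inter_subset_right)) h1

theorem mul_unit_re (w : ℂ) (θ : ℝ) : (w * unit θ).re = ‖w‖ * Real.cos (θ + w.arg) := by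
  conv_lhs => rw [← Complex.norm_mul_exp_arg_mul_I w]
  rw [unit, mul_assoc, ← Complex.exp_add, ← add_mul, Complex.re_ofReal_mul, add_comm,
    ← Complex.ofReal_add, Complex.exp_ofReal_mul_I_re]

/-- The interior angle is at most `π` if all directions into `E` lie in a half-plane. -/
theorem interiorAngle_le_pi {E : Set ℂ} {x w : ℂ} (hw : w ≠ 0)
    (h : ∀ θ ∈ directions E x, 0 ≤ (w * unit θ).re) : interiorAngle E x ≤ Real.pi := by
  have hpi := Real.pi_pos
  have hA : MeasurableSet {θ : ℝ | 0 ≤ (w * unit θ).re} := by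
    have := continuous_unit
    exact (isClosed_le continuous_const (by fun_prop)).measurableSet
  have := interiorAngle_le_of_subset (E := E) (x := x) hA (fun m θ => ?_) h
    (b := -w.arg - Real.pi) (c := -w.arg - Real.pi / 2) (d := -w.arg + Real.pi / 2)
    (by linarith) ?_
  · linarith
  · rw [mem_ofPred_eq, mem_ofPred_eq, unit_eq_unit_iff.2 ⟨m, rfl⟩]
  · rintro θ ⟨h1, h2⟩
    rw [mem_ofPred_eq, mul_unit_re] at h1
    have h3 : 0 ≤ Real.cos (θ + w.arg) := by
      by_contra! hlt
      have := mul_neg_of_pos_of_neg (norm_pos_iff.2 hw) hlt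
      linarith
    constructor
    · by_contra! hlt
      have := Real.cos_neg_of_pi_div_two_lt_of_lt (x := -(θ + w.arg)) (by linarith)
        (by linarith [h2.1])
      rw [Real.cos_neg] at this
      linarith
    · by_contra! hlt
      have := Real.cos_neg_of_pi_div_two_lt_of_lt (x := θ + w.arg) (by linarith)
        (by linarith [h2.2])
      linarith

variable {n : ℕ} {Q : Polygon ℂ n}

/-- A half-plane containing all vertices contains the environment, so at a vertex on its border all
inward directions lie in a half-plane. -/
theorem interiorAngle_le_pi_of_forall_le {w : ℂ} (hw : w ≠ 0) {i : Fin n}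
    (h : ∀ j, (w * Q i).re ≤ (w * Q j).re) : interiorAngle (environment Q) (Q i) ≤ Real.pi := by
  refine interiorAngle_le_pi hw fun θ hθ => ?_
  obtain ⟨ε, hε, hx⟩ := hθ
  have h1 := le_of_mem_environment hw h (hx (ε / 2) ⟨by linarith, by linarith⟩)
  rw [mul_add, Complex.add_re, mul_left_comm, Complex.re_ofReal_mul] at h1
  have h2 : 0 ≤ ε / 2 * (w * unit θ).re := by linarith
  exact nonneg_of_mul_nonneg_right h2 (by linarith)

/-- At least three vertices of a simple polygon are not reflex. -/
theorem IsSimple.numReflex_add_three_le (hQ : IsSimple Q) (hn : 3 ≤ n) :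
    numReflex Q + 3 ≤ n := by
  have : Nonempty (Fin n) := ⟨⟨0, by omega⟩⟩
  set S : Set (Fin n) := {i | Real.pi < interiorAngle (environment Q) (Q i)} with hS
  have hmem : ∀ (w : ℂ) (_ : w ≠ 0) (i : Fin n), (∀ j, (w * Q i).re ≤ (w * Q j).re) → i ∈ Sᶜ :=
    fun w hw i h => not_lt.2 (interiorAngle_le_pi_of_forall_le hw h)
  obtain ⟨i, hi⟩ := Finite.exists_min fun i => (1 * Q i).re
  obtain ⟨k, hk⟩ := Finite.exists_min fun i => (-1 * Q i).re
  have hik : i ≠ k := by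
    rintro rfl
    obtain ⟨j, hj⟩ := hQ.exists_ne hn (one_ne_zero) (1 * Q i).re
    have h1 := hi j
    have h2 := hk j
    simp only [neg_mul, Complex.neg_re] at h2
    exact hj (le_antisymm (by linarith) h1)
  have hne : Q i - Q k ≠ 0 := sub_ne_zero.2 (hQ.injective.ne hik)
  -- This functional is constant on the line through the two extreme vertices already found. As some
  -- vertex is off that line, its minimum or maximum gives a third one.
  set w : ℂ := Complex.I / (Q i - Q k) with hw
  have hw0 : w ≠ 0 := div_ne_zero Complex.I_ne_zero hne
  have hwe : (w * Q i).re = (w * Q k).re := by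
    have : w * Q i - w * Q k = Complex.I := by rw [hw]; field_simp
    have := congrArg Complex.re this
    rw [Complex.sub_re, Complex.I_re] at this
    linarith
  obtain ⟨l, hl⟩ := hQ.exists_ne hn hw0 (w * Q i).re
  obtain ⟨m, hm, hmi, hmk⟩ : ∃ m ∈ Sᶜ, m ≠ i ∧ m ≠ k := by
    rcases hl.lt_or_gt with hlt | hlt
    · obtain ⟨m, hm⟩ := Finite.exists_min fun i => (w * Q i).re
      refine ⟨m, hmem w hw0 m hm, ?_, ?_⟩
      · rintro rfl; linarith [hm l]
      · rintro rfl; linarith [hm l]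
    · obtain ⟨m, hm⟩ := Finite.exists_min fun i => (-w * Q i).re
      have hm' : ∀ j, (w * Q j).re ≤ (w * Q m).re := fun j => by
        have := hm j
        simp only [neg_mul, Complex.neg_re] at this
        linarith
      refine ⟨m, hmem (-w) (neg_ne_zero.2 hw0) m hm, ?_, ?_⟩
      · rintro rfl; linarith [hm' l]
      · rintro rfl; linarith [hm' l]
  have hsub : ({i, k, m} : Set (Fin n)) ⊆ Sᶜ := by
    rintro x (rfl | rfl | rfl)
    · exact hmem 1 one_ne_zero _ hi
    · exact hmem (-1) (by simp) _ hk
    · exact hm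
  have h3 : ({i, k, m} : Set (Fin n)).ncard = 3 :=
    ncard_eq_three.2 ⟨i, k, m, hik, hmi.symm, hmk.symm, rfl⟩
  have h4 := ncard_le_ncard hsub (toFinite _)
  have h5 := ncard_add_ncard_compl S
  rw [Nat.card_eq_fintype_card, Fintype.card_fin] at h5
  change S.ncard + 3 ≤ n
  omega

end Angle

end PTSS

namespace PTSS

/-! ### Cells near an inner point of a gap -/

section HalfDisc

theorem exists_mul_re_ne_zero {U : Set ℂ} (hU : IsOpen U) {z : ℂ} (hz : z ∈ U) {w : ℂ}
    (hw : w ≠ 0) (a : ℂ) : ∃ y ∈ U, (w * (y - a)).re ≠ 0 := by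
  by_cases h : (w * (z - a)).re = 0
  · have hc : Filter.Tendsto (fun t : ℝ => z + t * w⁻¹) (𝓝[>] 0) (𝓝 z) := by
      have : Continuous fun t : ℝ => z + t * w⁻¹ := by fun_prop
      have := this.tendsto 0
      simp only [Complex.ofReal_zero, zero_mul, add_zero] at this
      exact this.mono_left nhdsWithin_le_nhds
    obtain ⟨t, ht, ht0⟩ := ((hc.eventually (hU.mem_nhds hz)).and self_mem_nhdsWithin).exists
    refine ⟨_, ht, ?_⟩
    have : w * (z + t * w⁻¹ - a) = w * (z - a) + t := by field_simp; ring
    rw [this, Complex.add_re, h, Complex.ofReal_re, zero_add]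
    exact (show (0 : ℝ) < t from ht0).ne'
  · exact ⟨z, hz, h⟩

/-- A disc minus a diameter is dense in the disc, and the set is closed. -/
theorem mem_interior_of_mul_re_ne_zero {E : Set ℂ} (hE : IsClosed E) {a w : ℂ} (hw : w ≠ 0)
    {ε : ℝ} (hε : 0 < ε) (h : ∀ z ∈ Metric.ball a ε, (w * (z - a)).re ≠ 0 → z ∈ E) :
    a ∈ interior E := by
  refine mem_interior.2 ⟨Metric.ball a ε, fun z hz => ?_, Metric.isOpen_ball,
    Metric.mem_ball_self hε⟩
  rw [← hE.closure_eq, mem_closure_iff]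
  intro o ho hzo
  obtain ⟨y, hy, hy'⟩ := exists_mul_re_ne_zero (ho.inter Metric.isOpen_ball) ⟨hzo, hz⟩ hw a
  exact ⟨y, hy.1, h y hy.2 hy'⟩

theorem isPreconnected_halfDisc (a w : ℂ) (ε : ℝ) :
    IsPreconnected {z | z ∈ Metric.ball a ε ∧ 0 < (w * (z - a)).re} := by
  have := ((convex_ball a ε).inter (convex_halfSpace_gt (f := fun z : ℂ => (w * z).re)
    ⟨fun x y => by simp [mul_add], fun r x => by simp; ring⟩ (w * a).re)).isPreconnected
  convert this using 1
  ext z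
  simp [mul_sub]

theorem mul_sub_re_eq_zero_of_mem_segment {a b x z w : ℂ} (hw : (w * (b - a)).re = 0)
    (hx : x ∈ segment ℝ a b) (hz : z ∈ segment ℝ a b) : (w * (z - x)).re = 0 := by
  rw [segment_eq_image'] at hx hz
  obtain ⟨s, -, rfl⟩ := hx
  obtain ⟨t, -, rfl⟩ := hz
  have : w * ((a + t • (b - a)) - (a + s • (b - a))) = ((t - s : ℝ) : ℂ) * (w * (b - a)) := by
    simp only [Complex.real_smul]; push_cast; ring
  simp only [this, Complex.re_ofReal_mul, hw, mul_zero]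

/-- Near an inner point of a gap, the cell on one side of the gap contains a half-disc. -/
theorem IsPTSSPartition.exists_halfDisc {E : Set ℂ} {N : ℕ} {cell : Fin N → Set ℂ}
    (h : IsPTSSPartition E cell) {j k : Fin N} (hjk : j ≠ k) {a b x : ℂ} (hab : a ≠ b)
    (hcell : cell j ∩ cell k = segment ℝ a b) (hxE : x ∈ interior E) (hx : x ∈ segment ℝ a b) :
    ∃ w : ℂ, w ≠ 0 ∧ (w * (b - a)).re = 0 ∧ ∃ ε > 0, Metric.ball x ε ⊆ E ∧
      ∀ z ∈ Metric.ball x ε, 0 < (w * (z - x)).re → z ∈ cell j := by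
  have hxj : x ∈ cell j := (hcell ▸ hx : x ∈ cell j ∩ cell k).1
  have hxk : x ∈ cell k := (hcell ▸ hx : x ∈ cell j ∩ cell k).2
  have hcl : ∀ i, IsClosed (cell i) := fun i => (h.partition.compact i).isClosed
  have hclosed : IsClosed (⋃ i ∈ {i | x ∉ cell i}, cell i) :=
    (toFinite _).isClosed_biUnion fun i _ => hcl i
  obtain ⟨ε, hε, hb⟩ := Metric.isOpen_iff.1 (hclosed.isOpen_compl.inter isOpen_interior) x
    ⟨by simp, hxE⟩
  have hcov : ∀ z ∈ Metric.ball x ε, z ∈ cell j ∨ z ∈ cell k := by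
    intro z hz
    have hzE := interior_subset (hb hz).2
    rw [← h.partition.iUnion_eq] at hzE
    obtain ⟨i, hi⟩ := mem_iUnion.1 hzE
    have hxi : x ∈ cell i := by
      by_contra hxi
      exact (hb hz).1 (mem_biUnion (show i ∈ {i | x ∉ cell i} from hxi) hi)
    by_contra! hcon
    have hji : j ≠ i := by rintro rfl; exact hcon.1 hi
    have hki : k ≠ i := by rintro rfl; exact hcon.2 hi
    exact not_triangle h.tree (h.adj_of_mem hjk hxE hxj hxk) (h.adj_of_mem hki hxE hxk hxi)
      (h.adj_of_mem hji hxE hxj hxi)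
  -- An open half-disc beside the gap line is connected, covered by the two closed cells, and
  -- disjoint from their intersection, so one of the cells contains it.
  have hside : ∀ w : ℂ, (w * (b - a)).re = 0 →
      (∀ z ∈ Metric.ball x ε, 0 < (w * (z - x)).re → z ∈ cell j) ∨
      (∀ z ∈ Metric.ball x ε, 0 < (w * (z - x)).re → z ∈ cell k) := by
    intro w hw
    by_contra! hcon
    obtain ⟨⟨z, hz, hzw, hzj⟩, ⟨z', hz', hzw', hzk'⟩⟩ := hcon
    obtain ⟨y, hy, hy'⟩ := isPreconnected_closed_iff.1 (isPreconnected_halfDisc x w ε)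
      (cell j) (cell k) (hcl j) (hcl k) (fun y hy => hcov y hy.1)
      ⟨z', ⟨hz', hzw'⟩, (hcov z' hz').resolve_right hzk'⟩
      ⟨z, ⟨hz, hzw⟩, (hcov z hz).resolve_left hzj⟩
    rw [hcell] at hy'
    exact hy.2.ne' (mul_sub_re_eq_zero_of_mem_segment hw hx hy')
  have hba : b - a ≠ 0 := sub_ne_zero.2 hab.symm
  have hw0 : (Complex.I / (b - a)) ≠ 0 := div_ne_zero Complex.I_ne_zero hba
  have hw1 : (Complex.I / (b - a) * (b - a)).re = 0 := by
    rw [div_mul_cancel₀ _ hba, Complex.I_re]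
  have hw2 : (-(Complex.I / (b - a)) * (b - a)).re = 0 := by
    rw [neg_mul, Complex.neg_re, hw1, neg_zero]
  have hbE : Metric.ball x ε ⊆ E := fun z hz => interior_subset (hb hz).2
  rcases hside _ hw1 with h1 | h1
  · exact ⟨_, hw0, hw1, ε, hε, hbE, h1⟩
  rcases hside _ hw2 with h2 | h2
  · exact ⟨_, neg_ne_zero.2 hw0, hw2, ε, hε, hbE, h2⟩
  -- Now both half-discs belong to `cell k`. The cell `j` is the closure of its interior, so it has
  -- a point near `x` off the gap line, which then lies in both cells.
  exfalso
  have hxcl : x ∈ closure (interior (cell j)) := by rw [h.partition.region]; exact hxj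
  obtain ⟨z, hz, hzj⟩ := mem_closure_iff.1 hxcl _ Metric.isOpen_ball (Metric.mem_ball_self hε)
  obtain ⟨y, hy, hy'⟩ := exists_mul_re_ne_zero (Metric.isOpen_ball.inter isOpen_interior)
    ⟨hz, hzj⟩ hw0 x
  have hyk : y ∈ cell k := by
    rcases hy'.lt_or_gt with hlt | hlt
    · refine h2 y hy.1 ?_
      rw [neg_mul, Complex.neg_re]; linarith
    · exact h1 y hy.1 hlt
  have : y ∈ cell j ∩ cell k := ⟨interior_subset hy.2, hyk⟩
  rw [hcell] at this
  exact hy' (mul_sub_re_eq_zero_of_mem_segment hw1 hx this)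

end HalfDisc

/-! ### Points with a fully visible neighbourhood -/

section Visibility

/-- If `x` lies on a gap that is not aligned with `p`, then all points near `x` are visible. -/
theorem mem_interior_visibilitySet {E C : Set ℂ} {p x w : ℂ} (hC : C ⊆ E)
    (hp : ∀ z ∈ C, segment ℝ p z ⊆ C) {ε : ℝ} (hε : 0 < ε) (hb : Metric.ball x ε ⊆ E)
    (hh : ∀ z ∈ Metric.ball x ε, 0 < (w * (z - x)).re → z ∈ C)
    (hpx : (w * (p - x)).re ≠ 0) : x ∈ interior (visibilitySet E p) := by
  set s : ℝ := (w * (p - x)).re with hs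
  set M : ℝ := ‖x - p‖ + ε with hM
  have hM0 : 0 < M := by positivity
  obtain ⟨τ, hτ, hτs⟩ : ∃ τ : ℝ, (τ = 1 ∨ τ = -1) ∧ 0 < τ * s := by
    rcases hpx.lt_or_gt with h | h
    · exact ⟨-1, Or.inr rfl, by linarith⟩
    · exact ⟨1, Or.inl rfl, by linarith⟩
  have hτ1 : |τ| = 1 := by rcases hτ with rfl | rfl <;> simp
  set c : ℝ := min (1 / 2) (ε / (2 * M)) with hc
  have hc0 : 0 < c := lt_min (by norm_num) (by positivity)
  have hc1 : c ≤ 1 / 2 := min_le_left _ _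
  have hcM : c * M ≤ ε / 2 := by
    have : c ≤ ε / (2 * M) := min_le_right _ _
    rw [le_div_iff₀ (by positivity)] at this
    linarith
  have hcont : Continuous fun z : ℂ => |(w * (z - x)).re| := by fun_prop
  have hev : ∀ᶠ z in 𝓝 x, |(w * (z - x)).re| < c * (τ * s) / 2 := by
    have := hcont.tendsto x
    simp only [sub_self, mul_zero, Complex.zero_re, abs_zero] at this
    exact this.eventually (gt_mem_nhds (by positivity))
  rw [mem_interior_iff_mem_nhds]
  filter_upwards [hev, Metric.ball_mem_nhds x (half_pos hε)] with z hz hzb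
  rw [mem_ball_iff_norm] at hzb
  have hzE : z ∈ E := hb (by rw [mem_ball_iff_norm]; linarith)
  refine ⟨hzE, ?_⟩
  have hzp : ‖z - p‖ ≤ M := by
    have := norm_add_le (z - x) (x - p)
    rw [sub_add_sub_cancel] at this
    linarith
  -- `z` is moved along its line of sight into the half-disc: back towards `p` if `p` is on that
  -- side (`τ = 1`), beyond `z` otherwise. The sight line to the moved point stays in `C` by
  -- star-shapedness, and any remaining piece stays in the ball.
  set r' : ℝ := 1 - τ * c with hr'
  have hr'0 : 1 / 2 ≤ r' ∧ r' ≤ 3 / 2 := by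
    rcases hτ with h | h <;> rw [hr', h] <;> constructor <;> linarith
  set z' : ℂ := p + r' * (z - p) with hz'
  have hz'b : z' ∈ Metric.ball x ε := by
    rw [mem_ball_iff_norm, show z' - x = (z - x) + ((-(τ * c) : ℝ) : ℂ) * (z - p) by
      rw [hz', hr']; push_cast; ring]
    have h1 := norm_add_le (z - x) (((-(τ * c) : ℝ) : ℂ) * (z - p))
    rw [norm_mul, Complex.norm_real, Real.norm_eq_abs, abs_neg, abs_mul, hτ1, one_mul,
      abs_of_pos hc0] at h1
    have h2 := mul_le_mul_of_nonneg_left hzp hc0.le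
    linarith
  have hz'C : z' ∈ C := by
    refine hh z' hz'b ?_
    rw [show w * (z' - x) = ((τ * c : ℝ) : ℂ) * (w * (p - x)) + (r' : ℂ) * (w * (z - x)) by
      rw [hz', hr']; push_cast; ring, Complex.add_re, Complex.re_ofReal_mul,
      Complex.re_ofReal_mul, ← hs]
    rw [abs_lt] at hz
    have h3 : 0 < c * (τ * s) := by positivity
    nlinarith [hz.1, hr'0.1, hr'0.2]
  intro y hy
  rw [segment_eq_image'] at hy
  obtain ⟨r, hr, rfl⟩ := hy
  rcases le_or_gt r r' with hrr | hrr
  · refine hC (hp z' hz'C ?_)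
    rw [segment_eq_image']
    have : 0 < r' := by linarith [hr'0.1]
    refine ⟨r / r', ⟨div_nonneg hr.1 this.le, (div_le_one this).2 hrr⟩, ?_⟩
    have : (r' : ℂ) ≠ 0 := by exact_mod_cast this.ne'
    simp only [Complex.real_smul, hz']
    push_cast
    field_simp
    ring
  · refine hb ?_
    simp only [Complex.real_smul]
    rw [mem_ball_iff_norm, show p + (r : ℂ) * (z - p) - x = (z - x) + ((r - 1 : ℝ) : ℂ) * (z - p) by
      push_cast; ring]
    have h1 := norm_add_le (z - x) (((r - 1 : ℝ) : ℂ) * (z - p))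
    have h4 : |r - 1| ≤ c := by
      rw [abs_le]
      rcases hτ with h | h <;> rw [hr', h] at hrr <;> constructor <;> linarith [hr.2]
    rw [norm_mul, Complex.norm_real, Real.norm_eq_abs] at h1
    have h2 := mul_le_mul h4 hzp (norm_nonneg _) hc0.le
    linarith

/-- All points near `x` are visible from `p` if the half-open segment `]p, x]` is in the interior
and the environment is star-shaped near `p`. -/
theorem mem_interior_visibilitySet_of_openSegment {E : Set ℂ} {p x : ℂ} {ε : ℝ} (hε : 0 < ε)
    (hcon : ∀ z ∈ Metric.ball p ε, z ∈ E → segment ℝ p z ⊆ E)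
    (hseg : ∀ r ∈ Ioc (0 : ℝ) 1, p + r * (x - p) ∈ interior E) :
    x ∈ interior (visibilitySet E p) := by
  obtain ⟨r₀, hr₀, hr₀b⟩ : ∃ r₀ ∈ Ioc (0 : ℝ) 1, p + r₀ * (x - p) ∈ Metric.ball p ε := by
    have hc : Filter.Tendsto (fun t : ℝ => p + t * (x - p)) (𝓝[>] 0) (𝓝 p) := by
      have : Continuous fun t : ℝ => p + t * (x - p) := by fun_prop
      have := this.tendsto 0
      simp only [Complex.ofReal_zero, zero_mul, add_zero] at this
      exact this.mono_left nhdsWithin_le_nhds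
    obtain ⟨t, ht, ht0⟩ := ((hc.eventually (Metric.ball_mem_nhds p hε)).and
      (Ioc_mem_nhdsGT one_pos)).exists
    exact ⟨t, ht0, ht⟩
  -- Away from `p` the sight line is a compact subset of the open interior, so nearby sight lines
  -- stay inside too. The rest, near `p`, is handled by local star-shapedness.
  have hev1 : ∀ᶠ z in 𝓝 x, ∀ r ∈ Icc r₀ 1, p + (r : ℂ) * (z - p) ∈ interior E := by
    refine isCompact_Icc.eventually_forall_of_forall_eventually fun r hr => ?_
    have hc : Continuous fun q : ℂ × ℝ => p + (q.2 : ℂ) * (q.1 - p) := by fun_prop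
    exact hc.continuousAt.eventually (isOpen_interior.mem_nhds (hseg r ⟨hr₀.1.trans_le hr.1, hr.2⟩))
  have hev2 : ∀ᶠ z in 𝓝 x, p + (r₀ : ℂ) * (z - p) ∈ Metric.ball p ε := by
    have hc : Continuous fun z : ℂ => p + (r₀ : ℂ) * (z - p) := by fun_prop
    exact hc.continuousAt.eventually (Metric.isOpen_ball.mem_nhds hr₀b)
  rw [mem_interior_iff_mem_nhds]
  filter_upwards [hev1, hev2] with z h1 h2
  refine ⟨by simpa using interior_subset (h1 1 ⟨hr₀.2, le_rfl⟩), fun y hy => ?_⟩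
  rw [segment_eq_image'] at hy
  obtain ⟨r, hr, rfl⟩ := hy
  rcases le_total r₀ r with h | h
  · simpa using interior_subset (h1 r ⟨h, hr.2⟩)
  · refine hcon _ h2 (interior_subset (h1 r₀ ⟨le_rfl, hr₀.2⟩)) ?_
    rw [segment_eq_image']
    refine ⟨r / r₀, ⟨div_nonneg hr.1 hr₀.1.le, (div_le_one hr₀.1).2 h⟩, ?_⟩
    have : (r₀ : ℂ) ≠ 0 := by exact_mod_cast hr₀.1.ne'
    simp only [Complex.real_smul]
    push_cast
    field_simp
    ring

end Visibility

/-! ### Visibility gaps are aligned with the observer -/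

section Gaps

/-- A segment determines its ends as a set. The separating gap of the partition and the visibility
gap are given by different pairs of points, and this transfers the frontier condition. -/
theorem left_mem_frontier_of_segment_eq {E : Set ℂ} {a b a' b' : ℂ} (hg : IsGap E a' b')
    (h : segment ℝ a' b' = segment ℝ a b) : a ∈ frontier E := by
  have ha : a ∈ segment ℝ a' b' := h ▸ left_mem_segment ..
  by_cases h1 : a = a'
  · rw [h1]; exact hg.2.1
  by_cases h2 : a = b'
  · rw [h2]; exact hg.2.2.1
  exfalso
  have ha' := mem_openSegment_of_ne_left_right (Ne.symm h1) (Ne.symm h2) ha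
  have h3 : a' ∈ segment ℝ a b := h ▸ left_mem_segment ..
  have h4 : b' ∈ segment ℝ a b := h ▸ right_mem_segment ..
  rw [segment_eq_image'] at h3 h4
  obtain ⟨s, hs, rfl⟩ := h3
  obtain ⟨t, ht, rfl⟩ := h4
  obtain ⟨α, β, hα, hβ, hαβ, heq⟩ := ha'
  have hab : b - a ≠ 0 := by
    intro h0
    simp [h0] at h1
  have h5 : ((α * s + β * t : ℝ) : ℂ) * (b - a) = 0 := by
    simp only [Complex.real_smul] at heq
    push_cast
    have : (α : ℂ) + β = 1 := by exact_mod_cast hαβ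
    linear_combination heq - a * this
  rcases mul_eq_zero.1 h5 with h6 | h6
  · have h6 : α * s + β * t = 0 := by exact_mod_cast h6
    have h7 : s = 0 := by
      have := mul_nonneg hα.le hs.1
      have := mul_nonneg hβ.le ht.1
      have : α * s = 0 := by linarith
      exact (mul_eq_zero.1 this).resolve_left hα.ne'
    apply h1
    simp [h7]
  · exact hab h6

variable {E : Set ℂ} {N : ℕ} {cell : Fin N → Set ℂ} {root : Fin N} {pos : Fin N → ℂ}

theorem interior_rvsRegion_subset (k : Fin N) :
    interior (rvsRegion E cell root k) ⊆ interior E := interior_mono fun _ hx => hx.1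

/-- In a Reflex Vertex Straddling deployment, the gap `[a, pos k]` from agent `j` to its child `k`
is aligned with `pos j`, and near `a` the cell of `j` contains a half-disc along the gap. -/
theorem IsRVS.exists_gap (hE : IsPTSSTree E cell root pos)
    (hcon : ∀ p ∈ frontier E, ∃ ε > 0, ∀ x ∈ Metric.ball p ε, x ∈ E → segment ℝ p x ⊆ E)
    (hR : IsRVS E cell root pos) {j k : Fin N} (hjk : IsParent cell root j k) :
    ∃ a, a ∈ frontier E ∧ cell j ∩ cell k = segment ℝ a (pos k) ∧
      openSegment ℝ a (pos k) ⊆ interior E ∧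
      (∃ t : ℝ, 0 < t ∧ pos k - a = t * (a - pos j)) ∧ a ≠ pos j ∧
      ∃ w : ℂ, w ≠ 0 ∧ (w * (pos k - a)).re = 0 ∧ ∃ ε > 0, ∀ z ∈ Metric.ball a ε,
        0 < (w * (z - a)).re → z ∈ cell j := by
  obtain ⟨a, hcell, ⟨hab, hopen, hfront, -, -⟩, hdist⟩ := hR.child j k hjk
  have hopenE : openSegment ℝ a (pos k) ⊆ interior E :=
    hopen.trans (interior_rvsRegion_subset j)
  have hjk' : j ≠ k := hjk.1.1
  set x : ℂ := midpoint ℝ a (pos k) with hx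
  have hx' : x = a + ((1 / 2 : ℝ) : ℂ) * (pos k - a) := by
    rw [hx, midpoint_eq_smul_add, Complex.real_smul]
    push_cast
    rw [invOf_eq_inv]
    push_cast
    ring
  have hxo : x ∈ openSegment ℝ a (pos k) := by
    rw [openSegment_eq_image']
    exact ⟨1 / 2, ⟨by norm_num, by norm_num⟩, by rw [hx']; simp⟩
  have hxs : x ∈ segment ℝ a (pos k) := openSegment_subset_segment _ _ _ hxo
  have hxE : x ∈ interior E := hopenE hxo
  have haF : a ∈ frontier E := by
    obtain ⟨a', b', hg, hs⟩ := hE.partition.separated j k hjk'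
      ⟨x, hcell ▸ hxs, hxE⟩
    exact left_mem_frontier_of_segment_eq hg (hs.symm.trans hcell)
  obtain ⟨w, hw, hwb, ε, hε, hball, hdisc⟩ :=
    hE.partition.exists_halfDisc hjk' hab hcell hxE hxs
  have hpk := hE.pos_mem j
  have hnotint : x ∉ interior (visibilitySet E (pos j)) := (hfront hxs).2
  -- If the agent were off the gap line, a neighbourhood of the midpoint `x` would be visible,
  -- although `x` lies on the frontier of the visibility set.
  have hpx : (w * (pos j - x)).re = 0 := by
    by_contra hne
    exact hnotint (mem_interior_visibilitySet (hE.partition.cell_subset j) hpk.1.2 hε hball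
      hdisc hne)
  have hba : pos k - a ≠ 0 := sub_ne_zero.2 hab.symm
  obtain ⟨s, hs⟩ : ∃ s : ℝ, pos j = a + s * (pos k - a) := by
    have h1 : (w * (pos k - a)) ≠ 0 := mul_ne_zero hw hba
    have h2 : (w * (pos j - a)).re = 0 := by
      have h3 := mul_sub_re_eq_zero_of_mem_segment hwb (left_mem_segment ℝ a (pos k)) hxs
      have : w * (pos j - a) = w * (pos j - x) + w * (x - a) := by ring
      rw [this, Complex.add_re, hpx, h3, add_zero]
    have h4 : (w * (pos k - a)).im ≠ 0 := fun h => h1 (Complex.ext hwb h)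
    refine ⟨(w * (pos j - a)).im / (w * (pos k - a)).im, ?_⟩
    have h5 : w * (pos j - a) =
        (((w * (pos j - a)).im / (w * (pos k - a)).im : ℝ) : ℂ) * (w * (pos k - a)) := by
      apply Complex.ext
      · rw [Complex.re_ofReal_mul, hwb, mul_zero, h2]
      · rw [Complex.im_ofReal_mul, div_mul_cancel₀ _ h4]
    have h6 : pos j - a =
        (((w * (pos j - a)).im / (w * (pos k - a)).im : ℝ) : ℂ) * (pos k - a) :=
      mul_left_cancel₀ hw (h5.trans (by ring))
    linear_combination h6
  have hl : 0 < ‖pos k - a‖ := norm_pos_iff.2 hba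
  -- Because `a` is the nearer end, a positive `s` would be less than 1, which puts the agent inside
  -- the gap and hence in the interior of the environment.
  have hs0 : s ≤ 0 := by
    by_contra! hpos
    rw [dist_eq_norm, dist_eq_norm] at hdist
    have e1 : pos j - a = (s : ℂ) * (pos k - a) := by rw [hs]; ring
    have e2 : pos j - pos k = ((s - 1 : ℝ) : ℂ) * (pos k - a) := by rw [hs]; push_cast; ring
    rw [e1, e2, norm_mul, norm_mul, Complex.norm_real, Complex.norm_real] at hdist
    have h7 := le_of_mul_le_mul_right hdist hl
    rw [Real.norm_eq_abs, Real.norm_eq_abs, abs_of_pos hpos] at h7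
    have h8 : s < 1 := by
      by_contra! h9
      rw [abs_of_nonneg (by linarith)] at h7
      linarith
    refine hE.pos_notMem_interior j (hopenE ?_)
    rw [openSegment_eq_image']
    exact ⟨s, ⟨hpos, h8⟩, by rw [hs]; simp⟩
  -- An agent standing at `a` would see a whole neighbourhood of the midpoint, again contradicting
  -- the frontier condition.
  have hs1 : s ≠ 0 := by
    rintro rfl
    have hpa : pos j = a := by rw [hs]; simp
    obtain ⟨δ, hδ, hst⟩ := hcon a haF
    refine hnotint ?_
    rw [hpa]
    refine mem_interior_visibilitySet_of_openSegment hδ hst fun r hr => hopenE ?_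
    rw [openSegment_eq_image']
    refine ⟨r / 2, ⟨by linarith [hr.1], by linarith [hr.2]⟩, ?_⟩
    rw [hx']
    simp only [Complex.real_smul]
    push_cast
    ring
  have hs2 : s < 0 := lt_of_le_of_ne hs0 hs1
  refine ⟨a, haF, hcell, hopenE, ⟨-s⁻¹, by
    have := inv_lt_zero.2 hs2; linarith, ?_⟩, ?_, w, hw, hwb, ?_⟩
  · have : (s : ℂ) ≠ 0 := by exact_mod_cast hs1
    rw [hs]
    push_cast
    field_simp
    ring
  · intro h
    have : (s : ℂ) * (pos k - a) = 0 := by linear_combination hs.symm.trans h.symm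
    rcases mul_eq_zero.1 this with h | h
    · exact hs1 (by exact_mod_cast h)
    · exact hba h
  -- The contraction with centre `pos j` and ratio `r` sends the midpoint `x` to `a`. The
  -- star-shaped cell therefore contains the contracted half-disc at `a`.
  · set r : ℝ := s / (s - 1 / 2) with hr
    have hs3 : s - 1 / 2 < 0 := by linarith
    have hr0 : 0 < r := div_pos_of_neg_of_neg hs2 hs3
    have hr1 : r < 1 := by
      rw [hr, div_lt_one_of_neg hs3]; linarith
    refine ⟨r * ε, by positivity, fun z hz hzw => ?_⟩
    have hrc : (r : ℂ) ≠ 0 := by exact_mod_cast hr0.ne'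
    have hax : a - pos j = r * (x - pos j) := by
      have h1 : r * (s - 1 / 2) = s := div_mul_cancel₀ _ hs3.ne
      have h2 : (r : ℂ) * (s - 1 / 2) = s := by
        rw [← Complex.ofReal_inj] at h1
        push_cast at h1
        exact h1
      rw [hs, hx']
      push_cast
      linear_combination (pos k - a) * h2
    set z' : ℂ := x + (r : ℂ)⁻¹ * (z - a) with hz'
    have hz'C : z' ∈ cell j := by
      refine hdisc z' ?_ ?_
      · rw [mem_ball_iff_norm] at hz ⊢
        rw [hz', add_sub_cancel_left, norm_mul, norm_inv, Complex.norm_real, Real.norm_eq_abs,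
          abs_of_pos hr0, inv_mul_lt_iff₀ hr0]
        exact hz
      · rw [hz', add_sub_cancel_left, mul_left_comm, ← Complex.ofReal_inv, Complex.re_ofReal_mul]
        exact mul_pos (inv_pos.2 hr0) hzw
    refine hpk.1.2 z' hz'C ?_
    rw [segment_eq_image']
    refine ⟨r, ⟨hr0.le, hr1.le⟩, ?_⟩
    simp only [Complex.real_smul, hz']
    have : (r : ℂ) * (x + (r : ℂ)⁻¹ * (z - a) - pos j) = r * (x - pos j) + (z - a) := by
      field_simp
      ring
    rw [this, ← hax]
    ring

end Gaps

end PTSS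

namespace PTSS

/-! ### Near ends of visibility gaps are reflex vertices -/

section Reflex

theorem mem_directions_of_mul_unit_re_pos {E : Set ℂ} {a w : ℂ} {ε : ℝ} (hε : 0 < ε)
    (h : ∀ z ∈ Metric.ball a ε, 0 < (w * (z - a)).re → z ∈ E) {θ : ℝ}
    (hθ : 0 < (w * unit θ).re) : θ ∈ directions E a := by
  refine ⟨ε, hε, fun ρ hρ => h _ ?_ ?_⟩
  · rw [mem_ball_iff_norm, add_sub_cancel_left, norm_mul, norm_unit, mul_one, Complex.norm_real,
      Real.norm_eq_abs, abs_of_pos hρ.1]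
    exact hρ.2
  · rw [add_sub_cancel_left, mul_left_comm, Complex.re_ofReal_mul]
    exact mul_pos hρ.1 hθ

theorem exists_unit_eq (z : ℂ) : ∃ θ : ℝ, z = ‖z‖ * unit θ :=
  ⟨z.arg, (Complex.norm_mul_exp_arg_mul_I z).symm⟩

/-- One interior point close to `a` has a neighbourhood in the set, and local star-shapedness fills
in the segments from `a`. -/
theorem mem_directions_near {E : Set ℂ} {a : ℂ} {ε : ℝ} (hε : 0 < ε)
    (hcon : ∀ z ∈ Metric.ball a ε, z ∈ E → segment ℝ a z ⊆ E) {θ : ℝ}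
    (hθ : ∀ ε > 0, ∃ ρ ∈ Ioo (0 : ℝ) ε, a + ρ * unit θ ∈ interior E) :
    ∃ δ > 0, ∀ η ∈ Ioo (θ - δ) (θ + δ), η ∈ directions E a := by
  obtain ⟨ρ, hρ, hint⟩ := hθ ε hε
  have hc : Continuous fun η : ℝ => a + ρ * unit η := by
    have := continuous_unit
    fun_prop
  obtain ⟨δ, hδ, hb⟩ := Metric.eventually_nhds_iff_ball.1
    (hc.continuousAt.eventually (isOpen_interior.mem_nhds hint))
  refine ⟨δ, hδ, fun η hη => ⟨ρ, hρ.1, fun r hr => ?_⟩⟩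
  have hη' := interior_subset (hb η (by rwa [Real.ball_eq_Ioo]))
  refine hcon _ ?_ hη' ?_
  · rw [mem_ball_iff_norm, add_sub_cancel_left, norm_mul, norm_unit, mul_one, Complex.norm_real,
      Real.norm_eq_abs, abs_of_pos hρ.1]
    exact hρ.2
  · rw [segment_eq_image']
    refine ⟨r / ρ, ⟨div_nonneg hr.1.le hρ.1.le, (div_le_one hρ.1).2 hr.2.le⟩, ?_⟩
    have : (ρ : ℂ) ≠ 0 := by exact_mod_cast hρ.1.ne'
    simp only [Complex.real_smul]
    push_cast
    field_simp
    ring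

/-- The interior angle exceeds `π` if the set contains a half-disc together with a
neighbourhood of one of the two boundary directions of the half-disc. -/
theorem pi_lt_interiorAngle {E : Set ℂ} {a b w : ℂ} (hw : w ≠ 0) (hab : a ≠ b)
    (hwb : (w * (b - a)).re = 0) {ε : ℝ} (hε : 0 < ε)
    (h : ∀ z ∈ Metric.ball a ε, 0 < (w * (z - a)).re → z ∈ E)
    (hcon : ∀ z ∈ Metric.ball a ε, z ∈ E → segment ℝ a z ⊆ E)
    (hopen : openSegment ℝ a b ⊆ interior E) : Real.pi < interiorAngle E a := by
  have hpi := Real.pi_pos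
  obtain ⟨θ, hθ⟩ := exists_unit_eq (b - a)
  have hl : 0 < ‖b - a‖ := norm_pos_iff.2 (sub_ne_zero.2 hab.symm)
  have hlw : 0 < ‖w‖ := norm_pos_iff.2 hw
  have hcos : Real.cos (θ + w.arg) = 0 := by
    rw [hθ, mul_left_comm, Complex.re_ofReal_mul, mul_unit_re] at hwb
    rcases mul_eq_zero.1 hwb with h0 | h0
    · exact absurd h0 hl.ne'
    · exact (mul_eq_zero.1 h0).resolve_left hlw.ne'
  obtain ⟨δ, hδ, hnear⟩ := mem_directions_near (θ := θ) hε hcon (fun e he => by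
    refine ⟨min (e / 2) (‖b - a‖ / 2), ⟨by positivity, (min_le_left _ _).trans_lt (by linarith)⟩,
      hopen ?_⟩
    rw [openSegment_eq_image']
    refine ⟨min (e / 2) (‖b - a‖ / 2) / ‖b - a‖, ⟨by positivity, ?_⟩, ?_⟩
    · rw [div_lt_one hl]
      exact (min_le_right _ _).trans_lt (by linarith)
    · have h3 : (‖b - a‖ : ℂ) ≠ 0 := by exact_mod_cast hl.ne'
      have h4 : b - a = (‖b - a‖ : ℂ) * unit θ := hθ
      generalize min (e / 2) (‖b - a‖ / 2) = m
      generalize ‖b - a‖ = l at h3 h4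
      simp only [Complex.real_smul, h4]
      push_cast
      field_simp)
  have hhalf : ∀ η, 0 < Real.cos (η + w.arg) → η ∈ directions E a := fun η hη =>
    mem_directions_of_mul_unit_re_pos hε h (by rw [mul_unit_re]; positivity)
  set δ' := min δ (Real.pi / 2) with hδ'
  have hδ'0 : 0 < δ' := lt_min hδ (by linarith)
  have hδ'1 : δ' ≤ δ := min_le_left _ _
  have hδ'2 : δ' ≤ Real.pi / 2 := min_le_right _ _
  have hcos' : ∀ η, Real.cos (η + w.arg) = -Real.sin (θ + w.arg) * Real.sin (η - θ) := by
    intro η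
    rw [show η + w.arg = (θ + w.arg) + (η - θ) by ring, Real.cos_add, hcos]
    ring
  -- The sign tells whether the half-disc of directions ends or begins at the gap direction `θ`. In
  -- both cases the neighbourhood of `θ` extends an interval of length π by `δ'`.
  have hsin : Real.sin (θ + w.arg) = 1 ∨ Real.sin (θ + w.arg) = -1 := by
    have := Real.sin_sq_add_cos_sq (θ + w.arg)
    rw [hcos] at this
    exact mul_self_eq_one_iff.1 (by linarith)
  rcases hsin with h1 | h1
  · have := le_interiorAngle (E := E) (x := a) (c := θ - Real.pi) (d := θ + δ') (by linarith)
      (fun η hη => by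
        rcases le_or_gt (θ - δ') η with h2 | h2
        · rcases eq_or_lt_of_le h2 with h3 | h3
          · refine hhalf η ?_
            rw [hcos', h1, ← h3]
            have := Real.sin_pos_of_pos_of_lt_pi hδ'0 (by linarith)
            rw [show θ - δ' - θ = -δ' by ring, Real.sin_neg]
            linarith
          · exact hnear η ⟨by linarith, by linarith [hη.2]⟩
        · refine hhalf η ?_
          rw [hcos', h1]
          have := Real.sin_neg_of_neg_of_neg_pi_lt (x := η - θ) (by linarith) (by linarith [hη.1])
          linarith)
    linarith
  · have := le_interiorAngle (E := E) (x := a) (c := θ - δ') (d := θ + Real.pi) (by linarith)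
      (fun η hη => by
        rcases le_or_gt (θ + δ') η with h2 | h2
        · refine hhalf η ?_
          rw [hcos', h1]
          have := Real.sin_pos_of_pos_of_lt_pi (x := η - θ) (by linarith) (by linarith [hη.2])
          linarith
        · exact hnear η ⟨by linarith [hη.1], by linarith⟩)
    linarith

variable {n : ℕ} {Q : Polygon ℂ n}

/-- At a frontier point that is not a vertex, the interior angle is at most `π`. -/
theorem IsSimple.interiorAngle_le_pi (hQ : IsSimple Q) {a : ℂ}
    (ha : a ∈ frontier (environment Q)) (hv : ∀ i, a ≠ Q i) :
    interiorAngle (environment Q) a ≤ Real.pi := by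
  obtain ⟨i, hi⟩ := mem_iUnion.1 (frontier_environment_subset ha)
  obtain ⟨ε, hε, hloc⟩ := exists_ball_inter_boundary (Q := Q) a
  have hedge : ∀ x ∈ Metric.ball a ε, x ∈ Q.boundary ℝ → x ∈ Q.edgeSet ℝ i := by
    intro x hx hxb
    obtain ⟨j, hxj, haj⟩ := hloc x hx hxb
    by_cases hij : i = j
    · rwa [hij]
    · rcases hQ.eq_of_mem_of_mem hij hi haj with ⟨-, h⟩ | ⟨-, h⟩
      · exact absurd h (hv j)
      · exact absurd h (hv i)
  set d := Q (finRotate n i) - Q i with hd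
  have hd0 : d ≠ 0 := by
    intro h0
    rw [edgeSet_eq_segment, sub_eq_zero.1 h0, segment_same] at hi
    exact hv i hi
  set w := Complex.I / d with hw
  have hw0 : w ≠ 0 := div_ne_zero Complex.I_ne_zero hd0
  have hwd : (w * d).re = 0 := by rw [hw, div_mul_cancel₀ _ hd0, Complex.I_re]
  rw [edgeSet_eq_segment] at hi
  have hmiss : ∀ w : ℂ, (w * d).re = 0 →
      Disjoint {z | z ∈ Metric.ball a ε ∧ 0 < (w * (z - a)).re} (Q.boundary ℝ) := by
    intro w hw
    refine disjoint_left.2 fun z hz hzb => ?_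
    have := hedge z hz.1 hzb
    rw [edgeSet_eq_segment] at this
    exact hz.2.ne' (mul_sub_re_eq_zero_of_mem_segment hw hi this)
  -- Near a point that is not a vertex the boundary stays on a single edge. Each half-disc beside it
  -- is thus entirely inside or entirely outside, and both inside would make `a` an interior point.
  have hall : ∀ w : ℂ, (w * d).re = 0 →
      (∀ z ∈ Metric.ball a ε, 0 < (w * (z - a)).re → z ∈ environment Q) ∨
      (∀ z ∈ Metric.ball a ε, 0 < (w * (z - a)).re → z ∉ environment Q) := by
    intro w hw
    by_contra! hcon
    obtain ⟨⟨z, hz, hzw, hzE⟩, ⟨y, hy, hyw, hyE⟩⟩ := hcon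
    exact hzE ((mem_environment_iff_of_isPreconnected (isPreconnected_halfDisc a w ε)
      (hmiss w hw) ⟨hy, hyw⟩ ⟨hz, hzw⟩).1 hyE)
  have hfin : ∀ w : ℂ, w ≠ 0 →
      (∀ z ∈ Metric.ball a ε, 0 < (w * (z - a)).re → z ∉ environment Q) →
      interiorAngle (environment Q) a ≤ Real.pi := by
    intro w hw h
    refine PTSS.interiorAngle_le_pi (neg_ne_zero.2 hw) fun θ hθ => ?_
    by_contra! hlt
    rw [neg_mul, Complex.neg_re, neg_lt_zero] at hlt
    obtain ⟨e, he, hx⟩ := hθ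
    obtain ⟨e', he', hx'⟩ := mem_directions_of_mul_unit_re_pos (E := (environment Q)ᶜ) hε h hlt
    have hm : min e e' / 2 < min e e' := by have := lt_min he he'; linarith
    have hm0 : 0 < min e e' / 2 := by have := lt_min he he'; linarith
    exact hx' (min e e' / 2) ⟨hm0, hm.trans_le (min_le_right _ _)⟩
      (hx (min e e' / 2) ⟨hm0, hm.trans_le (min_le_left _ _)⟩)
  have hwd' : (-w * d).re = 0 := by rw [neg_mul, Complex.neg_re, hwd, neg_zero]
  rcases hall w hwd with h1 | h1
  · rcases hall (-w) hwd' with h2 | h2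
    · exfalso
      refine ha.2 (mem_interior_of_mul_re_ne_zero isClosed_environment hw0 hε fun z hz hne => ?_)
      rcases hne.lt_or_gt with hlt | hlt
      · exact h2 z hz (by rw [neg_mul, Complex.neg_re]; linarith)
      · exact h1 z hz hlt
    · exact hfin _ (neg_ne_zero.2 hw0) h2
  · exact hfin w hw0 h1

end Reflex

/-! ### One reflex vertex for each agent other than the root -/

section Injective

/-- Two half-discs at a frontier point overlap. -/
theorem exists_mem_halfDisc_inter {E : Set ℂ} (hE : IsClosed E) {a w w' : ℂ} (ha : a ∉ interior E)
    (hw : w ≠ 0) (hw' : w' ≠ 0) {ε : ℝ} (hε : 0 < ε)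
    (h : ∀ z ∈ Metric.ball a ε, 0 < (w * (z - a)).re → z ∈ E)
    (h' : ∀ z ∈ Metric.ball a ε, 0 < (w' * (z - a)).re → z ∈ E) :
    ∃ z ∈ Metric.ball a ε, 0 < (w * (z - a)).re ∧ 0 < (w' * (z - a)).re := by
  by_contra! hcon
  refine ha (mem_interior_of_mul_re_ne_zero hE hw hε fun z hz hne => ?_)
  rcases hne.lt_or_gt with hlt | hlt
  · refine h' z hz ?_
    by_contra! hle
    -- The reflection of `z` in `a` lies in the first half-disc and in the closure of the second. A
    -- small push along `w'⁻¹` puts it into both.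
    have hc : Filter.Tendsto (fun t : ℝ => a - (z - a) + t * w'⁻¹) (𝓝[>] 0)
        (𝓝 (a - (z - a))) := by
      have : Continuous fun t : ℝ => a - (z - a) + t * w'⁻¹ := by fun_prop
      have := this.tendsto 0
      simp only [Complex.ofReal_zero, zero_mul, add_zero] at this
      exact this.mono_left nhdsWithin_le_nhds
    have hball : a - (z - a) ∈ Metric.ball a ε := by
      rw [mem_ball_iff_norm] at hz ⊢
      rwa [sub_sub_cancel_left, norm_neg]
    have hpos : {y : ℂ | 0 < (w * (y - a)).re} ∈ 𝓝 (a - (z - a)) := by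
      refine (isOpen_lt continuous_const (by fun_prop)).mem_nhds ?_
      rw [mem_ofPred_eq, sub_sub_cancel_left, mul_neg, Complex.neg_re]
      linarith
    obtain ⟨t, ⟨ht1, ht2⟩, ht0⟩ := (((hc.eventually (Metric.isOpen_ball.mem_nhds hball)).and
      (hc.eventually hpos)).and self_mem_nhdsWithin).exists
    have := hcon _ ht1 ht2
    rw [show w' * (a - (z - a) + t * w'⁻¹ - a) = -(w' * (z - a)) + t by field_simp; ring,
      Complex.add_re, Complex.neg_re, Complex.ofReal_re] at this
    have ht0 : (0 : ℝ) < t := ht0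
    linarith
  · exact h z hz hlt

variable {n N : ℕ} {Q : Polygon ℂ n} {cell : Fin N → Set ℂ} {root : Fin N} {pos : Fin N → ℂ}

/-- A Reflex Vertex Straddling deployment has at most one more agent than there are
reflex vertices. -/
theorem IsRVS.le_numReflex (hn : 0 < n) (hQ : IsSimple Q) (hE : IsPTSSTree (environment Q) cell root pos)
    (hR : IsRVS (environment Q) cell root pos) : N ≤ numReflex Q + 1 := by
  have hcon : ∀ p ∈ frontier (environment Q), ∃ ε > 0, ∀ x ∈ Metric.ball p ε,
      x ∈ environment Q → segment ℝ p x ⊆ environment Q := fun p hp =>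
    exists_ball_segment_subset (frontier_environment_subset hp)
  have key : ∀ k, k ≠ root → ∃ i, Real.pi < interiorAngle (environment Q) (Q i) ∧ ∃ j,
      IsParent cell root j k ∧ cell j ∩ cell k = segment ℝ (Q i) (pos k) ∧
      openSegment ℝ (Q i) (pos k) ⊆ interior (environment Q) ∧ Q i ∈ frontier (environment Q) ∧
      (∃ t : ℝ, 0 < t ∧ pos k - Q i = t * (Q i - pos j)) ∧
      ∃ w : ℂ, w ≠ 0 ∧ ∃ ε > 0, ∀ z ∈ Metric.ball (Q i) ε,
        0 < (w * (z - Q i)).re → z ∈ cell j := by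
    intro k hk
    obtain ⟨j, hj⟩ := exists_parent hE.partition.tree hk
    obtain ⟨a, haF, hcell, hopen, ⟨t, ht, hpt⟩, hne, w, hw, hwb, ε, hε, hdisc⟩ :=
      hR.exists_gap hE hcon hj
    obtain ⟨ε', hε', hst⟩ := hcon a haF
    have hak : a ≠ pos k := by
      intro h
      rw [← h, sub_self] at hpt
      have : (t : ℂ) ≠ 0 := by exact_mod_cast ht.ne'
      rcases mul_eq_zero.1 hpt.symm with h1 | h1
      · exact this h1
      · exact hne (sub_eq_zero.1 h1)
    have hang : Real.pi < interiorAngle (environment Q) a :=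
      pi_lt_interiorAngle hw hak hwb (lt_min hε hε')
        (fun z hz hzw => hE.partition.cell_subset j
          (hdisc z (Metric.ball_subset_ball (min_le_left _ _) hz) hzw))
        (fun z hz => hst z (Metric.ball_subset_ball (min_le_right _ _) hz)) hopen
    obtain ⟨i, rfl⟩ : ∃ i, a = Q i := by
      by_contra! hcon
      exact absurd (hQ.interiorAngle_le_pi haF hcon) (not_le.2 hang)
    exact ⟨i, hang, j, hj, hcell, hopen, haF, ⟨t, ht, hpt⟩, w, hw, ε, hε, hdisc⟩
  have : Nonempty (Fin n) := ⟨⟨0, hn⟩⟩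
  choose! f hf using key
  have hinj : InjOn f {k | k ≠ root} := by
    intro k hk k' hk' hkk
    by_contra hne
    obtain ⟨-, j, hj, hcell, hopen, haF, ⟨t, ht, hpt⟩, w, hw, ε, hε, hdisc⟩ := hf k hk
    obtain ⟨-, j', hj', hcell', hopen', -, ⟨t', ht', hpt'⟩, w', hw', ε', hε', hdisc'⟩ := hf k' hk'
    rw [← hkk] at hcell' hopen' hpt' hdisc'
    generalize Q (f k) = a at *
    -- With a common parent, both gaps continue the same line of sight beyond `a` and overlap, so
    -- the children are adjacent and form a triangle with the parent. With different parents, their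
    -- half-discs at the frontier point `a` overlap, against disjointness of interiors.
    by_cases hjj : j = j'
    · subst hjj
      set s := min t t' / 2 with hs
      have hs0 : 0 < s := by have := lt_min ht ht'; linarith
      have hst : s < t := by have := lt_min ht ht'; have := min_le_left t t'; linarith
      have hst' : s < t' := by have := lt_min ht ht'; have := min_le_right t t'; linarith
      have hmem : ∀ k t, 0 < t → s < t → pos k - a = (t : ℂ) * (a - pos j) →
          a + s * (a - pos j) ∈ openSegment ℝ a (pos k) := by
        intro k t ht hst hpt
        rw [openSegment_eq_image']
        refine ⟨s / t, ⟨by positivity, (div_lt_one ht).2 hst⟩, ?_⟩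
        have : (t : ℂ) ≠ 0 := by exact_mod_cast ht.ne'
        simp only [Complex.real_smul, hpt]
        push_cast
        field_simp
      have h1 := hmem k t ht hst hpt
      have h2 := hmem k' t' ht' hst' hpt'
      have h3 := hopen h1
      have h4 := openSegment_subset_segment _ _ _ h1
      have h5 := openSegment_subset_segment _ _ _ h2
      rw [← hcell] at h4
      rw [← hcell'] at h5
      exact not_triangle hE.partition.tree hj.1
        (hE.partition.adj_of_mem hne h3 h4.2 h5.2) hj'.1
    · obtain ⟨z, hz, hz1, hz2⟩ := exists_mem_halfDisc_inter isClosed_environment haF.2 hw hw'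
        (lt_min hε hε')
        (fun z hz hzw => hE.partition.cell_subset j
          (hdisc z (Metric.ball_subset_ball (min_le_left _ _) hz) hzw))
        (fun z hz hzw => hE.partition.cell_subset j'
          (hdisc' z (Metric.ball_subset_ball (min_le_right _ _) hz) hzw))
      have hop : ∀ w : ℂ, IsOpen {z : ℂ | 0 < (w * (z - a)).re} := fun w =>
        isOpen_lt continuous_const (by fun_prop)
      have hzj : z ∈ interior (cell j) := mem_interior.2
        ⟨Metric.ball a ε ∩ {z : ℂ | 0 < (w * (z - a)).re}, fun y hy => hdisc y hy.1 hy.2,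
          Metric.isOpen_ball.inter (hop w), Metric.ball_subset_ball (min_le_left _ _) hz, hz1⟩
      have hzj' : z ∈ interior (cell j') := mem_interior.2
        ⟨Metric.ball a ε' ∩ {z : ℂ | 0 < (w' * (z - a)).re}, fun y hy => hdisc' y hy.1 hy.2,
          Metric.isOpen_ball.inter (hop w'), Metric.ball_subset_ball (min_le_right _ _) hz, hz2⟩
      exact disjoint_left.1 (hE.partition.partition.disjoint j j' hjj) hzj hzj'
  have h1 : ({k | k ≠ root} : Set (Fin N)).ncard ≤ numReflex Q :=
    ncard_le_ncard_of_injOn f (fun k hk => (hf k hk).1) hinj (toFinite _)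
  have h2 := ncard_add_ncard_compl ({root} : Set (Fin N))
  rw [ncard_singleton, Nat.card_eq_fintype_card, Fintype.card_fin] at h2
  have h3 : ({root} : Set (Fin N))ᶜ = {k | k ≠ root} := rfl
  rw [h3] at h2
  omega

end Injective

end PTSS

namespace PTSS

/-! ### Continuous logarithms and change of argument -/

section Lift

theorem exists_continuous_exp_eq {A : Type*} [TopologicalSpace A] [SimplyConnectedSpace A]
    [LocallyPathConnectedSpace A] {g : A → ℂ} (hg : Continuous g) (h0 : ∀ a, g a ≠ 0) :
    ∃ Θ : A → ℂ, Continuous Θ ∧ ∀ a, Complex.exp (Θ a) = g a := by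
  obtain ⟨a₀⟩ : Nonempty A := inferInstance
  obtain ⟨F, ⟨-, hF⟩, -⟩ := Complex.isCoveringMapOn_exp.existsUnique_continuousMap_lifts
    (⟨g, hg⟩ : C(A, ℂ)) (a₀ := a₀) (e₀ := Complex.log (g a₀)) (Complex.exp_log (h0 a₀))
    (fun a => h0 a)
  exact ⟨F, F.continuous, fun a => congrFun hF a⟩

/-- As long as the curve stays in the slit plane turned by `w`, the principal logarithm is another
lift. The two differ by a continuous map whose exponential is constant, hence by a constant. -/
theorem im_sub_im_eq_arg_sub_arg {Θ : ℝ → ℂ} (hΘ : Continuous Θ) {a b : ℝ} (hab : a ≤ b) {w : ℂ}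
    (hw : w ≠ 0) (h : ∀ t ∈ Icc a b, Complex.exp (Θ t) / w ∈ Complex.slitPlane) :
    (Θ b).im - (Θ a).im =
      (Complex.exp (Θ b) / w).arg - (Complex.exp (Θ a) / w).arg := by
  have hc : ContinuousOn (fun t => Θ t - Complex.log (Complex.exp (Θ t) / w)) (Icc a b) :=
    hΘ.continuousOn.sub (ContinuousOn.clog (by fun_prop) h)
  have hexp : ∀ t, Complex.exp (Θ t - Complex.log (Complex.exp (Θ t) / w)) = w := by
    intro t
    rw [Complex.exp_sub, Complex.exp_log (div_ne_zero (Complex.exp_ne_zero _) hw)]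
    have := Complex.exp_ne_zero (Θ t)
    field_simp
  have := Complex.isCoveringMap_exp.constOn_of_comp isPreconnected_Icc hc
    (fun t _ t' _ => Subtype.ext ((hexp t).trans (hexp t').symm))
    (right_mem_Icc.2 hab) (left_mem_Icc.2 hab)
  have := congrArg Complex.im this
  simp only [Complex.sub_im, Complex.log_im] at this
  linarith

end Lift

/-! ### Parametrisation of a polygonal curve with one edge per unit of time -/

section PiecewiseLinear

/-- The piecewise linear curve through the points `z m`, at time `m`. -/
noncomputable def pl (z : ℤ → ℂ) (t : ℝ) : ℂ := z ⌊t⌋ + (t - ⌊t⌋) * (z (⌊t⌋ + 1) - z ⌊t⌋)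

theorem pl_add (z : ℤ → ℂ) (m : ℤ) {x : ℝ} (hx : x ∈ Icc (0 : ℝ) 1) :
    pl z (m + x) = z m + x * (z (m + 1) - z m) := by
  rcases hx.2.eq_or_lt with rfl | h
  · have : ⌊(m : ℝ) + 1⌋ = m + 1 := by
      rw [Int.floor_add_one, Int.floor_intCast]
    simp [pl]
  · have : ⌊(m : ℝ) + x⌋ = m := by
      rw [Int.floor_intCast_add, Int.floor_eq_zero_iff.2 ⟨hx.1, h⟩, add_zero]
    rw [pl, this]
    push_cast
    ring

theorem pl_intCast (z : ℤ → ℂ) (m : ℤ) : pl z m = z m := by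
  simpa using pl_add z m (x := 0) ⟨le_rfl, zero_le_one⟩

theorem continuous_pl (z : ℤ → ℂ) : Continuous (pl z) := by
  have hlf : LocallyFinite fun m : ℤ => Icc (m : ℝ) (m + 1) := by
    intro t
    refine ⟨Ioo (t - 1) (t + 1), Ioo_mem_nhds (by linarith) (by linarith),
      (finite_Icc (⌊t⌋ - 2) (⌊t⌋ + 2)).subset ?_⟩
    rintro m ⟨s, hs, hs'⟩
    have h1 := Int.floor_le t
    have h2 := Int.lt_floor_add_one t
    constructor
    · have : ((⌊t⌋ - 3 : ℤ) : ℝ) < m := by push_cast; linarith [hs.1, hs.2, hs'.1, hs'.2]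
      have : ⌊t⌋ - 3 < m := by exact_mod_cast this
      omega
    · have : (m : ℝ) < ((⌊t⌋ + 3 : ℤ) : ℝ) := by push_cast; linarith [hs.1, hs.2, hs'.1, hs'.2]
      have : m < ⌊t⌋ + 3 := by exact_mod_cast this
      omega
  refine hlf.continuous (iUnion_eq_univ_iff.2 fun t => ⟨⌊t⌋, Int.floor_le t,
    (Int.lt_floor_add_one t).le⟩) (fun m => isClosed_Icc) fun m => ?_
  have : ContinuousOn (fun t : ℝ => z m + ((t - m : ℝ) : ℂ) * (z (m + 1) - z m))
    (Icc (m : ℝ) (m + 1)) := by fun_prop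
  refine this.congr fun t ht => ?_
  have := pl_add z m (x := t - m) ⟨by linarith [ht.1], by linarith [ht.2]⟩
  rwa [add_sub_cancel] at this

theorem exists_eq_add (t : ℝ) : ∃ m : ℤ, ∃ x ∈ Ico (0 : ℝ) 1, t = m + x :=
  ⟨⌊t⌋, Int.fract t, ⟨Int.fract_nonneg t, Int.fract_lt_one t⟩, (Int.floor_add_fract t).symm⟩

theorem pl_add_period {z : ℤ → ℂ} {n : ℕ} (hz : ∀ m, z (m + n) = z m) (t : ℝ) :
    pl z (t + n) = pl z t := by
  obtain ⟨m, x, hx, rfl⟩ := exists_eq_add t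
  rw [show (m : ℝ) + x + n = ((m + n : ℤ) : ℝ) + x by push_cast; ring,
    pl_add z _ ⟨hx.1, hx.2.le⟩, pl_add z _ ⟨hx.1, hx.2.le⟩, hz, add_right_comm, hz]

end PiecewiseLinear

/-! ### Turning number of a rectilinear closed curve, by Hopf's secant argument -/

section Turning

/-- The points of the plane that are lexicographically positive. -/
def LexPos (u : ℂ) : Prop := 0 < u.re ∨ (u.re = 0 ∧ 0 < u.im)

theorem LexPos.mem_slitPlane {u : ℂ} (h : LexPos u) : u ∈ Complex.slitPlane := by
  rcases h with h | h
  · exact Or.inl h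
  · exact Or.inr h.2.ne'

/-- The lexicographically positive points form a convex cone inside the slit plane. The
lexicographic order is needed because an extreme edge may have several vertices with the least real
part. -/
theorem LexPos.add_mul {u v : ℂ} (hu : LexPos u) (hv : LexPos v) {x : ℝ} (hx : x ∈ Ico (0 : ℝ) 1) :
    LexPos (u + x * (v - u)) := by
  obtain ⟨h0, h1⟩ := hx
  have e1 : (u + x * (v - u)).re = (1 - x) * u.re + x * v.re := by
    simp; ring
  have e2 : (u + x * (v - u)).im = (1 - x) * u.im + x * v.im := by
    simp; ring
  unfold LexPos
  rw [e1, e2]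
  have hx1 : 0 < 1 - x := by linarith
  rcases hu with hu | ⟨hu, hu'⟩
  · left
    have : 0 ≤ v.re := by
      rcases hv with h | h
      · exact h.le
      · exact h.1.ge
    positivity
  · rw [hu]
    rcases h0.eq_or_lt with rfl | h0
    · right; simpa using hu'
    rcases hv with hv | ⟨hv, hv'⟩
    · left; simp only [mul_zero, zero_add]; positivity
    · right; rw [hv]; constructor
      · ring
      · positivity

theorem mem_slitPlane_turn {r τ x : ℝ} (hr : 0 < r) (hτ : τ = 1 ∨ τ = -1)
    (hx : x ∈ Icc (0 : ℝ) 1) : ((1 - x : ℝ) + (x * r * τ : ℝ) * Complex.I) ∈ Complex.slitPlane := by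
  rw [Complex.mem_slitPlane_iff]
  simp only [Complex.add_re, Complex.ofReal_re, Complex.mul_re, Complex.I_re, Complex.ofReal_im,
    Complex.I_im, Complex.add_im, Complex.mul_im]
  rcases hx.2.eq_or_lt with rfl | h
  · right
    rcases hτ with rfl | rfl <;> simp [hr.ne']
  · left; simp; linarith

theorem arg_turn {r τ : ℝ} (hr : 0 < r) (hτ : τ = 1 ∨ τ = -1) :
    Complex.arg ((r * τ : ℝ) * Complex.I) = τ * (Real.pi / 2) := by
  rcases hτ with rfl | rfl
  · rw [mul_one, Complex.arg_real_mul _ hr, Complex.arg_I, one_mul]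
  · rw [show ((r * -1 : ℝ) : ℂ) * Complex.I = (r : ℂ) * -Complex.I by push_cast; ring,
      Complex.arg_real_mul _ hr, Complex.arg_neg_I]
    ring

/-- The rotation of a segment that moves linearly from one edge to the next, perpendicular one. -/
theorem im_sub_im_of_turn {Θ : ℝ → ℂ} (hΘ : Continuous Θ) {u v : ℂ} {r τ : ℝ} (hu : u ≠ 0)
    (hr : 0 < r) (hτ : τ = 1 ∨ τ = -1) (hv : v = (r * τ : ℝ) * Complex.I * u)
    (h : ∀ x ∈ Icc (0 : ℝ) 1, Complex.exp (Θ x) = (1 - x) * u + x * v) :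
    (Θ 1).im - (Θ 0).im = τ * (Real.pi / 2) := by
  have hq : ∀ x ∈ Icc (0 : ℝ) 1, Complex.exp (Θ x) / u =
      (1 - x : ℝ) + (x * r * τ : ℝ) * Complex.I := by
    intro x hx
    rw [h x hx, hv]
    push_cast
    field_simp
  rw [im_sub_im_eq_arg_sub_arg hΘ zero_le_one hu fun x hx => by
    rw [hq x hx]; exact mem_slitPlane_turn hr hτ hx, hq 1 ⟨zero_le_one, le_rfl⟩,
    hq 0 ⟨le_rfl, zero_le_one⟩]
  have := arg_turn hr hτ
  push_cast at this ⊢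
  simp [this]

/-- The turning number of a simple closed curve with perpendicular consecutive edges. -/
theorem sum_turn_eq {z d : ℤ → ℂ} {l τ : ℤ → ℝ} {n : ℕ} (hn : 2 ≤ n)
    (hz : ∀ m, z (m + n) = z m) (hl : ∀ m, 0 < l m) (he : ∀ m, z (m + 1) - z m = l m * d m)
    (hτ : ∀ m, τ m = 1 ∨ τ m = -1) (hτn : ∀ m, τ (m + n) = τ m)
    (hd : ∀ m, d m = 1 ∨ d m = -1 ∨ d m = Complex.I ∨ d m = -Complex.I)
    (hdτ : ∀ m, d (m + 1) = τ (m + 1) * Complex.I * d m)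
    (hinj : ∀ s δ : ℝ, 1 ≤ δ → δ ≤ n - 1 → pl z (s + δ) ≠ pl z s)
    (hlex : ∀ m : ℤ, 0 < m → m < n → LexPos (z m - z 0)) :
    ∑ m ∈ Finset.range n, τ (m + 1) = 4 * τ 0 := by
  have hn' : (2 : ℝ) ≤ n := by exact_mod_cast hn
  have hd0 : ∀ m, d m ≠ 0 := by
    intro m
    rcases hd m with h | h | h | h <;> simp [h]
  have he0 : ∀ m, z (m + 1) - z m ≠ 0 := by
    intro m
    rw [he]
    exact mul_ne_zero (by exact_mod_cast (hl m).ne') (hd0 m)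
  have heτ : ∀ m, z (m + 1 + 1) - z (m + 1) =
      (l (m + 1) / l m * τ (m + 1) : ℝ) * Complex.I * (z (m + 1) - z m) := by
    intro m
    have : (l m : ℂ) ≠ 0 := by exact_mod_cast (hl m).ne'
    rw [he, he, hdτ]
    push_cast
    field_simp
  -- Clamping extends the secant map from the strip `1 ≤ δ ≤ n - 1` to the simply connected plane
  -- without creating zeros. On the edge `δ = 1` a secant turns from one edge vector to the next, so
  -- the tangent itself is never needed.
  set clamp : ℝ → ℝ := fun δ => max 1 (min δ (n - 1)) with hclamp
  have hcl : ∀ δ : ℝ, 1 ≤ δ → δ ≤ n - 1 → clamp δ = δ := fun δ h1 h2 => by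
    rw [hclamp]; simp only; rw [min_eq_left h2, max_eq_right h1]
  set G : ℝ × ℝ → ℂ := fun q => pl z (q.1 + clamp q.2) - pl z q.1 with hG
  have hpl := continuous_pl z
  have hGc : Continuous G := by fun_prop
  have hG0 : ∀ q, G q ≠ 0 := fun q => sub_ne_zero.2 (hinj _ _ (le_max_left _ _)
    (max_le (by linarith) (min_le_right _ _)))
  obtain ⟨Θ, hΘ, hΘG⟩ := exists_continuous_exp_eq hGc hG0
  have hval : ∀ s δ : ℝ, 1 ≤ δ → δ ≤ n - 1 →
      Complex.exp (Θ (s, δ)) = pl z (s + δ) - pl z s := fun s δ h1 h2 => by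
    rw [hΘG, hG]; simp only; rw [hcl δ h1 h2]
  have hedge : ∀ m : ℤ, (Θ ((m + 1 : ℤ), 1)).im - (Θ (m, 1)).im = τ (m + 1) * (Real.pi / 2) := by
    intro m
    have := im_sub_im_of_turn (Θ := fun x => Θ (m + x, 1)) (by fun_prop) (he0 m)
      (div_pos (hl (m + 1)) (hl m)) (hτ (m + 1)) (heτ m) (fun x hx => by
        rw [hval _ _ le_rfl (by linarith), pl_add z m hx,
          show (m : ℝ) + x + 1 = ((m + 1 : ℤ) : ℝ) + x by push_cast; ring, pl_add z _ hx]
        ring)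
    push_cast
    simpa using this
  have hsum : ∀ k : ℕ, (Θ ((k : ℝ), 1)).im - (Θ (0, 1)).im =
      (∑ m ∈ Finset.range k, τ (m + 1)) * (Real.pi / 2) := by
    intro k
    induction k with
    | zero => simp
    | succ k ih =>
      rw [Finset.sum_range_succ, add_mul, ← ih, ← hedge k]
      push_cast
      ring
  have hlex' : ∀ t : ℝ, 1 ≤ t → t ≤ n - 1 → LexPos (pl z t - z 0) := by
    intro t h1 h2
    obtain ⟨m, x, hx, rfl⟩ := exists_eq_add t
    rw [pl_add z m ⟨hx.1, hx.2.le⟩]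
    have hm1 : 0 < m := by
      have : (0 : ℝ) < m := by linarith [hx.2]
      exact_mod_cast this
    have hm2 : m < n := by
      have : (m : ℝ) < (n : ℕ) := by linarith [hx.1]
      exact_mod_cast this
    rcases hx.1.eq_or_lt with h0 | h0
    · rw [← h0]; simpa using hlex m hm1 hm2
    · have hm3 : m + 1 < n := by
        have : ((m + 1 : ℤ) : ℝ) < (n : ℕ) := by push_cast; linarith
        exact_mod_cast this
      have := (hlex m hm1 hm2).add_mul (hlex (m + 1) (by omega) hm3) hx
      convert this using 1
      ring
  have hp0 : pl z 0 = z 0 := by simpa using pl_intCast z 0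
  have hp1 : pl z 1 = z 1 := by simpa using pl_intCast z 1
  have hzn : z (-1 + n) = z (-1) := hz (-1)
  have hpn : pl z (n - 1) = z (-1) := by
    have := pl_intCast z (-1 + n)
    rw [hzn] at this
    rw [← this]
    congr 1
    push_cast
    ring
  -- The total turning along `δ = 1` is computed over the detour (0, 1), (0, n-1), (1, n-1), (n-1,
  -- 1), (n, 1). Its four legs contribute `φ`, a quarter turn at vertex 0, `φ` again with secants
  -- reversed, and another quarter turn at vertex 0.
  set φ : ℝ := (z (-1) - z 0).arg - (z 1 - z 0).arg with hφ
  have h1 : (Θ (0, (n : ℝ) - 1)).im - (Θ (0, 1)).im = φ := by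
    have hv : ∀ t ∈ Icc (1 : ℝ) (n - 1), Complex.exp (Θ (0, t)) / 1 = pl z t - z 0 := by
      intro t ht
      rw [hval _ _ ht.1 ht.2, zero_add, hp0, div_one]
    have := im_sub_im_eq_arg_sub_arg (Θ := fun t => Θ (0, t)) (by fun_prop)
      (a := 1) (b := n - 1) (by linarith) one_ne_zero (fun t ht => by
        rw [hv t ht]; exact (hlex' t ht.1 ht.2).mem_slitPlane)
    rw [this, hv _ ⟨by linarith, le_rfl⟩, hv _ ⟨le_rfl, by linarith⟩, hpn, hp1]
  have h2 : (Θ (1, (n : ℝ) - 1)).im - (Θ (0, (n : ℝ) - 1)).im = τ 0 * (Real.pi / 2) := by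
    have hne := neg_ne_zero.2 (he0 (-1))
    have hturn := heτ (-1)
    simp only [Int.reduceNeg, neg_add_cancel, zero_add] at hne hturn
    refine im_sub_im_of_turn (Θ := fun x => Θ (x, (n : ℝ) - 1)) (by fun_prop) hne
      (div_pos (hl 0) (hl (-1))) (hτ 0) (v := -(z 1 - z 0)) ?_ (fun x hx => ?_)
    · rw [hturn]; ring
    · rw [hval _ _ (by linarith) le_rfl, show x + ((n : ℝ) - 1) = ((-1 : ℤ) + x) + n by
        push_cast; ring, pl_add_period hz, pl_add z _ hx]
      have := pl_add z 0 hx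
      simp only [Int.cast_zero, zero_add] at this
      rw [this]
      simp only [Int.reduceNeg, neg_add_cancel]
      ring
  have h3 : (Θ ((n : ℝ) - 1, 1)).im - (Θ (1, (n : ℝ) - 1)).im = φ := by
    have hv : ∀ t ∈ Icc (1 : ℝ) (n - 1), Complex.exp (Θ (t, n - t)) / (-1) = pl z t - z 0 := by
      intro t ht
      have := pl_add_period hz 0
      rw [zero_add, hp0] at this
      rw [hval _ _ (by linarith [ht.2]) (by linarith [ht.1]), add_sub_cancel, this]
      ring
    have := im_sub_im_eq_arg_sub_arg (Θ := fun t => Θ (t, n - t)) (by fun_prop)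
      (a := 1) (b := n - 1) (by linarith) (neg_ne_zero.2 one_ne_zero) (fun t ht => by
        rw [hv t ht]; exact (hlex' t ht.1 ht.2).mem_slitPlane)
    rw [hv _ ⟨by linarith, le_rfl⟩, hv _ ⟨le_rfl, by linarith⟩, hpn, hp1] at this
    simpa using this
  have h4 : (Θ ((n : ℝ), 1)).im - (Θ ((n : ℝ) - 1, 1)).im = τ 0 * (Real.pi / 2) := by
    have h5 := hedge (-1 + n)
    have h6 := hτn 0
    rw [zero_add] at h6
    rw [show (-1 + n + 1 : ℤ) = n by ring, h6] at h5
    push_cast at h5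
    rw [show (-1 + n : ℝ) = n - 1 by ring] at h5
    exact h5
  -- Minimality of `z 0` leaves only `-1` and `-I` for the incoming direction and, for each, only
  -- one turn; then `φ` can be read off.
  have hφτ : φ = τ 0 * (Real.pi / 2) := by
    have hlex1 : LexPos (z 1 - z 0) := hp1 ▸ hlex' 1 le_rfl (by linarith)
    have hlex2 : LexPos (z (-1) - z 0) := hpn ▸ hlex' (n - 1) (by linarith) le_rfl
    have e1 := he 0
    have e2 := he (-1)
    have e3 := hdτ (-1)
    simp only [Int.reduceNeg, neg_add_cancel, zero_add] at e1 e2 e3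
    have e2' : z (-1) - z 0 = (l (-1) : ℂ) * -d (-1) := by rw [mul_neg, ← e2]; ring
    rw [hφ, e1, e2', Complex.arg_real_mul _ (hl _), Complex.arg_real_mul _ (hl _), e3]
    rw [e1, e3] at hlex1
    rw [e2'] at hlex2
    have l0 := hl 0
    have l1 := hl (-1)
    unfold LexPos at hlex1 hlex2
    rcases hd (-1) with h | h | h | h <;> rw [h] at hlex1 hlex2 ⊢
    · simp at hlex2; linarith
    · rcases hτ 0 with h' | h' <;> rw [h'] at hlex1 ⊢
      · simp at hlex1; linarith
      · simp
    · simp at hlex2; linarith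
    · rcases hτ 0 with h' | h' <;> rw [h'] at hlex1 ⊢
      · simp
      · simp at hlex1; linarith
  have hS := hsum n
  have hpi := Real.pi_pos
  have : (∑ m ∈ Finset.range n, τ (m + 1)) * (Real.pi / 2) = 4 * τ 0 * (Real.pi / 2) := by
    rw [← hS]
    linarith
  exact mul_right_cancel₀ (by positivity) this

end Turning

end PTSS

namespace PTSS

/-! ### Cyclic indexing of the vertices -/

section Index

/-- The vertex that is reached from the vertex `i` in `m` steps along the polygon. -/
def step {n : ℕ} (i : Fin n) (m : ℤ) : Fin n := (finRotate n ^ m) i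

variable {n : ℕ}

theorem step_zero (i : Fin n) : step i 0 = i := rfl

theorem step_add_one (i : Fin n) (m : ℤ) : step i (m + 1) = finRotate n (step i m) := by
  rw [step, step, add_comm, zpow_one_add, Equiv.Perm.mul_apply]

theorem orderOf_finRotate (hn : 2 ≤ n) : orderOf (finRotate n) = n := by
  rw [(isCycle_finRotate_of_le hn).orderOf, support_finRotate_of_le hn, Finset.card_univ,
    Fintype.card_fin]

theorem step_add_period (hn : 2 ≤ n) (i : Fin n) (m : ℤ) : step i (m + n) = step i m := by
  have : finRotate n ^ (n : ℤ) = 1 :=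
    orderOf_dvd_iff_zpow_eq_one.1 (by rw [orderOf_finRotate hn])
  rw [step, zpow_add, this, mul_one, step]

theorem step_eq_step_iff (hn : 2 ≤ n) (i : Fin n) {a b : ℤ} :
    step i a = step i b ↔ (n : ℤ) ∣ b - a := by
  have hcast : ((n : ℤ) ∣ b - a) ↔ finRotate n ^ (b - a) = 1 := by
    rw [← orderOf_dvd_iff_zpow_eq_one, orderOf_finRotate hn]
  have hab : step i b = (finRotate n ^ a) ((finRotate n ^ (b - a)) i) := by
    rw [← Equiv.Perm.mul_apply, ← zpow_add, add_sub_cancel, step]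
  rw [hab, step, (finRotate n ^ a).injective.eq_iff, hcast]
  constructor
  · intro h
    have h0 : 0 ≤ (b - a) % (n : ℤ) := Int.emod_nonneg _ (by omega)
    obtain ⟨k, hk⟩ := Int.eq_ofNat_of_zero_le h0
    have h1 : finRotate n ^ (b - a) = finRotate n ^ k := by
      rw [← zpow_mod_orderOf, orderOf_finRotate hn, hk, zpow_natCast]
    rw [h1] at h ⊢
    exact ((isCycle_finRotate_of_le hn).pow_eq_one_iff' (finRotate_ne_self hn i)).2 h.symm
  · intro h
    rw [h, Equiv.Perm.one_apply]

theorem injOn_step (hn : 2 ≤ n) (i : Fin n) (c : ℤ) :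
    InjOn (fun m : ℕ => step i (m + c)) (Finset.range n : Set ℕ) := by
  intro a ha b hb hab
  rw [Finset.coe_range, mem_Iio] at ha hb
  obtain ⟨k, hk⟩ := (step_eq_step_iff hn i).1 hab
  have hk1 : k < 1 := by
    by_contra! h
    nlinarith
  have hk2 : -1 < k := by
    by_contra! h
    nlinarith
  have : k = 0 := by omega
  subst this
  omega

theorem image_step (hn : 2 ≤ n) (i : Fin n) (c : ℤ) :
    (Finset.range n).image (fun m : ℕ => step i (m + c)) = Finset.univ := by
  refine Finset.eq_univ_of_card _ ?_
  rw [Finset.card_image_of_injOn (injOn_step hn i c), Finset.card_range, Fintype.card_fin]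

theorem exists_step_eq (hn : 2 ≤ n) (i j : Fin n) : ∃ m : ℕ, m < n ∧ step i m = j := by
  have : j ∈ (Finset.range n).image (fun m : ℕ => step i (m + 0)) := by
    rw [image_step hn]; exact Finset.mem_univ _
  obtain ⟨m, hm, h⟩ := Finset.mem_image.1 this
  exact ⟨m, Finset.mem_range.1 hm, by simpa using h⟩

theorem sum_step (hn : 2 ≤ n) (i : Fin n) (c : ℤ) (f : Fin n → ℝ) :
    ∑ m ∈ Finset.range n, f (step i (m + c)) = ∑ j, f j := by
  rw [← image_step hn i c, Finset.sum_image (injOn_step hn i c)]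

variable {Q : Polygon ℂ n}

theorem mem_edgeSet_step (i : Fin n) (m : ℤ) {x : ℝ} (hx : x ∈ Icc (0 : ℝ) 1) :
    Q (step i m) + x * (Q (step i (m + 1)) - Q (step i m)) ∈ Q.edgeSet ℝ (step i m) := by
  rw [edgeSet_eq_segment, segment_eq_image', step_add_one]
  exact ⟨x, hx, by simp only [Complex.real_smul]⟩

/-- The boundary curve of a simple polygon is injective. -/
theorem IsSimple.pl_ne (hQ : IsSimple Q) (hn : 3 ≤ n) (i : Fin n) {u : ℂ} (hu : u ≠ 0) {s δ : ℝ}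
    (h1 : 1 ≤ δ) (h2 : δ ≤ n - 1) :
    pl (fun m => Q (step i m) / u) (s + δ) ≠ pl (fun m => Q (step i m) / u) s := by
  obtain ⟨a, x, hx, rfl⟩ := exists_eq_add s
  obtain ⟨b, y, hy, hb⟩ := exists_eq_add (a + x + δ)
  rw [hb, pl_add _ _ ⟨hx.1, hx.2.le⟩, pl_add _ _ ⟨hy.1, hy.2.le⟩]
  intro heq
  have heq' : Q (step i b) + y * (Q (step i (b + 1)) - Q (step i b)) =
      Q (step i a) + x * (Q (step i (a + 1)) - Q (step i a)) := by
    field_simp at heq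
    exact heq
  have hmb := mem_edgeSet_step (Q := Q) i b ⟨hy.1, hy.2.le⟩
  have hma := mem_edgeSet_step (Q := Q) i a ⟨hx.1, hx.2.le⟩
  rw [heq'] at hmb
  have hab1 : 0 < b - a := by
    have : (0 : ℝ) < ((b - a : ℤ) : ℝ) := by push_cast; linarith [hx.1, hy.2]
    exact_mod_cast this
  have hab2 : b - a < n := by
    have : ((b - a : ℤ) : ℝ) < ((n : ℤ) : ℝ) := by push_cast; linarith [hx.2, hy.1]
    exact_mod_cast this
  have hne : step i a ≠ step i b := fun h => by
    have := Int.le_of_dvd hab1 ((step_eq_step_iff (by omega) i).1 h)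
    omega
  have hend : ∀ c : ℤ, ∀ t : ℝ, t < 1 →
      Q (step i c) + t * (Q (step i (c + 1)) - Q (step i c)) ≠ Q (step i (c + 1)) := by
    intro c t ht h
    have h3 : Q (step i (c + 1)) - Q (step i c) ≠ 0 := by
      rw [step_add_one]; exact sub_ne_zero.2 (hQ.ne_next (by omega) _)
    have h4 : ((1 - t : ℝ) : ℂ) * (Q (step i (c + 1)) - Q (step i c)) = 0 := by
      push_cast; linear_combination -h
    rcases mul_eq_zero.1 h4 with h5 | h5
    · have : 1 - t = 0 := by exact_mod_cast h5
      linarith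
    · exact h3 h5
  -- The edges are distinct, so a common point is the end of one and the start of the other. The
  -- fractional parts are less than 1, so neither parameter reaches the end of its edge.
  rcases hQ.eq_of_mem_of_mem hne hma hmb with ⟨h, h'⟩ | ⟨h, h'⟩
  · rw [h, ← step_add_one] at h'
    exact hend a x hx.2 h'
  · refine hend b y hy.2 (heq'.trans (h'.trans ?_))
    rw [h, ← step_add_one]

end Index

/-! ### Edge directions and turns of an orthogonal polygon -/

section Orthogonal

variable {n : ℕ} {Q : Polygon ℂ n}

/-- The length of an edge. -/
noncomputable def edgeLength (Q : Polygon ℂ n) (i : Fin n) : ℝ := ‖Q (finRotate n i) - Q i‖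

/-- The direction of an edge. -/
noncomputable def edgeDir (Q : Polygon ℂ n) (i : Fin n) : ℂ :=
  (Q (finRotate n i) - Q i) / edgeLength Q i

theorem IsSimple.edgeLength_pos (hQ : IsSimple Q) (hn : 2 ≤ n) (i : Fin n) :
    0 < edgeLength Q i := norm_pos_iff.2 (sub_ne_zero.2 (hQ.ne_next hn i))

theorem IsSimple.next_sub (hQ : IsSimple Q) (hn : 2 ≤ n) (i : Fin n) :
    Q (finRotate n i) - Q i = edgeLength Q i * edgeDir Q i := by
  have : (edgeLength Q i : ℂ) ≠ 0 := by exact_mod_cast (hQ.edgeLength_pos hn i).ne'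
  rw [edgeDir]
  field_simp

theorem IsSimple.norm_edgeDir (hQ : IsSimple Q) (hn : 2 ≤ n) (i : Fin n) : ‖edgeDir Q i‖ = 1 := by
  rw [edgeDir, norm_div, Complex.norm_real, Real.norm_eq_abs,
    abs_of_pos (hQ.edgeLength_pos hn i)]
  exact div_self (hQ.edgeLength_pos hn i).ne'

theorem IsSimple.edgeDir_ne_zero (hQ : IsSimple Q) (hn : 2 ≤ n) (i : Fin n) : edgeDir Q i ≠ 0 :=
  norm_ne_zero_iff.1 (by rw [hQ.norm_edgeDir hn]; exact one_ne_zero)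

theorem eq_turn_of_inner_eq_zero {u v : ℂ} (hu : ‖u‖ = 1) (hv : ‖v‖ = 1)
    (h : inner ℝ u v = 0) : ∃ t : ℝ, (t = 1 ∨ t = -1) ∧ v = t * Complex.I * u := by
  rw [Complex.inner] at h
  have h1 : v * (starRingEnd ℂ) u = ((v * (starRingEnd ℂ) u).im : ℝ) * Complex.I := by
    apply Complex.ext <;> simp [h]
  have h2 : u * (starRingEnd ℂ) u = 1 := by
    rw [Complex.mul_conj, Complex.normSq_eq_norm_sq, hu]; simp
  refine ⟨(v * (starRingEnd ℂ) u).im, ?_, ?_⟩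
  · have := congrArg norm h1
    rw [norm_mul, RCLike.norm_conj, hu, hv, norm_mul, Complex.norm_I, Complex.norm_real,
      Real.norm_eq_abs] at this
    have h3 : |(v * (starRingEnd ℂ) u).im| = 1 := by linarith
    exact eq_or_eq_neg_of_abs_eq h3
  · rw [← h1]
    linear_combination -v * h2

theorem IsSimple.exists_turn (hQ : IsSimple Q) (hn : 2 ≤ n) (hO : IsOrthogonal Q) :
    ∃ τ : Fin n → ℝ, (∀ i, τ i = 1 ∨ τ i = -1) ∧
      ∀ i, edgeDir Q (finRotate n i) = τ (finRotate n i) * Complex.I * edgeDir Q i := by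
  have h : ∀ i, ∃ t : ℝ, (t = 1 ∨ t = -1) ∧
      edgeDir Q (finRotate n i) = t * Complex.I * edgeDir Q i := by
    intro i
    refine eq_turn_of_inner_eq_zero (hQ.norm_edgeDir hn _) (hQ.norm_edgeDir hn _) ?_
    have := hO i
    rw [hQ.next_sub hn, hQ.next_sub hn, ← Complex.real_smul, ← Complex.real_smul,
      real_inner_smul_left, real_inner_smul_right] at this
    have h1 := (hQ.edgeLength_pos hn i).ne'
    have h2 := (hQ.edgeLength_pos hn (finRotate n i)).ne'
    exact (mul_eq_zero.1 ((mul_eq_zero.1 this).resolve_left h1)).resolve_left h2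
  choose t ht ht' using h
  -- The turn is attached to the vertex where it happens, that is, to the start of the outgoing
  -- edge.
  refine ⟨fun i => t ((finRotate n).symm i), fun i => ht _, fun i => ?_⟩
  simp only [Equiv.symm_apply_apply]
  exact ht' i

theorem mul_I_mem_axes {t : ℝ} (ht : t = 1 ∨ t = -1) {d : ℂ}
    (hd : d = 1 ∨ d = -1 ∨ d = Complex.I ∨ d = -Complex.I) :
    t * Complex.I * d = 1 ∨ t * Complex.I * d = -1 ∨ t * Complex.I * d = Complex.I ∨
      t * Complex.I * d = -Complex.I := by
  rcases ht with rfl | rfl <;> rcases hd with rfl | rfl | rfl | rfl <;> simp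

theorem IsSimple.edgeDir_div_mem (hQ : IsSimple Q) (hn : 2 ≤ n) {τ : Fin n → ℝ}
    (hτ : ∀ i, τ i = 1 ∨ τ i = -1)
    (hturn : ∀ i, edgeDir Q (finRotate n i) = τ (finRotate n i) * Complex.I * edgeDir Q i)
    (i₀ i : Fin n) : edgeDir Q i / edgeDir Q i₀ = 1 ∨ edgeDir Q i / edgeDir Q i₀ = -1 ∨
      edgeDir Q i / edgeDir Q i₀ = Complex.I ∨ edgeDir Q i / edgeDir Q i₀ = -Complex.I := by
  obtain ⟨m, -, rfl⟩ := exists_step_eq hn i₀ i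
  induction m with
  | zero =>
    left
    rw [Nat.cast_zero, step_zero, div_self (hQ.edgeDir_ne_zero hn _)]
  | succ m ih =>
    rw [Nat.cast_succ, step_add_one, hturn, mul_div_assoc]
    exact mul_I_mem_axes (hτ _) ih

/-- A vertex of an orthogonal polygon that is lexicographically minimal with respect to the
coordinate axes along the polygon, and the turning number of the polygon. -/
theorem IsSimple.exists_lexMin (hQ : IsSimple Q) (hn : 3 ≤ n) {τ : Fin n → ℝ}
    (hτ : ∀ i, τ i = 1 ∨ τ i = -1)
    (hturn : ∀ i, edgeDir Q (finRotate n i) = τ (finRotate n i) * Complex.I * edgeDir Q i)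
    {u : ℂ} (hu : u ≠ 0) (hd : ∀ i, edgeDir Q i / u = 1 ∨ edgeDir Q i / u = -1 ∨
      edgeDir Q i / u = Complex.I ∨ edgeDir Q i / u = -Complex.I) :
    ∃ i, (∀ j, j ≠ i → LexPos (Q j / u - Q i / u)) ∧ ∑ j, τ j = 4 * τ i := by
  have : Nonempty (Fin n) := ⟨⟨0, by omega⟩⟩
  have hn2 : 2 ≤ n := by omega
  -- Division by `u` makes the edges parallel to the coordinate axes, in which the lexicographic
  -- minimum is taken.
  obtain ⟨i, hi⟩ := Finite.exists_min fun i : Fin n => toLex ((Q i / u).re, (Q i / u).im)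
  have hlex : ∀ j, j ≠ i → LexPos (Q j / u - Q i / u) := by
    intro j hj
    have hne : Q j / u ≠ Q i / u := fun h => hj (hQ.injective (by
      field_simp at h; exact h))
    have h1 := Prod.Lex.toLex_le_toLex.1 (hi j)
    simp only at h1
    unfold LexPos
    rw [Complex.sub_re, Complex.sub_im]
    rcases h1 with h1 | ⟨h1, h2⟩
    · left; linarith
    · right
      refine ⟨by linarith, ?_⟩
      rcases h2.eq_or_lt with h3 | h3
      · exact absurd (Complex.ext h1.symm h3.symm) hne
      · linarith
  refine ⟨i, hlex, ?_⟩
  have hS := sum_turn_eq (z := fun m => Q (step i m) / u) (d := fun m => edgeDir Q (step i m) / u)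
    (l := fun m => edgeLength Q (step i m)) (τ := fun m => τ (step i m)) hn2
    (fun m => by simp only [step_add_period hn2]) (fun m => hQ.edgeLength_pos hn2 _)
    (fun m => by
      simp only [step_add_one]
      rw [← sub_div, hQ.next_sub hn2, mul_div_assoc])
    (fun m => hτ _) (fun m => by simp only [step_add_period hn2]) (fun m => hd _)
    (fun m => by
      simp only [step_add_one]
      rw [hturn, mul_div_assoc])
    (fun s δ h1 h2 => hQ.pl_ne hn i hu h1 h2)
    (fun m h1 h2 => hlex _ fun h => by
      have h3 := (step_eq_step_iff hn2 i (a := 0) (b := m)).1 (by rw [step_zero, h])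
      have := Int.le_of_dvd (by omega) h3
      omega)
  simp only [step_zero] at hS
  rw [← hS, sum_step hn2 i 1 τ]

end Orthogonal

end PTSS

namespace PTSS

/-! ### The environment lies on a constant side of the boundary -/

section Offset

variable {n : ℕ} {Q : Polygon ℂ n}

theorem IsSimple.exists_eq_of_mem_edgeSet (hQ : IsSimple Q) (hn : 2 ≤ n) {i : Fin n} {x : ℂ}
    (hx : x ∈ Q.edgeSet ℝ i) :
    ∃ c ∈ Icc 0 (edgeLength Q i), x = Q i + c * edgeDir Q i := by
  rw [edgeSet_eq_segment, segment_eq_image'] at hx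
  obtain ⟨r, hr, rfl⟩ := hx
  have hl := (hQ.edgeLength_pos hn i).le
  refine ⟨r * edgeLength Q i, ⟨mul_nonneg hr.1 hl, mul_le_of_le_one_left hl hr.2⟩, ?_⟩
  simp only [Complex.real_smul]
  rw [hQ.next_sub hn]
  push_cast
  ring

theorem IsSimple.mem_edgeSet_of_eq (hQ : IsSimple Q) (hn : 2 ≤ n) {i : Fin n} {c : ℝ}
    (hc : c ∈ Icc 0 (edgeLength Q i)) : Q i + c * edgeDir Q i ∈ Q.edgeSet ℝ i := by
  have hl := hQ.edgeLength_pos hn i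
  rw [edgeSet_eq_segment, segment_eq_image']
  refine ⟨c / edgeLength Q i, ⟨div_nonneg hc.1 hl.le, (div_le_one hl).2 hc.2⟩, ?_⟩
  have : (edgeLength Q i : ℂ) ≠ 0 := by exact_mod_cast hl.ne'
  simp only [Complex.real_smul]
  rw [hQ.next_sub hn]
  push_cast
  field_simp

theorem IsSimple.next_eq (hQ : IsSimple Q) (hn : 2 ≤ n) (i : Fin n) :
    Q (finRotate n i) = Q i + edgeLength Q i * edgeDir Q i := by
  rw [← hQ.next_sub hn]; ring

/-- A length that is small with respect to the geometry of the polygon. -/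
structure IsSmall (Q : Polygon ℂ n) (ε : ℝ) : Prop where
  pos : 0 < ε
  near_vertex : ∀ i, ∀ x ∈ Metric.ball (Q i) (4 * ε), x ∈ Q.boundary ℝ →
    ∃ j, x ∈ Q.edgeSet ℝ j ∧ Q i ∈ Q.edgeSet ℝ j
  le_dist : ∀ i j, Disjoint (Q.edgeSet ℝ i) (Q.edgeSet ℝ j) →
    ∀ x ∈ Q.edgeSet ℝ i, ∀ y ∈ Q.edgeSet ℝ j, 2 * ε ≤ dist x y
  lt_edgeLength : ∀ i, 4 * ε < edgeLength Q i

theorem IsSimple.exists_isSmall (hQ : IsSimple Q) (hn : 2 ≤ n) : ∃ ε, IsSmall Q ε := by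
  have hlt : ∀ δ > (0 : ℝ), ∀ᶠ ε in 𝓝[>] (0 : ℝ), 4 * ε < δ := fun δ hδ => by
    filter_upwards [Ioo_mem_nhdsGT (show (0 : ℝ) < δ / 4 by linarith)] with ε hε
    linarith [hε.2]
  have h1 : ∀ᶠ ε in 𝓝[>] (0 : ℝ), ∀ i, ∀ x ∈ Metric.ball (Q i) (4 * ε), x ∈ Q.boundary ℝ →
      ∃ j, x ∈ Q.edgeSet ℝ j ∧ Q i ∈ Q.edgeSet ℝ j := by
    refine Filter.eventually_all.2 fun i => ?_
    obtain ⟨δ, hδ, h⟩ := exists_ball_inter_boundary (Q := Q) (Q i)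
    filter_upwards [hlt δ hδ] with ε hε x hx
    exact h x (Metric.ball_subset_ball hε.le hx)
  have h2 : ∀ᶠ ε in 𝓝[>] (0 : ℝ), ∀ i j, Disjoint (Q.edgeSet ℝ i) (Q.edgeSet ℝ j) →
      ∀ x ∈ Q.edgeSet ℝ i, ∀ y ∈ Q.edgeSet ℝ j, 2 * ε ≤ dist x y := by
    refine Filter.eventually_all.2 fun i => Filter.eventually_all.2 fun j => ?_
    by_cases hd : Disjoint (Q.edgeSet ℝ i) (Q.edgeSet ℝ j)
    · obtain ⟨δ, hδ, h⟩ := hd.exists_thickenings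
        (by rw [edgeSet_eq_segment]; exact isCompact_segment _ _) (isClosed_edgeSet Q j)
      filter_upwards [hlt δ hδ, self_mem_nhdsWithin] with ε hε hε0 _ x hx y hy
      have hε0 : (0 : ℝ) < ε := hε0
      by_contra! hcon
      refine disjoint_left.1 h (Metric.mem_thickening_iff.2 ⟨x, hx, ?_⟩)
        (Metric.self_subset_thickening hδ _ hy)
      rw [dist_comm]
      linarith
    · exact Filter.Eventually.of_forall fun _ h => absurd h hd
  have h3 : ∀ᶠ ε in 𝓝[>] (0 : ℝ), ∀ i, 4 * ε < edgeLength Q i :=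
    Filter.eventually_all.2 fun i => hlt _ (hQ.edgeLength_pos hn i)
  obtain ⟨ε, ⟨⟨h1, h2⟩, h3⟩, h0⟩ := (((h1.and h2).and h3).and self_mem_nhdsWithin).exists
  exact ⟨ε, h0, h1, h2, h3⟩

variable {τ : Fin n → ℝ} {ε : ℝ}

theorem mul_self_eq_one_of_eq {t : ℝ} (h : t = 1 ∨ t = -1) : (t : ℂ) * t = 1 := by
  rcases h with rfl | rfl <;> simp

theorem re_add_mul_I (a b : ℝ) : ((a : ℂ) + b * Complex.I).re = a := by simp

theorem im_add_mul_I (a b : ℝ) : ((a : ℂ) + b * Complex.I).im = b := by simp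

/-- A segment parallel to an edge at a small distance does not meet the boundary. -/
theorem IsSimple.disjoint_offset (hQ : IsSimple Q) (hn : 2 ≤ n)
    (hτ : ∀ i, τ i = 1 ∨ τ i = -1)
    (hturn : ∀ i, edgeDir Q (finRotate n i) = τ (finRotate n i) * Complex.I * edgeDir Q i)
    (hε : IsSmall Q ε) {s : ℝ} (hs : s = 1 ∨ s = -1) (i : Fin n) :
    Disjoint (segment ℝ (Q i + ε * (edgeDir Q i - s * Complex.I * edgeDir Q i))
      (Q (finRotate n i) + ε * (-edgeDir Q i - s * Complex.I * edgeDir Q i)))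
      (Q.boundary ℝ) := by
  refine disjoint_left.2 fun x hx hxb => ?_
  have hε0 := hε.pos
  set D := edgeDir Q i with hD
  have hD0 : D ≠ 0 := hQ.edgeDir_ne_zero hn i
  have hl := hε.lt_edgeLength i
  obtain ⟨c, hc1, hc2, rfl⟩ : ∃ c : ℝ, ε ≤ c ∧ c ≤ edgeLength Q i - ε ∧
      x = Q i + c * D - ε * s * Complex.I * D := by
    rw [segment_eq_image'] at hx
    obtain ⟨r, hr, rfl⟩ := hx
    refine ⟨ε + r * (edgeLength Q i - 2 * ε), ?_, ?_, ?_⟩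
    · have := mul_nonneg hr.1 (show 0 ≤ edgeLength Q i - 2 * ε by linarith)
      linarith
    · have := mul_le_of_le_one_left (show 0 ≤ edgeLength Q i - 2 * ε by linarith) hr.2
      linarith
    · simp only [Complex.real_smul]
      rw [hQ.next_eq hn]
      push_cast
      ring
  have key : ∀ a b : ℝ, (c : ℂ) * D - ε * s * Complex.I * D = (a + b * Complex.I) * D →
      c = a ∧ -(ε * s) = b := by
    intro a b h
    have h1 : ((c : ℝ) : ℂ) + (-(ε * s) : ℝ) * Complex.I = a + b * Complex.I :=
      mul_right_cancel₀ hD0 (by push_cast; linear_combination h)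
    exact ⟨by simpa using congrArg Complex.re h1, by simpa using congrArg Complex.im h1⟩
  obtain ⟨j, hj⟩ := mem_iUnion.1 hxb
  by_cases h1 : j = i
  · subst h1
    obtain ⟨c', -, h⟩ := hQ.exists_eq_of_mem_edgeSet hn hj
    have := (key c' 0 (by rw [← hD] at h; push_cast; linear_combination h)).2
    rcases hs with rfl | rfl <;> linarith
  by_cases h2 : j = finRotate n i
  · subst h2
    obtain ⟨c', -, h⟩ := hQ.exists_eq_of_mem_edgeSet hn hj
    rw [hturn, hQ.next_eq hn, ← hD] at h
    have := (key (edgeLength Q i) (c' * τ (finRotate n i))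
      (by push_cast; linear_combination h)).1
    linarith
  by_cases h3 : i = finRotate n j
  · obtain ⟨c', -, h⟩ := hQ.exists_eq_of_mem_edgeSet hn hj
    have h4 := hQ.next_eq hn j
    have h5 := hturn j
    rw [← h3, ← hD] at h5
    rw [← h3] at h4
    have h6 : edgeDir Q j = -(τ i * Complex.I * D) := by
      rw [h5]
      linear_combination (-edgeDir Q j) * mul_self_eq_one_of_eq (hτ i) +
        (edgeDir Q j * τ i * τ i) * Complex.I_mul_I
    rw [h4, h6] at h
    have := (key 0 ((edgeLength Q j - c') * τ i) (by push_cast; linear_combination h)).1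
    linarith
  -- For an edge disjoint from edge `i`: the offset point is only `ε` away from its foot on edge
  -- `i`, but disjoint edges are at least `2 * ε` apart.
  have hy := hQ.mem_edgeSet_of_eq hn (i := i) (c := c) ⟨by linarith, by linarith⟩
  have hle := hε.le_dist i j (hQ.disjoint i j h1 h2 h3) _ hy _ hj
  have hs1 : |s| = 1 := by rcases hs with rfl | rfl <;> simp
  rw [dist_eq_norm, show Q i + (c : ℂ) * edgeDir Q i -
    (Q i + c * D - ε * s * Complex.I * D) = (ε : ℂ) * (s * (Complex.I * D)) by rw [hD]; ring,
    norm_mul, norm_mul, norm_mul, hD, hQ.norm_edgeDir hn, Complex.norm_real, Complex.norm_real,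
    Complex.norm_I, Real.norm_eq_abs, Real.norm_eq_abs, hs1, abs_of_pos hε0] at hle
  linarith

/-- Near a vertex, in coordinates along the incoming edge, the boundary lies on two half-lines. -/
theorem IsSimple.coords_of_mem_boundary (hQ : IsSimple Q) (hn : 2 ≤ n)
    (hτ : ∀ i, τ i = 1 ∨ τ i = -1)
    (hturn : ∀ i, edgeDir Q (finRotate n i) = τ (finRotate n i) * Complex.I * edgeDir Q i)
    (hε : IsSmall Q ε) (j : Fin n) {x : ℂ}
    (hx : x ∈ Metric.ball (Q (finRotate n j)) (4 * ε)) (hxb : x ∈ Q.boundary ℝ) :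
    ((x - Q (finRotate n j)) / edgeDir Q j).re ≤ 0 ∧
      0 ≤ τ (finRotate n j) * ((x - Q (finRotate n j)) / edgeDir Q j).im ∧
      (((x - Q (finRotate n j)) / edgeDir Q j).re = 0 ∨
        ((x - Q (finRotate n j)) / edgeDir Q j).im = 0) := by
  have hD0 : edgeDir Q j ≠ 0 := hQ.edgeDir_ne_zero hn j
  obtain ⟨k, hk, hik⟩ := hε.near_vertex _ x hx hxb
  obtain ⟨c, hc, h⟩ := hQ.exists_eq_of_mem_edgeSet hn hk
  by_cases h1 : finRotate n j = k
  · subst h1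
    have h2 : (x - Q (finRotate n j)) / edgeDir Q j =
        ((0 : ℝ) : ℂ) + (c * τ (finRotate n j) : ℝ) * Complex.I := by
      rw [h, hturn]
      push_cast
      field_simp
      ring
    rw [h2, re_add_mul_I, im_add_mul_I]
    refine ⟨le_rfl, ?_, Or.inl rfl⟩
    have h3 : τ (finRotate n j) * τ (finRotate n j) = 1 := by
      rcases hτ (finRotate n j) with h | h <;> rw [h] <;> norm_num
    have h4 : τ (finRotate n j) * (c * τ (finRotate n j)) =
      c * (τ (finRotate n j) * τ (finRotate n j)) := by ring
    rw [h4, h3, mul_one]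
    exact hc.1
  · rcases hQ.eq_of_mem_of_mem h1 (vertex_mem_edgeSet Q _) hik with ⟨h2, h3⟩ | ⟨h2, h3⟩
    · exact absurd (hQ.injective h3) h1
    · have hjk : j = k := (finRotate n).injective h2
      subst hjk
      have h2 : (x - Q (finRotate n j)) / edgeDir Q j =
          ((c - edgeLength Q j : ℝ) : ℂ) + (0 : ℝ) * Complex.I := by
        rw [h, hQ.next_eq hn]
        push_cast
        field_simp
        ring
      rw [h2, re_add_mul_I, im_add_mul_I]
      exact ⟨by linarith [hc.2], by simp, Or.inr rfl⟩

/-- Near a vertex, the complement of the closed quadrant between the two edges is contained in the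
environment or disjoint from it. -/
theorem IsSimple.mem_environment_iff_of_outer (hQ : IsSimple Q) (hn : 2 ≤ n)
    (hτ : ∀ i, τ i = 1 ∨ τ i = -1)
    (hturn : ∀ i, edgeDir Q (finRotate n i) = τ (finRotate n i) * Complex.I * edgeDir Q i)
    (hε : IsSmall Q ε) (j : Fin n) {x : ℂ}
    (hx : x ∈ Metric.ball (Q (finRotate n j)) (4 * ε))
    (h : 0 < ((x - Q (finRotate n j)) / edgeDir Q j).re ∨
      τ (finRotate n j) * ((x - Q (finRotate n j)) / edgeDir Q j).im < 0) :
    x ∈ environment Q ↔ Q (finRotate n j) +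
      ε * (edgeDir Q j - τ (finRotate n j) * Complex.I * edgeDir Q j) ∈ environment Q := by
  set P := Q (finRotate n j) with hP
  set v := edgeDir Q j with hv
  set t := τ (finRotate n j) with ht
  have ht1 : t = 1 ∨ t = -1 := hτ _
  have hv0 : v ≠ 0 := hQ.edgeDir_ne_zero hn j
  have hε0 := hε.pos
  have hcb : P + ε * (v - t * Complex.I * v) ∈ Metric.ball P (4 * ε) := by
    rw [mem_ball_iff_norm, add_sub_cancel_left, norm_mul, Complex.norm_real, Real.norm_eq_abs,
      abs_of_pos hε0]
    have h1 := norm_sub_le v (t * Complex.I * v)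
    have h2 : |t| = 1 := by rcases ht1 with h | h <;> rw [h] <;> simp
    rw [norm_mul, norm_mul, hv, hQ.norm_edgeDir hn, Complex.norm_real, Real.norm_eq_abs, h2,
      Complex.norm_I] at h1
    rw [← hv] at h1
    nlinarith
  have hcoord : (P + ε * (v - t * Complex.I * v) - P) / v =
      (ε : ℂ) + (-(ε * t) : ℝ) * Complex.I := by
    push_cast
    field_simp
    ring
  have hw1 : ∀ z, (v⁻¹ * (z - P)).re = ((z - P) / v).re := fun z => by
    rw [div_eq_inv_mul]
  have hw2 : ∀ z, (t * Complex.I * v⁻¹ * (z - P)).re = -(t * ((z - P) / v).im) := fun z => by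
    rw [show t * Complex.I * v⁻¹ * (z - P) = (t : ℂ) * (Complex.I * ((z - P) / v)) by
      rw [div_eq_inv_mul]; ring, Complex.re_ofReal_mul, Complex.I_mul_re, mul_neg]
  have htt : t * t = 1 := by rcases ht1 with h | h <;> rw [h] <;> norm_num
  -- The outer region is a union of two half-discs that miss the boundary, and the reference point
  -- lies in both.
  rcases h with h | h
  · refine mem_environment_iff_of_isPreconnected (isPreconnected_halfDisc P v⁻¹ (4 * ε))
      (disjoint_left.2 fun z hz hzb => ?_) ⟨hx, by rw [hw1]; exact h⟩ ⟨hcb, ?_⟩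
    · have := (hQ.coords_of_mem_boundary hn hτ hturn hε j hz.1 hzb).1
      have h1 := hz.2
      rw [hw1] at h1
      linarith
    · rw [hw1, hcoord, re_add_mul_I]
      exact hε0
  · refine mem_environment_iff_of_isPreconnected
      (isPreconnected_halfDisc P (t * Complex.I * v⁻¹) (4 * ε))
      (disjoint_left.2 fun z hz hzb => ?_) ⟨hx, by rw [hw2]; linarith⟩ ⟨hcb, ?_⟩
    · have := (hQ.coords_of_mem_boundary hn hτ hturn hε j hz.1 hzb).2.1
      have h1 := hz.2
      rw [hw2] at h1
      linarith
    · rw [hw2, hcoord, im_add_mul_I]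
      have : -(t * -(ε * t)) = ε * (t * t) := by ring
      rw [this, htt]
      linarith

/-- Near a vertex, the open quadrant between the two edges is contained in the
environment or disjoint from it. -/
theorem IsSimple.mem_environment_iff_of_inner (hQ : IsSimple Q) (hn : 2 ≤ n)
    (hτ : ∀ i, τ i = 1 ∨ τ i = -1)
    (hturn : ∀ i, edgeDir Q (finRotate n i) = τ (finRotate n i) * Complex.I * edgeDir Q i)
    (hε : IsSmall Q ε) (j : Fin n) {x y : ℂ}
    (hx : x ∈ Metric.ball (Q (finRotate n j)) (4 * ε))
    (hx1 : ((x - Q (finRotate n j)) / edgeDir Q j).re < 0)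
    (hx2 : 0 < τ (finRotate n j) * ((x - Q (finRotate n j)) / edgeDir Q j).im)
    (hy : y ∈ Metric.ball (Q (finRotate n j)) (4 * ε))
    (hy1 : ((y - Q (finRotate n j)) / edgeDir Q j).re < 0)
    (hy2 : 0 < τ (finRotate n j) * ((y - Q (finRotate n j)) / edgeDir Q j).im) :
    x ∈ environment Q ↔ y ∈ environment Q := by
  set P := Q (finRotate n j) with hP
  set v := edgeDir Q j with hv
  set t := τ (finRotate n j) with ht
  have hconv : Convex ℝ {z | z ∈ Metric.ball P (4 * ε) ∧ ((z - P) / v).re < 0 ∧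
      0 < t * ((z - P) / v).im} := by
    have h1 : Convex ℝ {z : ℂ | (z / v).re < (P / v).re} :=
      convex_halfSpace_lt (f := fun z : ℂ => (z / v).re)
        ⟨fun x y => by simp [add_div], fun r x => by
          simp only [Complex.real_smul, mul_div_assoc, Complex.re_ofReal_mul, smul_eq_mul]⟩ _
    have h2 : Convex ℝ {z : ℂ | t * (P / v).im < t * (z / v).im} :=
      convex_halfSpace_gt (f := fun z : ℂ => t * (z / v).im)
        ⟨fun x y => by simp [add_div, mul_add], fun r x => by
          simp only [Complex.real_smul, mul_div_assoc, Complex.im_ofReal_mul, smul_eq_mul]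
          ring⟩ _
    have h3 : {z | z ∈ Metric.ball P (4 * ε) ∧ ((z - P) / v).re < 0 ∧
        0 < t * ((z - P) / v).im} = Metric.ball P (4 * ε) ∩
        ({z : ℂ | (z / v).re < (P / v).re} ∩ {z : ℂ | t * (P / v).im < t * (z / v).im}) := by
      ext z
      simp [sub_div, mul_sub]
    rw [h3]
    exact (convex_ball P (4 * ε)).inter (h1.inter h2)
  refine mem_environment_iff_of_isPreconnected hconv.isPreconnected
    (disjoint_left.2 fun z hz hzb => ?_) ⟨hx, hx1, hx2⟩ ⟨hy, hy1, hy2⟩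
  rcases (hQ.coords_of_mem_boundary hn hτ hturn hε j hz.1 hzb).2.2 with h | h
  · exact hz.2.1.ne h
  · have := hz.2.2
    rw [h, mul_zero] at this
    exact lt_irrefl _ this

theorem IsSimple.offset_mem_ball (hQ : IsSimple Q) (hn : 2 ≤ n) (hε : IsSmall Q ε) (i j : Fin n)
    {a b : ℝ} (ha : |a| = 1) (hb : |b| = 1) :
    Q i + ε * ((a + b * Complex.I) * edgeDir Q j) ∈ Metric.ball (Q i) (4 * ε) := by
  have hε0 := hε.pos
  rw [mem_ball_iff_norm, add_sub_cancel_left, norm_mul, norm_mul, hQ.norm_edgeDir hn,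
    Complex.norm_real, Real.norm_eq_abs, abs_of_pos hε0]
  have h1 := norm_add_le (a : ℂ) (b * Complex.I)
  rw [norm_mul, Complex.norm_real, Complex.norm_real, Real.norm_eq_abs, Real.norm_eq_abs, ha, hb,
    Complex.norm_I] at h1
  nlinarith

theorem offset_coords {P v : ℂ} (hv : v ≠ 0) (ε a b : ℝ) :
    (P + ε * ((a + b * Complex.I) * v) - P) / v = (ε * a : ℝ) + (ε * b : ℝ) * Complex.I := by
  push_cast
  field_simp
  ring

/-- The side `s` of the boundary belongs to the environment either near all edges or near none. -/
theorem IsSimple.offset_mem_iff (hQ : IsSimple Q) (hn : 2 ≤ n)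
    (hτ : ∀ i, τ i = 1 ∨ τ i = -1)
    (hturn : ∀ i, edgeDir Q (finRotate n i) = τ (finRotate n i) * Complex.I * edgeDir Q i)
    (hε : IsSmall Q ε) {s : ℝ} (hs : s = 1 ∨ s = -1) (j : Fin n) :
    Q j + ε * (edgeDir Q j - s * Complex.I * edgeDir Q j) ∈ environment Q ↔
      Q (finRotate n j) + ε * (edgeDir Q (finRotate n j) -
        s * Complex.I * edgeDir Q (finRotate n j)) ∈ environment Q := by
  rw [mem_environment_iff_of_segment (hQ.disjoint_offset hn hτ hturn hε hs j)]
  have hε0 := hε.pos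
  have hv0 := hQ.edgeDir_ne_zero hn j
  have hs1 : |s| = 1 := by rcases hs with rfl | rfl <;> simp
  have hss := mul_self_eq_one_of_eq hs
  have hss' : s * s = 1 := by rcases hs with rfl | rfl <;> norm_num
  have hts : τ (finRotate n j) = s ∨ τ (finRotate n j) = -s := by
    rcases hτ (finRotate n j) with h | h <;> rcases hs with rfl | rfl <;> rw [h] <;> norm_num
  -- If the turn is `s`, side `s` is the outer region at the vertex, and both offset points lie in
  -- it. If the turn is `-s`, side `s` is the inner quadrant and the two offset points coincide.
  rcases hts with h | h
  · have e1 : Q (finRotate n j) + ε * (-edgeDir Q j - s * Complex.I * edgeDir Q j) =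
        Q (finRotate n j) + ε * (((-1 : ℝ) + (-s : ℝ) * Complex.I) * edgeDir Q j) := by
      push_cast; ring
    have e2 : Q (finRotate n j) + ε * (edgeDir Q (finRotate n j) -
        s * Complex.I * edgeDir Q (finRotate n j)) =
        Q (finRotate n j) + ε * (((1 : ℝ) + (s : ℝ) * Complex.I) * edgeDir Q j) := by
      rw [hturn, h]
      push_cast
      linear_combination (ε * edgeDir Q j) * hss - (ε * edgeDir Q j * s * s) * Complex.I_mul_I
    rw [e1, e2, hQ.mem_environment_iff_of_outer hn hτ hturn hε j
      (hQ.offset_mem_ball hn hε _ _ (a := -1) (b := -s) (by simp) (by rw [abs_neg]; exact hs1)) (Or.inr ?_),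
      ← hQ.mem_environment_iff_of_outer hn hτ hturn hε j
      (hQ.offset_mem_ball hn hε _ _ (a := 1) (b := s) (by simp) hs1) (Or.inl ?_)]
    · rw [offset_coords hv0, re_add_mul_I]; linarith
    · rw [offset_coords hv0, im_add_mul_I, h]
      have : s * (ε * -s) = -(ε * (s * s)) := by ring
      rw [this, hss']
      linarith
  · have e : Q (finRotate n j) + ε * (-edgeDir Q j - s * Complex.I * edgeDir Q j) =
        Q (finRotate n j) + ε * (edgeDir Q (finRotate n j) -
        s * Complex.I * edgeDir Q (finRotate n j)) := by
      rw [hturn, h]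
      push_cast
      linear_combination (ε * edgeDir Q j) * hss - (ε * edgeDir Q j * s * s) * Complex.I_mul_I
    rw [e]

theorem LexPos.of_mul {l : ℝ} (hl : 0 < l) {x : ℂ} (h : LexPos (l * x)) : LexPos x := by
  unfold LexPos at h ⊢
  rw [Complex.re_ofReal_mul, Complex.im_ofReal_mul] at h
  rcases h with h | ⟨h, h'⟩
  · exact Or.inl (pos_of_mul_pos_right h hl.le)
  · exact Or.inr ⟨(mul_eq_zero.1 h).resolve_left hl.ne', pos_of_mul_pos_right h' hl.le⟩

/-- Structure of an orthogonal polygon near its vertices, in coordinates along the incoming edge.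
At the vertices outside `R` the environment is contained in a quadrant; at the vertices in `R` it
misses a quadrant. -/
theorem IsSimple.exists_quadrants (hQ : IsSimple Q) (hn : 3 ≤ n) (hO : IsOrthogonal Q) :
    ∃ (R : Finset (Fin n)) (u : ℂ), 2 * R.card + 4 = n ∧ u ≠ 0 ∧ ∀ i, ∃ v : ℂ,
      (v / u = 1 ∨ v / u = -1 ∨ v / u = Complex.I ∨ v / u = -Complex.I) ∧
      ∃ t : ℝ, (t = 1 ∨ t = -1) ∧ ∃ δ > 0,
        (i ∉ R → ∀ x ∈ Metric.ball (Q i) δ, x ∈ environment Q →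
          ((x - Q i) / v).re ≤ 0 ∧ 0 ≤ t * ((x - Q i) / v).im) ∧
        (i ∈ R → ∀ x ∈ Metric.ball (Q i) δ, ((x - Q i) / v).re < 0 →
          0 < t * ((x - Q i) / v).im → x ∉ environment Q) := by
  have hn2 : 2 ≤ n := by omega
  obtain ⟨τ, hτ, hturn⟩ := hQ.exists_turn hn2 hO
  obtain ⟨ε, hε⟩ := hQ.exists_isSmall hn2
  have hε0 := hε.pos
  set u := edgeDir Q ⟨0, by omega⟩ with hu
  have hu0 : u ≠ 0 := hQ.edgeDir_ne_zero hn2 _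
  have haxes := hQ.edgeDir_div_mem hn2 hτ hturn ⟨0, by omega⟩
  rw [← hu] at haxes
  obtain ⟨i₀, hlex, hsum⟩ := hQ.exists_lexMin hn hτ hturn hu0 haxes
  set s := τ i₀ with hs
  have hs1 : s = 1 ∨ s = -1 := hτ i₀
  have hsabs : |s| = 1 := by rcases hs1 with h | h <;> rw [h] <;> simp
  have hss : s * s = 1 := by rcases hs1 with h | h <;> rw [h] <;> norm_num
  have hssc := mul_self_eq_one_of_eq hs1
  have hcase : ∀ i, τ i = s ∨ τ i = -s := fun i => by
    rcases hτ i with h | h <;> rcases hs1 with h' | h' <;> rw [h, h'] <;> norm_num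
  -- At the lexicographically least vertex, the outer region contains a point with smaller real part
  -- (in coordinates divided by `u`) than every vertex, so it is outside the environment. Being on a
  -- fixed side of the boundary, this carries over to all vertices.
  have hout₀ : Q i₀ + ε * (edgeDir Q i₀ - s * Complex.I * edgeDir Q i₀) ∉ environment Q := by
    obtain ⟨j, hj⟩ := (finRotate n).surjective i₀
    have hv0 := hQ.edgeDir_ne_zero hn2 j
    have hti := hturn j
    rw [hj, ← hs] at hti
    have e2 : Q i₀ + ε * (edgeDir Q i₀ - s * Complex.I * edgeDir Q i₀) =
        Q i₀ + ε * (((1 : ℝ) + (s : ℝ) * Complex.I) * edgeDir Q j) := by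
      rw [hti]
      push_cast
      linear_combination (ε * edgeDir Q j) * hssc - (ε * edgeDir Q j * s * s) * Complex.I_mul_I
    have h1 := hQ.mem_environment_iff_of_outer hn2 hτ hturn hε j
      (hQ.offset_mem_ball hn2 hε _ j (a := 1) (b := s) (by simp) hsabs) (Or.inl (by
        rw [offset_coords hv0, re_add_mul_I]; linarith))
    rw [hj, ← e2, ← hs] at h1
    rw [h1]
    intro hmem
    have hmin : ∀ k, (u⁻¹ * Q i₀).re ≤ (u⁻¹ * Q k).re := by
      intro k
      by_cases hk : k = i₀
      · rw [hk]
      · have := hlex k hk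
        unfold LexPos at this
        rw [Complex.sub_re] at this
        rw [← div_eq_inv_mul, ← div_eq_inv_mul]
        rcases this with h | h
        · linarith
        · linarith [h.1]
    have h2 := le_of_mem_environment (inv_ne_zero hu0) hmin hmem
    have hji : j ≠ i₀ := by
      rw [← hj]; exact (finRotate_ne_self hn2 j).symm
    have hl1 : LexPos (-(edgeDir Q j / u)) := by
      have h3 := hlex j hji
      have h4 := hQ.next_eq hn2 j
      rw [hj] at h4
      refine LexPos.of_mul (hQ.edgeLength_pos hn2 j) ?_
      convert h3 using 1
      rw [h4]
      field_simp
      ring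
    have hl2 : LexPos (s * Complex.I * (edgeDir Q j / u)) := by
      have h3 := hlex (finRotate n i₀) (finRotate_ne_self hn2 i₀)
      have h4 := hQ.next_eq hn2 i₀
      refine LexPos.of_mul (hQ.edgeLength_pos hn2 i₀) ?_
      convert h3 using 1
      rw [h4, hti]
      field_simp
      ring
    rw [show u⁻¹ * (Q i₀ + ε * (edgeDir Q j - s * Complex.I * edgeDir Q j)) =
      u⁻¹ * Q i₀ + ε * (edgeDir Q j / u - s * Complex.I * (edgeDir Q j / u)) by
        rw [div_eq_inv_mul]; ring, Complex.add_re, Complex.re_ofReal_mul, Complex.sub_re] at h2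
    have h3 : 0 ≤ (edgeDir Q j / u).re - (s * Complex.I * (edgeDir Q j / u)).re :=
      nonneg_of_mul_nonneg_right (by linarith) hε0
    unfold LexPos at hl1 hl2
    rcases haxes j with h | h | h | h <;> rw [h] at h3 hl1 hl2
    · simp at hl1; linarith
    · simp at h3; linarith
    · simp at hl1; linarith
    · simp at h3 hl2
      linarith
  have hout : ∀ i, Q i + ε * (edgeDir Q i - s * Complex.I * edgeDir Q i) ∉ environment Q := by
    intro i
    obtain ⟨m, -, rfl⟩ := exists_step_eq hn2 i₀ i
    clear * - hout₀ hQ hn2 hτ hturn hε hs1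
    induction m with
    | zero => exact hout₀
    | succ m ih =>
      rw [Nat.cast_succ, step_add_one, ← hQ.offset_mem_iff hn2 hτ hturn hε hs1]
      exact ih
  -- `R` collects the turns opposite to the one at the extreme vertex. From the turning number, s(n
  -- - |R|) - s|R| = 4s.
  refine ⟨Finset.univ.filter fun i => τ i = -s, u, ?_, hu0, fun i => ?_⟩
  · have h1 : ∑ i, τ i = ∑ i, (s + if τ i = -s then -(2 * s) else 0) := by
      refine Finset.sum_congr rfl fun i _ => ?_
      split_ifs with h
      · rw [h]; ring
      · rw [(hcase i).resolve_right h, add_zero]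
    rw [Finset.sum_add_distrib, ← Finset.sum_filter, Finset.sum_const, Finset.sum_const,
      hsum, Finset.card_univ, Fintype.card_fin, nsmul_eq_mul, nsmul_eq_mul] at h1
    have h2 : (n : ℝ) * (s * s) - 2 * ((Finset.univ.filter fun i => τ i = -s).card : ℝ) * (s * s) =
        4 * (s * s) := by
      linear_combination -s * h1
    rw [hss] at h2
    have h3 : ((2 * (Finset.univ.filter fun i => τ i = -s).card + 4 : ℕ) : ℝ) = n := by
      push_cast; linarith
    exact_mod_cast h3
  · obtain ⟨j, rfl⟩ := (finRotate n).surjective i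
    have hv0 := hQ.edgeDir_ne_zero hn2 j
    have ho := hout (finRotate n j)
    refine ⟨edgeDir Q j, haxes j, τ (finRotate n j), hτ _, 4 * ε, by linarith, ?_, ?_⟩
    · intro hR x hx hxE
      have h : τ (finRotate n j) = s := (hcase _).resolve_right (by simpa using hR)
      have e2 : Q (finRotate n j) + ε * (edgeDir Q (finRotate n j) -
          s * Complex.I * edgeDir Q (finRotate n j)) =
          Q (finRotate n j) + ε * (((1 : ℝ) + (s : ℝ) * Complex.I) * edgeDir Q j) := by
        rw [hturn, h]
        push_cast
        linear_combination (ε * edgeDir Q j) * hssc - (ε * edgeDir Q j * s * s) * Complex.I_mul_I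
      rw [e2, hQ.mem_environment_iff_of_outer hn2 hτ hturn hε j
        (hQ.offset_mem_ball hn2 hε _ _ (a := 1) (b := s) (by simp) hsabs) (Or.inl (by
          rw [offset_coords hv0, re_add_mul_I]; linarith))] at ho
      by_contra! hcon
      refine ho ((hQ.mem_environment_iff_of_outer hn2 hτ hturn hε j hx ?_).1 hxE)
      rcases lt_or_ge 0 ((x - Q (finRotate n j)) / edgeDir Q j).re with h0 | h0
      · exact Or.inl h0
      · exact Or.inr (hcon h0)
    · intro hR x hx hx1 hx2 hxE
      have h : τ (finRotate n j) = -s := by simpa using hR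
      have e2 : Q (finRotate n j) + ε * (edgeDir Q (finRotate n j) -
          s * Complex.I * edgeDir Q (finRotate n j)) =
          Q (finRotate n j) + ε * (((-1 : ℝ) + (-s : ℝ) * Complex.I) * edgeDir Q j) := by
        rw [hturn, h]
        push_cast
        linear_combination (-ε * edgeDir Q j) * hssc + (ε * edgeDir Q j * s * s) * Complex.I_mul_I
      rw [e2] at ho
      refine ho ((hQ.mem_environment_iff_of_inner hn2 hτ hturn hε j hx hx1 hx2
        (hQ.offset_mem_ball hn2 hε _ _ (a := -1) (b := -s) (by simp) (by rw [abs_neg]; exact hsabs)) ?_ ?_).1 hxE)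
      · rw [offset_coords hv0, re_add_mul_I]; linarith
      · rw [offset_coords hv0, im_add_mul_I, h]
        have : -s * (ε * -s) = ε * (s * s) := by ring
        rw [this, hss]
        linarith

end Offset

end PTSS

namespace PTSS

/-! ### Reflex vertices of an orthogonal polygon -/

section Orthogonal

variable {n : ℕ} {Q : Polygon ℂ n}

/-- At a vertex outside `R` the environment is confined to a quadrant, so its angle is at most π;
hence every reflex vertex belongs to `R`. This inclusion suffices. -/
theorem IsSimple.two_mul_numReflex_add_four_le (hQ : IsSimple Q) (hn : 3 ≤ n)
    (hO : IsOrthogonal Q) : 2 * numReflex Q + 4 ≤ n := by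
  obtain ⟨R, u, hR, hu, h⟩ := hQ.exists_quadrants hn hO
  have hsub : {i : Fin n | Real.pi < interiorAngle (environment Q) (Q i)} ⊆ (R : Set (Fin n)) := by
    intro i hi
    by_contra hiR
    obtain ⟨v, hv, t, ht, δ, hδ, h1, -⟩ := h i
    have hv0 : v ≠ 0 := by
      rintro rfl
      simp only [zero_div, zero_eq_neg, Complex.I_ne_zero, (Complex.I_ne_zero).symm, zero_ne_one, or_false, one_ne_zero] at hv
    refine absurd (PTSS.interiorAngle_le_pi (w := -v⁻¹) (neg_ne_zero.2 (inv_ne_zero hv0))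
      fun θ hθ => ?_) (not_le.2 hi)
    obtain ⟨ε, hε, hx⟩ := hθ
    have hm := lt_min hε hδ
    obtain ⟨ρ, hρ0, hρ1, hρ2⟩ : ∃ ρ : ℝ, 0 < ρ ∧ ρ < ε ∧ ρ < δ :=
      ⟨min ε δ / 2, by linarith, by have := min_le_left ε δ; linarith,
        by have := min_le_right ε δ; linarith⟩
    have h2 := (h1 hiR _ (by
      rw [mem_ball_iff_norm, add_sub_cancel_left, norm_mul, norm_unit, mul_one, Complex.norm_real,
        Real.norm_eq_abs, abs_of_pos hρ0]
      exact hρ2) (hx ρ ⟨hρ0, hρ1⟩)).1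
    rw [add_sub_cancel_left, mul_div_assoc, Complex.re_ofReal_mul, div_eq_inv_mul] at h2
    rw [neg_mul, Complex.neg_re]
    have := nonpos_of_mul_nonpos_right h2 hρ0
    linarith
  have := ncard_le_ncard hsub (toFinite _)
  rw [ncard_coe_finset] at this
  have h3 : numReflex Q ≤ R.card := this
  omega

end Orthogonal

/-! ### Directions entering a convex quadrilateral -/

section Directions

/-- The direction `g` leads from `p` into `S`. -/
def Enters (S : Set ℂ) (p g : ℂ) : Prop := ∃ ε > 0, ∀ ρ ∈ Ioo (0 : ℝ) ε, p + ρ * g ∈ S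

theorem Enters.mono {S T : Set ℂ} {p g : ℂ} (h : Enters S p g) (hST : S ⊆ T) : Enters T p g := by
  obtain ⟨ε, hε, h⟩ := h
  exact ⟨ε, hε, fun ρ hρ => hST (h ρ hρ)⟩

theorem Enters.exists_mem_inter {S T : Set ℂ} {p g : ℂ} (h : Enters S p g) (h' : Enters T p g) :
    (S ∩ T).Nonempty := by
  obtain ⟨ε, hε, h⟩ := h
  obtain ⟨ε', hε', h'⟩ := h'
  have hm := lt_min hε hε'
  have h1 := min_le_left ε ε'
  have h2 := min_le_right ε ε'
  exact ⟨p + (min ε ε' / 2 : ℝ) * g, h _ ⟨by linarith, by linarith⟩, h' _ ⟨by linarith, by linarith⟩⟩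

theorem Enters.exists_mem_ball {S : Set ℂ} {p g : ℂ} (h : Enters S p g) {δ : ℝ} (hδ : 0 < δ) :
    ∃ ρ : ℝ, 0 < ρ ∧ p + ρ * g ∈ S ∧ p + ρ * g ∈ Metric.ball p δ := by
  obtain ⟨ε, hε, h⟩ := h
  have hc : Filter.Tendsto (fun t : ℝ => p + t * g) (𝓝[>] 0) (𝓝 p) := by
    have : Continuous fun t : ℝ => p + t * g := by fun_prop
    have := this.tendsto 0
    simp only [Complex.ofReal_zero, zero_mul, add_zero] at this
    exact this.mono_left nhdsWithin_le_nhds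
  obtain ⟨t, ht, ht0⟩ := ((hc.eventually (Metric.ball_mem_nhds p hδ)).and
    (Ioo_mem_nhdsGT hε)).exists
  exact ⟨t, ht0.1, h t ht0, ht⟩

theorem enters_interior_of_mem {K : Set ℂ} (hK : Convex ℝ K) {p g : ℂ} (hp : p ∈ K) {r : ℝ}
    (hr : 0 < r) (hw : p + r * g ∈ interior K) : Enters (interior K) p g := by
  refine ⟨r, hr, fun ρ hρ => hK.openSegment_closure_interior_subset_interior
    (subset_closure hp) hw ?_⟩
  rw [openSegment_eq_image']
  refine ⟨ρ / r, ⟨div_pos hρ.1 hr, (div_lt_one hr).2 hρ.2⟩, ?_⟩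
  have : (r : ℂ) ≠ 0 := by exact_mod_cast hr.ne'
  simp only [Complex.real_smul]
  push_cast
  field_simp
  ring

/-- A line in direction `g` through a point of a convex region, with points of the region on both
sides, meets the interior of the region. -/
theorem enters_or_enters_neg {K : Set ℂ} (hK : Convex ℝ K) (hreg : closure (interior K) = K)
    {p a b g : ℂ} (hg : g ≠ 0) (hp : p ∈ K) (ha : a ∈ K) (hb : b ∈ K)
    (hap : (a / g).im < (p / g).im) (hpb : (p / g).im < (b / g).im) :
    Enters (interior K) p g ∨ Enters (interior K) p (-g) := by
  have hcont : Continuous fun z : ℂ => (z / g).im := by fun_prop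
  have ha' : a ∈ closure (interior K) := hreg.symm ▸ ha
  have hb' : b ∈ closure (interior K) := hreg.symm ▸ hb
  obtain ⟨y, hy1, hy2⟩ := mem_closure_iff.1 ha' _
    (isOpen_lt hcont continuous_const) hap
  obtain ⟨z, hz1, hz2⟩ := mem_closure_iff.1 hb' _
    (isOpen_lt continuous_const hcont) hpb
  obtain ⟨w, hw, hwp⟩ := hK.interior.isPreconnected.intermediate_value hy2 hz2
    hcont.continuousOn ⟨le_of_lt hy1, le_of_lt hz1⟩
  simp only at hwp
  set r : ℝ := (w / g).re - (p / g).re with hr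
  have hwr : w = p + r * g := by
    have : w / g = p / g + r := by
      apply Complex.ext
      · simp [hr]
      · simp [hwp]
    field_simp at this
    rw [this]
    ring
  rcases lt_trichotomy r 0 with h | h | h
  · right
    refine enters_interior_of_mem hK hp (r := -r) (by linarith) ?_
    convert hw using 1
    rw [hwr]; push_cast; ring
  · left
    rw [h, Complex.ofReal_zero, zero_mul, add_zero] at hwr
    rw [hwr] at hw
    obtain ⟨ε, hε, hball⟩ := Metric.isOpen_iff.1 isOpen_interior p hw
    have hg' : 0 < ‖g‖ := norm_pos_iff.2 hg
    refine ⟨ε / ‖g‖, by positivity, fun ρ hρ => hball ?_⟩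
    rw [mem_ball_iff_norm, add_sub_cancel_left, norm_mul, Complex.norm_real, Real.norm_eq_abs,
      abs_of_pos hρ.1]
    exact (lt_div_iff₀ hg').1 hρ.2
  · left
    exact enters_interior_of_mem hK hp h (hwr ▸ hw)

open Classical in
/-- Four points in general position with respect to the direction `g`: from at least two of them
the direction `g` or the opposite direction leads into the convex hull. -/
theorem two_le_card_enters {p : Fin 4 → ℂ} {K : Set ℂ} (hK : K = convexHull ℝ (range p))
    (hreg : closure (interior K) = K) {g : ℂ} (hg : g ≠ 0)
    (hgen : ∀ a b, a ≠ b → ((p a - p b) / g).im ≠ 0) :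
    2 ≤ (Finset.univ.filter fun m => Enters (interior K) (p m) g ∨
      Enters (interior K) (p m) (-g)).card := by
  have hconv : Convex ℝ K := hK ▸ convex_convexHull ℝ _
  have hmem : ∀ m, p m ∈ K := fun m => hK ▸ subset_convexHull ℝ _ (mem_range_self m)
  obtain ⟨a, ha⟩ := Finite.exists_min fun m => (p m / g).im
  obtain ⟨b, hb⟩ := Finite.exists_max fun m => (p m / g).im
  have hlt : ∀ x y, x ≠ y → (p x / g).im ≤ (p y / g).im → (p x / g).im < (p y / g).im := by
    intro x y hxy hle
    refine lt_of_le_of_ne hle fun h => hgen x y hxy ?_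
    rw [sub_div, Complex.sub_im, h, sub_self]
  -- The lines in direction `g` through the corners other than the two extreme ones pass strictly
  -- between those two, hence through the interior.
  have hsub : (Finset.univ \ {a, b} : Finset (Fin 4)) ⊆ Finset.univ.filter fun m =>
      Enters (interior K) (p m) g ∨ Enters (interior K) (p m) (-g) := by
    intro m hm
    simp only [Finset.mem_sdiff, Finset.mem_univ, Finset.mem_insert, Finset.mem_singleton,
      true_and, not_or] at hm
    refine Finset.mem_filter.2 ⟨Finset.mem_univ _, ?_⟩
    exact enters_or_enters_neg hconv hreg hg (hmem m) (hmem a) (hmem b)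
      (hlt a m (Ne.symm hm.1) (ha m)) (hlt m b hm.2 (hb m))
  refine le_trans ?_ (Finset.card_le_card hsub)
  have h1 := Finset.le_card_sdiff ({a, b} : Finset (Fin 4)) Finset.univ
  have h2 : ({a, b} : Finset (Fin 4)).card ≤ 2 := Finset.card_le_two
  rw [Finset.card_univ, Fintype.card_fin] at h1
  omega

/-- The four directions obtained from `g` by quarter turns. -/
noncomputable def quarterTurn (g : ℂ) (k : Fin 4) : ℂ := Complex.I ^ (k : ℕ) * g

theorem quarterTurn_zero (g : ℂ) : quarterTurn g 0 = g := by simp [quarterTurn]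

theorem quarterTurn_one (g : ℂ) : quarterTurn g 1 = Complex.I * g := by simp [quarterTurn]

theorem quarterTurn_two (g : ℂ) : quarterTurn g 2 = -g := by simp [quarterTurn]

theorem quarterTurn_three (g : ℂ) : quarterTurn g 3 = -(Complex.I * g) := by
  simp [quarterTurn, pow_succ]

theorem quarterTurn_div (g v : ℂ) (k : Fin 4) : quarterTurn g k / v = quarterTurn (g / v) k :=
  mul_div_assoc _ _ _

-- A discrete form of the angle sum 2π: two corners are entered along ±`g`, and two along ±`I * g`.
open Classical in
theorem four_le_card_enters {p : Fin 4 → ℂ} {K : Set ℂ} (hK : K = convexHull ℝ (range p))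
    (hreg : closure (interior K) = K) {g : ℂ} (hg : g ≠ 0)
    (hgen : ∀ a b, a ≠ b → ((p a - p b) / g).im ≠ 0 ∧ ((p a - p b) / g).re ≠ 0) :
    4 ≤ ∑ m : Fin 4, ∑ k : Fin 4,
      if Enters (interior K) (p m) (quarterTurn g k) then 1 else 0 := by
  have h1 := two_le_card_enters hK hreg hg fun a b hab => (hgen a b hab).1
  have h2 := two_le_card_enters hK hreg (g := Complex.I * g) (mul_ne_zero Complex.I_ne_zero hg)
    fun a b hab => by
      have := (hgen a b hab).2
      rw [show (p a - p b) / (Complex.I * g) = -(Complex.I * ((p a - p b) / g)) by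
        have := Complex.I_ne_zero
        field_simp
        rw [Complex.I_sq]
        ring, Complex.neg_im, Complex.I_mul_im]
      simpa using this
  rw [Finset.card_filter] at h1 h2
  have h3 := Nat.add_le_add h1 h2
  rw [← Finset.sum_add_distrib] at h3
  refine le_trans h3 (Finset.sum_le_sum fun m _ => ?_)
  rw [Fin.sum_univ_four, quarterTurn_zero, quarterTurn_one, quarterTurn_two, quarterTurn_three]
  split_ifs <;> first | omega | tauto

end Directions

/-! ### Counting the quadrilaterals -/

section Count

theorem eq_of_quarterTurn_mem {c : ℂ} (hp : c.re ≠ 0) (hq : c.im ≠ 0) {t : ℝ}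
    (ht : t = 1 ∨ t = -1) {k k' : Fin 4}
    (h : (quarterTurn c k).re ≤ 0 ∧ 0 ≤ t * (quarterTurn c k).im)
    (h' : (quarterTurn c k').re ≤ 0 ∧ 0 ≤ t * (quarterTurn c k').im) : k = k' := by
  rcases ht with rfl | rfl <;> fin_cases k <;> fin_cases k' <;>
    simp [quarterTurn_zero, quarterTurn_one, quarterTurn_two, quarterTurn_three] at h h' ⊢ <;>
    first
    | exact hp (by linarith)
    | exact hq (by linarith)

theorem exists_quarterTurn_mem {c : ℂ} (hp : c.re ≠ 0) (hq : c.im ≠ 0) {t : ℝ}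
    (ht : t = 1 ∨ t = -1) :
    ∃ k : Fin 4, (quarterTurn c k).re < 0 ∧ 0 < t * (quarterTurn c k).im := by
  have h0 : ∀ s : ℝ, (c.re < 0 ∧ 0 < s * c.im) ∨ (-c.im < 0 ∧ 0 < s * c.re) ∨
      (-c.re < 0 ∧ 0 < s * -c.im) ∨ (c.im < 0 ∧ 0 < s * -c.re) →
      ∃ k : Fin 4, (quarterTurn c k).re < 0 ∧ 0 < s * (quarterTurn c k).im := by
    rintro s (h | h | h | h)
    · exact ⟨0, by rw [quarterTurn_zero]; exact h⟩
    · exact ⟨1, by rw [quarterTurn_one, Complex.I_mul_re, Complex.I_mul_im]; exact h⟩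
    · exact ⟨2, by rw [quarterTurn_two, Complex.neg_re, Complex.neg_im]; exact h⟩
    · exact ⟨3, by
        rw [quarterTurn_three, Complex.neg_re, Complex.neg_im, Complex.I_mul_re,
          Complex.I_mul_im, neg_neg]
        exact h⟩
  apply h0
  rcases ht with rfl | rfl <;> rcases hp.lt_or_gt with hp | hp <;>
    rcases hq.lt_or_gt with hq | hq <;> simp [hp, hq]

/-- Each nonzero `d i` excludes at most two slopes: those making the direction parallel or
perpendicular to it. Positivity of `x` keeps the direction off the coordinate axes as well. -/
theorem exists_generic_slope {ι : Type*} [Finite ι] (d : ι → ℂ) :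
    ∃ x : ℝ, 0 < x ∧ ∀ i, d i ≠ 0 →
      (d i / (1 + x * Complex.I)).im ≠ 0 ∧ (d i / (1 + x * Complex.I)).re ≠ 0 := by
  have hfin : (range (fun i => (d i).im / (d i).re) ∪
    range (fun i => -(d i).re / (d i).im)).Finite := (finite_range _).union (finite_range _)
  obtain ⟨x, hx0, hx⟩ := (Ioi_infinite (0 : ℝ)).exists_notMem_finite hfin
  refine ⟨x, hx0, fun i hi => ?_⟩
  have hx1 : (1 + x * Complex.I : ℂ) ≠ 0 := by
    intro h
    have := congrArg Complex.re h
    simp at this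
  set c := d i / (1 + x * Complex.I) with hc
  have hd : d i = c * (1 + x * Complex.I) := by rw [hc]; field_simp
  have hc0 : c ≠ 0 := div_ne_zero hi hx1
  have e1 : (d i).re = c.re - x * c.im := by rw [hd]; simp; ring
  have e2 : (d i).im = c.im + x * c.re := by rw [hd]; simp; ring
  constructor
  · intro h
    have h1 : c.re ≠ 0 := fun h' => hc0 (Complex.ext h' h)
    refine hx (Or.inl ⟨i, ?_⟩)
    simp only
    rw [e1, e2, h]
    rw [mul_zero, sub_zero, zero_add, mul_div_cancel_right₀ _ h1]
  · intro h
    have h1 : c.im ≠ 0 := fun h' => hc0 (Complex.ext h h')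
    refine hx (Or.inr ⟨i, ?_⟩)
    simp only
    rw [e1, e2, h]
    rw [mul_zero, add_zero, zero_sub, neg_neg, mul_div_cancel_right₀ _ h1]

variable {n N : ℕ} {Q : Polygon ℂ n} {cell : Fin N → Set ℂ}

open Classical in
/-- The number of convex quadrilaterals with corners at the vertices that partition the
environment of an orthogonal polygon. -/
theorem IsSimple.two_mul_add_two_le (hQ : IsSimple Q) (hn : 3 ≤ n) (hO : IsOrthogonal Q)
    (hP : IsPartition (environment Q) cell) (hq : IsQuadrilateralPartition Q cell) :
    2 * N + 2 ≤ n := by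
  obtain ⟨R, u, hR, hu, h⟩ := hQ.exists_quadrants hn hO
  choose f hf hcell using hq
  obtain ⟨x, hx0, hx⟩ := exists_generic_slope fun q : Fin n × Fin n => (Q q.1 - Q q.2) / u
  set ξ : ℂ := 1 + x * Complex.I with hξ
  have hξ0 : ξ ≠ 0 := by
    intro h
    have := congrArg Complex.re h
    simp [hξ] at this
  have hcoord : ∀ v : ℂ, (v / u = 1 ∨ v / u = -1 ∨ v / u = Complex.I ∨ v / u = -Complex.I) →
      (ξ * u / v).re ≠ 0 ∧ (ξ * u / v).im ≠ 0 := by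
    intro v hv
    have : ξ * u / v = ξ / (v / u) := by
      field_simp
    rw [this]
    rcases hv with h | h | h | h <;> rw [h] <;> simp [hξ, div_neg, hx0.ne']
  -- Exactly one quarter turn of a generic direction falls into a given quadrant. Outside `R` at
  -- most that one enters the environment; in `R` that one is excluded.
  have hcount : ∀ i, (∑ k : Fin 4,
      if Enters (environment Q) (Q i) (quarterTurn (ξ * u) k) then 1 else 0) ≤
      if i ∈ R then 3 else 1 := by
    intro i
    obtain ⟨v, hv, t, ht, δ, hδ, h1, h2⟩ := h i
    obtain ⟨hre, him⟩ := hcoord v hv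
    rw [← Finset.card_filter]
    have hpt : ∀ (ρ : ℝ) k, (Q i + ρ * quarterTurn (ξ * u) k - Q i) / v =
        ρ * quarterTurn (ξ * u / v) k := by
      intro ρ k
      rw [← quarterTurn_div, add_sub_cancel_left, mul_div_assoc]
    split_ifs with hi
    · obtain ⟨k, hk1, hk2⟩ := exists_quarterTurn_mem hre him ht
      have hsub : (Finset.univ.filter fun k =>
          Enters (environment Q) (Q i) (quarterTurn (ξ * u) k)) ⊆ Finset.univ.erase k := by
        intro k' hk'
        refine Finset.mem_erase.2 ⟨?_, Finset.mem_univ _⟩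
        rintro rfl
        obtain ⟨ρ, hρ, hE, hb⟩ := (Finset.mem_filter.1 hk').2.exists_mem_ball hδ
        refine h2 hi _ hb ?_ ?_ hE
        · rw [hpt, Complex.re_ofReal_mul]
          exact mul_neg_of_pos_of_neg hρ hk1
        · rw [hpt, Complex.im_ofReal_mul, mul_left_comm]
          exact mul_pos hρ hk2
      have := Finset.card_le_card hsub
      simpa using this
    · refine Finset.card_le_one.2 fun k hk k' hk' => ?_
      have key : ∀ k, Enters (environment Q) (Q i) (quarterTurn (ξ * u) k) →
          (quarterTurn (ξ * u / v) k).re ≤ 0 ∧ 0 ≤ t * (quarterTurn (ξ * u / v) k).im := by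
        intro k hk
        obtain ⟨ρ, hρ, hE, hb⟩ := hk.exists_mem_ball hδ
        have h3 := h1 hi _ hb hE
        rw [hpt, Complex.re_ofReal_mul, Complex.im_ofReal_mul, mul_left_comm] at h3
        exact ⟨nonpos_of_mul_nonpos_right h3.1 hρ, nonneg_of_mul_nonneg_right h3.2 hρ⟩
      exact eq_of_quarterTurn_mem hre him ht (key k (Finset.mem_filter.1 hk).2)
        (key k' (Finset.mem_filter.1 hk').2)
  set S : Finset (Fin N × Fin 4 × Fin 4) := Finset.univ.filter fun q =>
    Enters (interior (cell q.1)) (Q (f q.1 q.2.1)) (quarterTurn (ξ * u) q.2.2) with hS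
  set T : Finset (Fin n × Fin 4) := Finset.univ.filter fun q =>
    Enters (environment Q) (Q q.1) (quarterTurn (ξ * u) q.2) with hT
  have hScard : 4 * N ≤ S.card := by
    rw [hS, Finset.card_filter, Fintype.sum_prod_type]
    have h4 : ∀ c, 4 ≤ ∑ q : Fin 4 × Fin 4, if Enters (interior (cell c)) (Q (f c q.1))
        (quarterTurn (ξ * u) q.2) then 1 else 0 := by
      intro c
      rw [Fintype.sum_prod_type]
      refine four_le_card_enters (p := fun m => Q (f c m)) (hcell c) (hP.region c)
        (mul_ne_zero hξ0 hu) fun a b hab => ?_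
      have := hx (f c a, f c b) (div_ne_zero
        (sub_ne_zero.2 (hQ.injective.ne ((hf c).ne hab))) hu)
      rwa [div_div, mul_comm u] at this
    have := Finset.card_nsmul_le_sum Finset.univ _ 4 fun c _ => h4 c
    rw [Finset.card_univ, Fintype.card_fin, smul_eq_mul, mul_comm] at this
    exact this
  have hTcard : T.card ≤ n + 2 * R.card := by
    rw [hT, Finset.card_filter, Fintype.sum_prod_type]
    refine (Finset.sum_le_sum fun i _ => hcount i).trans ?_
    have : ∀ i, (if i ∈ R then 3 else 1) = 1 + if i ∈ R then 2 else 0 := by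
      intro i; split_ifs <;> rfl
    rw [Finset.sum_congr rfl fun i _ => this i, Finset.sum_add_distrib, Finset.sum_ite_mem]
    simp
    omega
  -- Two cells entered from the same vertex in the same direction would have a common interior
  -- point, so remembering only the vertex and the direction loses nothing.
  have hST : S.card ≤ T.card := by
    refine Finset.card_le_card_of_injOn (fun q => (f q.1 q.2.1, q.2.2)) ?_ ?_
    · rintro ⟨c, m, k⟩ hq
      have hq := (Finset.mem_filter.1 (Finset.mem_coe.1 hq)).2
      refine Finset.mem_coe.2 (Finset.mem_filter.2 ⟨Finset.mem_univ _, hq.mono ?_⟩)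
      refine interior_subset.trans ?_
      rw [← hP.iUnion_eq]
      exact subset_iUnion _ c
    · rintro ⟨c, m, k⟩ hq ⟨c', m', k'⟩ hq' heq
      have hq := (Finset.mem_filter.1 (Finset.mem_coe.1 hq)).2
      have hq' := (Finset.mem_filter.1 (Finset.mem_coe.1 hq')).2
      simp only [Prod.mk.injEq] at heq hq hq'
      obtain ⟨h1, rfl⟩ := heq
      have hcc : c = c' := by
        by_contra hne
        rw [← h1] at hq'
        obtain ⟨z, hz, hz'⟩ := hq.exists_mem_inter hq'
        exact disjoint_left.1 (hP.disjoint c c' hne) hz hz'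
      subst hcc
      rw [hf c h1]
  omega

end Count

end PTSS

theorem mainTheorem3 {n N : ℕ} (hn : 3 ≤ n) (Q : Polygon ℂ n) (hQ : PTSS.IsSimple Q)
    (cell : Fin N → Set ℂ) (root : Fin N) (pos : Fin N → ℂ)
    (hT : PTSS.IsPTSSTree (PTSS.environment Q) cell root pos)
    (ω : ℝ) (hω : 0 < ω)
    (X : PTSS.Execution (PTSS.environment Q) cell root pos ω) :
    PTSS.ClearedBy (PTSS.environment Q) X.lit
      (2 * Real.pi / ω * ((PTSS.height cell root : ℝ) + 1)) ∧
    (PTSS.IsRVS (PTSS.environment Q) cell root pos →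
      PTSS.ClearedBy (PTSS.environment Q) X.lit
        (2 * Real.pi / ω * ((PTSS.numReflex Q : ℝ) + 1))) ∧
    2 * Real.pi / ω * ((PTSS.numReflex Q : ℝ) + 1) ≤ 2 * Real.pi / ω * ((n : ℝ) - 2) ∧
    (PTSS.IsOrthogonal Q →
      (PTSS.IsRVS (PTSS.environment Q) cell root pos ∨
        PTSS.IsQuadrilateralPartition Q cell) →
      PTSS.ClearedBy (PTSS.environment Q) X.lit (Real.pi / ω * ((n : ℝ) - 2))) := by
  have hc : 0 < 2 * Real.pi / ω := by have := Real.pi_pos; positivity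
  have hh := PTSS.height_lt (root := root) hT.partition.tree
  refine ⟨X.clearedBy hT hω le_rfl, fun hR => X.clearedBy hT hω ?_, ?_, fun hO h =>
    X.clearedBy hT hω ?_⟩
  · have h1 := hR.le_numReflex (by omega) hQ hT
    have h2 : (PTSS.height cell root : ℝ) ≤ PTSS.numReflex Q := by
      exact_mod_cast (by omega : PTSS.height cell root ≤ PTSS.numReflex Q)
    gcongr
  · have h1 : ((PTSS.numReflex Q + 3 : ℕ) : ℝ) ≤ n :=
      Nat.cast_le.2 (hQ.numReflex_add_three_le hn)
    push_cast at h1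
    refine mul_le_mul_of_nonneg_left ?_ hc.le
    linarith
  · have h1 : 2 * N + 2 ≤ n := by
      rcases h with hR | hq
      · have h1 := hR.le_numReflex (by omega) hQ hT
        have h2 := hQ.two_mul_numReflex_add_four_le hn hO
        omega
      · exact hQ.two_mul_add_two_le hn hO hT.partition.partition hq
    -- Both deployments give 2N + 2 ≤ n, and h + 1 ≤ N turns the factor h + 1 into (n - 2) / 2.
    have h2 : ((2 * (PTSS.height cell root + 1) + 2 : ℕ) : ℝ) ≤ n := Nat.cast_le.2 (by omega)
    push_cast at h2
    have h3 : Real.pi / ω * ((n : ℝ) - 2) = 2 * Real.pi / ω * (((n : ℝ) - 2) / 2) := by ring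
    rw [h3]
    refine mul_le_mul_of_nonneg_left ?_ hc.le
    linarith
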